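/- Setting. Let $d\ge 1$ and let $\Omega\subset\mathbb R^d$ be an open set whose closure is triangulated by a finite conforming simplicial mesh (for instance a bounded polytopal Lipschitz domain). Let $S$ be any linear space of continuous functions that vanish outside $\Omega$ and are polynomials of degree at most $p_x\ge 1$ on each $d$-simplex of the mesh; such functions belong to $H^1_0(\Omega)$. Let $c\in C(\overline\Omega)$ with $c\ge c_0>0$ in $\Omega$, let $g:\mathbb R\to\mathbb R$ be continuous with $g(0)=0$, let $T>0$ and $F\in C([0,T];L^2(\Omega))$. Write $(\cdot,\cdot)$ for the inner product of $L^2(\Omega)$. Let $0=t_0<\dots<t_N=T$, $h_n=t_n-t_{n-1}$, $p\ge 1$. Let $Q$ be the space of continuous functions $[0,T]\to S$ that are polynomials of degree at most $p$ in time on each $[t_{n-1},t_n]$. Let $U_0,V_0\in S$. For nodes $x_i\in[0,1]$ with interpolatory weights $b_i$ put $\mathcal Q_n(\varphi)=h_n\sum_i b_i\,\varphi(t_{n-1}+x_ih_n)$ and $\mathcal Q=\sum_{n=1}^N\mathcal Q_n$. The quadrature scheme is: find $U\in Q$ with $U(0)=U_0$ and $$-\int_0^T(\partial_tU,\partial_tW)\,dt+\mathcal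 Q\big((c^2\nabla U,\nabla W)\big)+\mathcal Q\big((g(U),W)\big)=\mathcal Q\big((F,W)\big)+(V_0,W(0))$$ for all $W\in Q$ with $W(T)=0$. It is called (GLe) if the $x_i$ are the $p$ Gauss–Legendre nodes and (GLo) if they are the $p+1$ Gauss–Lobatto nodes. Semi-discrete system. For all $t\in[0,T]$ and $u\in S$ there is exactly one $a=a(t,u)\in S$ with $(a,w)+(c^2\nabla u,\nabla w)+(g(u),w)=(F(t),w)$ for all $w\in S$. Thus the first-order-in-time system semi-discretized in space is the ordinary differential equation $U'=V$, $V'=a(t,U)$ in $S\times S$. Theorem. (1) Every solution $U$ of (GLe) has exactly one reconstructed velocity, i.e. exactly one $\widetilde V\in Q$ with $\widetilde V(0)=V_0$ and $\int_0^T(\widetilde V,\partial_tW)\,dt=\int_0^T(\partial_tU,\partial_tW)\,dt$ for all $W\in Q$. For $U,\widetilde V\in Q$, the following are equivalent: $U$ solves (GLe) and $\widetilde V$ is its reconstructed velocity; the values of $(U,\widetilde V)$ at the mesh nodes $t_n$ and at the points $t_{n-1}+x_ih_n$ are the approximations and the internal stages of a solution of the $p$-stage Gauss–Legendre Runge–Kutta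 method, applied to the semi-discrete system with initial value $(U_0,V_0)$. Every solution (with its stages) of that Runge–Kutta method is obtained in this way from exactly one pair $(U,\widetilde V)$. (2) For every solution $U$ of (GLo) there is exactly one family of hybrid velocities, i.e. $\widehat V_0,\dots,\widehat V_N\in S$ with $\widehat V_0=V_0$ and, for $n=1,\dots,N$ and all polynomials $\lambda$ on $[t_{n-1},t_n]$ of degree at most $p$ with values in $S$, $$\int_{t_{n-1}}^{t_n}(\partial_t^2U,\lambda)\,dt+\big(\widehat V_n-\partial_tU(t_n^-),\lambda(t_n)\big)-\big(\widehat V_{n-1}-\partial_tU(t_{n-1}^+),\lambda(t_{n-1})\big)+\mathcal Q_n\big((c^2\nabla U,\nabla\lambda)+(g(U),\lambda)\big)=\mathcal Q_n\big((F,\lambda)\big).$$ For $U\in Q$ and $\widehat V_0,\dots,\widehat V_N\in S$, the following are equivalent: $U$ solves (GLo) and the $\widehat V_n$ are its hybrid velocities; the values $U(t_n)$, $\widehat V_n$, with the internal stages $U$ and (one-sided) $\partial_tU$ at the points $t_{n-1}+x_ih_n$, form a solution of the $(p+1)$-stage Lobatto IIIA/IIIB partitioned Runge–Kutta method (IIIA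 for $U$, IIIB for $V$), applied to the semi-discrete system with initial value $(U_0,V_0)$. Every solution (with its stages) of that method is obtained in this way from exactly one $U$. (3) If moreover $g\in C^1(\mathbb R)$, both schemes are symplectic. Precisely, let $D\subset S\times S$ be open and let $(U_0,V_0)\mapsto U$ assign to each $(U_0,V_0)\in D$ a solution of (GLe) (respectively (GLo)) with these initial data, such that $U(t)$ is differentiable in $(U_0,V_0)\in D$ for each $t\in[0,T]$. Then for each $n$ the numerical flow $(U_0,V_0)\mapsto(U(t_n),\widetilde V(t_n))$ (respectively $(U_0,V_0)\mapsto(U(t_n),\widehat V_n)$) is differentiable on $D$, and its derivative preserves the symplectic form $\omega(\xi,\eta)=(\xi_1,\eta_2)-(\xi_2,\eta_1)$ on $S\times S$. -/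

import Mathlib

open Set MeasureTheory Polynomial
open scoped BoundedContinuousFunction

noncomputable section

/-! ### Space discretization -/

/-- The Euclidean space `ℝ^d`. -/
abbrev RSpace (d : ℕ) : Type := EuclideanSpace ℝ (Fin d)

/-- Continuous finite element functions of degree at most `p` on the simplicial mesh `K`, with
homogeneous Dirichlet conditions.  They are represented by their extension by zero to `ℝ^d`: bounded
continuous functions that vanish off `Ω` and that agree, on every `d`-simplex of `K`, with a
polynomial of total degree at most `p`. These are the piecewise polynomials in `H¹₀(Ω)`. -/
def feSpace {d : ℕ} (Ω : Set (RSpace d)) (K : Geometry.SimplicialComplex ℝ (RSpace d)) (p : ℕ) :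
    Submodule ℝ (RSpace d →ᵇ ℝ) where
  carrier := {u | (∀ x ∉ Ω, u x = 0) ∧ ∀ s ∈ K.faces, s.card = d + 1 →
    ∃ q : MvPolynomial (Fin d) ℝ, q.totalDegree ≤ p ∧
      ∀ x ∈ convexHull ℝ (s : Set (RSpace d)), u x = MvPolynomial.eval (fun i => x i) q}
  add_mem' := by
    rintro u v ⟨hu, hu'⟩ ⟨hv, hv'⟩
    refine ⟨fun x hx => by simp [hu x hx, hv x hx], fun s hs hc => ?_⟩
    obtain ⟨q, hq, hq'⟩ := hu' s hs hc
    obtain ⟨r, hr, hr'⟩ := hv' s hs hc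
    exact ⟨q + r, (MvPolynomial.totalDegree_add q r).trans (max_le hq hr),
      fun x hx => by simp [hq' x hx, hr' x hx]⟩
  zero_mem' := ⟨fun x _ => rfl, fun s _ _ => ⟨0, by simp, fun x _ => by simp⟩⟩
  smul_mem' := by
    rintro a u ⟨hu, hu'⟩
    refine ⟨fun x hx => by simp [hu x hx], fun s hs hc => ?_⟩
    obtain ⟨q, hq, hq'⟩ := hu' s hs hc
    exact ⟨a • q, (MvPolynomial.totalDegree_smul_le a q).trans hq, fun x hx => by
      simp [hq' x hx, MvPolynomial.smul_eval]⟩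

/-- `(u, w)_{L²(Ω)}`. -/
def massForm {d : ℕ} (Ω : Set (RSpace d)) (u w : RSpace d →ᵇ ℝ) : ℝ :=
  ∫ x in Ω, u x * w x

/-- `(c² ∇u, ∇w)_{L²(Ω)}`.  For finite element functions the classical gradient exists off the
boundaries of the cells, hence almost everywhere, and is the weak gradient. -/
def stiffForm {d : ℕ} (Ω : Set (RSpace d)) (c : RSpace d → ℝ) (u w : RSpace d →ᵇ ℝ) : ℝ :=
  ∫ x in Ω, c x ^ 2 * inner ℝ (gradient (⇑u) x) (gradient (⇑w) x)

/-- `(g(u), w)_{L²(Ω)}`. -/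
def nonlinForm {d : ℕ} (Ω : Set (RSpace d)) (g : ℝ → ℝ) (u w : RSpace d →ᵇ ℝ) : ℝ :=
  ∫ x in Ω, g (u x) * w x

/-- `(f, w)_{L²(Ω)}` for a source `f ∈ L²(Ω)`. -/
def loadForm {d : ℕ} (Ω : Set (RSpace d)) (f : Lp ℝ 2 (volume.restrict Ω)) (w : RSpace d →ᵇ ℝ) :
    ℝ :=
  ∫ x in Ω, f x * w x

/-- `a ∈ S` is the acceleration of the semi-discrete wave equation at time `t` and displacement
`u ∈ S`: `(a, w) + (c² ∇u, ∇w) + (g(u), w) = (F(t), w)` for all `w ∈ S`. -/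
def IsAcceleration {d : ℕ} (Ω : Set (RSpace d)) (c : RSpace d → ℝ) (g : ℝ → ℝ)
    (F : ℝ → Lp ℝ 2 (volume.restrict Ω)) (S : Submodule ℝ (RSpace d →ᵇ ℝ))
    (t : ℝ) (u a : S) : Prop :=
  ∀ w : S, massForm Ω a w + stiffForm Ω c u w + nonlinForm Ω g u w = loadForm Ω (F t) w

open Classical in
/-- The acceleration as a function of `t` and `u` (it exists and is unique). -/
def acceleration {d : ℕ} (Ω : Set (RSpace d)) (c : RSpace d → ℝ) (g : ℝ → ℝ)
    (F : ℝ → Lp ℝ 2 (volume.restrict Ω)) (S : Submodule ℝ (RSpace d →ᵇ ℝ))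
    (t : ℝ) (u : S) : S :=
  if h : ∃ a, IsAcceleration Ω c g F S t u a then h.choose else 0

/-- Right-hand side of the semi-discretized first-order-in-time system
`(U, V)' = (V, acceleration(t, U))` in `S × S`. -/
def waveField {d : ℕ} (Ω : Set (RSpace d)) (c : RSpace d → ℝ) (g : ℝ → ℝ)
    (F : ℝ → Lp ℝ 2 (volume.restrict Ω)) (S : Submodule ℝ (RSpace d →ᵇ ℝ))
    (t : ℝ) (y : S × S) : S × S :=
  (y.2, acceleration Ω c g F S t y.1)

/-! ### Time discretization -/

/-- `U` is, on `[a, b]`, a polynomial of degree at most `p` with coefficients in `X`. -/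
def IsPolyOn {X : Type*} [AddCommGroup X] [Module ℝ X] (a b : ℝ) (p : ℕ) (U : ℝ → X) : Prop :=
  ∃ q : Fin (p + 1) → X, ∀ t ∈ Icc a b, U t = ∑ k : Fin (p + 1), t ^ (k : ℕ) • q k

/-- `U`, restricted to `[τ 0, τ N]`, is a continuous piecewise polynomial of degree at most `p` on
the time mesh `τ` with values in `X`, i.e. an element of `X ⊗ S_{h_t}^p`.  (Continuity at the mesh
nodes holds because the closed slabs share their end points.) -/
def IsTrial {X : Type*} [AddCommGroup X] [Module ℝ X] {N : ℕ} (τ : Fin (N + 1) → ℝ) (p : ℕ)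
    (U : ℝ → X) : Prop :=
  ∀ n : Fin N, IsPolyOn (τ n.castSucc) (τ n.succ) p U

/-- The step size `h^{(n)}` of the slab `[τ n, τ (n+1)]`. -/
def stepSize {N : ℕ} (τ : Fin (N + 1) → ℝ) (n : Fin N) : ℝ := τ n.succ - τ n.castSucc

/-- The image of `x ∈ [0, 1]` in the slab `[τ n, τ (n+1)]`. -/
def slabTime {N : ℕ} (τ : Fin (N + 1) → ℝ) (n : Fin N) (x : ℝ) : ℝ :=
  τ n.castSucc + x * stepSize τ n

/-- Time derivative on the closed slab `[τ n, τ (n+1)]` (one-sided at the end points). -/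
def slabDeriv {X : Type*} [NormedAddCommGroup X] [NormedSpace ℝ X] {N : ℕ}
    (τ : Fin (N + 1) → ℝ) (U : ℝ → X) (n : Fin N) (t : ℝ) : X :=
  derivWithin U (Icc (τ n.castSucc) (τ n.succ)) t

/-- The `p` Gauss-Legendre nodes on `[0, 1]`: the zeros of the shifted Legendre polynomial. -/
def gaussNodes (p : ℕ) : Finset ℝ :=
  ((shiftedLegendre p).map (Int.castRingHom ℝ)).roots.toFinset

/-- The `p + 1` Gauss-Lobatto nodes on `[0, 1]`: the end points and the zeros of the derivative of
the shifted Legendre polynomial of degree `p`. -/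
def lobattoNodes (p : ℕ) : Finset ℝ :=
  insert 0 (insert 1
    (derivative ((shiftedLegendre p).map (Int.castRingHom ℝ))).roots.toFinset)

/-- Weight at the node `x` of the interpolatory quadrature rule on `[0, 1]`. -/
def quadWeight (nodes : Finset ℝ) (x : ℝ) : ℝ :=
  ∫ s in (0 : ℝ)..1, (Lagrange.basis nodes id x).eval s

/-- Quadrature of `φ` on the slab `[τ n, τ (n+1)]`. -/
def slabQuad (nodes : Finset ℝ) {N : ℕ} (τ : Fin (N + 1) → ℝ) (n : Fin N) (φ : ℝ → ℝ) : ℝ :=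
  stepSize τ n * ∑ x ∈ nodes, quadWeight nodes x * φ (slabTime τ n x)

/-- The second-order-in-time scheme with the slabwise quadrature rule with nodes `nodes` in time:
trial functions of degree `p` in time, `U(0) = U₀`, and
`-(∂ₜU, ∂ₜW) + (c²∇U, ∇W)_quad + (g(U), W)_quad = (F, W)_quad + (V₀, W(0))`
for all test functions `W` of degree `p` in time that vanish at the final time. -/
def SolvesQuadScheme (nodes : Finset ℝ) {d : ℕ} (Ω : Set (RSpace d)) (c : RSpace d → ℝ)
    (g : ℝ → ℝ) (F : ℝ → Lp ℝ 2 (volume.restrict Ω)) (S : Submodule ℝ (RSpace d →ᵇ ℝ))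
    {N : ℕ} (τ : Fin (N + 1) → ℝ) (p : ℕ) (U₀ V₀ : S) (U : ℝ → S) : Prop :=
  IsTrial τ p U ∧ U (τ 0) = U₀ ∧
  ∀ W : ℝ → S, IsTrial τ p W → W (τ (Fin.last N)) = 0 →
    -(∫ t in (τ 0)..(τ (Fin.last N)), massForm Ω (deriv U t : S) (deriv W t : S))
      + ∑ n, slabQuad nodes τ n (fun t => stiffForm Ω c (U t) (W t))
      + ∑ n, slabQuad nodes τ n (fun t => nonlinForm Ω g (U t) (W t))
    = ∑ n, slabQuad nodes τ n (fun t => loadForm Ω (F t) (W t))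
      + massForm Ω V₀ (W (τ 0))

/-- `Vt` is the reconstructed velocity of `U`: it is a trial function with `Vt(0) = V₀` whose
`L²`-projection on the time derivatives of trial functions is `∂ₜU`. -/
def IsReconstruction {d : ℕ} (Ω : Set (RSpace d)) (S : Submodule ℝ (RSpace d →ᵇ ℝ))
    {N : ℕ} (τ : Fin (N + 1) → ℝ) (p : ℕ) (V₀ : S) (U Vt : ℝ → S) : Prop :=
  IsTrial τ p Vt ∧ Vt (τ 0) = V₀ ∧
  ∀ W : ℝ → S, IsTrial τ p W →
    ∫ t in (τ 0)..(τ (Fin.last N)), massForm Ω (Vt t) (deriv W t : S)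
      = ∫ t in (τ 0)..(τ (Fin.last N)), massForm Ω (deriv U t : S) (deriv W t : S)

/-- `Vh n`, `n = 0, …, N`, are the hybrid (nodal) velocities of `U`: `Vh 0 = V₀` and, with
`V = ∂ₜU` on the slab,
`(∂ₜV, λ) + (Vh n - V(tₙ⁻), λ(tₙ)) - (Vh (n-1) - V(tₙ₋₁⁺), λ(tₙ₋₁)) + (c²∇U, ∇λ)_quad
+ (g(U), λ)_quad = (F, λ)_quad` for all `λ` of degree at most `p` in time on the slab. -/
def IsHybridVelocity (nodes : Finset ℝ) {d : ℕ} (Ω : Set (RSpace d)) (c : RSpace d → ℝ)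
    (g : ℝ → ℝ) (F : ℝ → Lp ℝ 2 (volume.restrict Ω)) (S : Submodule ℝ (RSpace d →ᵇ ℝ))
    {N : ℕ} (τ : Fin (N + 1) → ℝ) (p : ℕ) (V₀ : S) (U : ℝ → S) (Vh : Fin (N + 1) → S) : Prop :=
  Vh 0 = V₀ ∧
  ∀ (n : Fin N) (l : ℝ → S), IsPolyOn (τ n.castSucc) (τ n.succ) p l →
    (∫ t in (τ n.castSucc)..(τ n.succ),
        massForm Ω (slabDeriv τ (slabDeriv τ U n) n t : S) (l t))
      + massForm Ω (Vh n.succ - slabDeriv τ U n (τ n.succ) : S) (l (τ n.succ))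
      - massForm Ω (Vh n.castSucc - slabDeriv τ U n (τ n.castSucc) : S) (l (τ n.castSucc))
      + slabQuad nodes τ n (fun t => stiffForm Ω c (U t) (l t))
      + slabQuad nodes τ n (fun t => nonlinForm Ω g (U t) (l t))
    = slabQuad nodes τ n (fun t => loadForm Ω (F t) (l t))

/-! ### Runge-Kutta methods -/

/-- A Butcher tableau with stages indexed by `ι`. -/
structure ButcherTableau (ι : Type*) where
  /-- Runge-Kutta matrix -/
  A : ι → ι → ℝ
  /-- weights -/
  b : ι → ℝ
  /-- nodes -/
  c : ι → ℝ

/-- `y` (values at the mesh nodes) and `Y` (internal stages) form a solution of the Runge-Kutta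
method `B` for `y' = f(t, y)`, `y(τ 0) = y₀`, on the mesh `τ`. -/
def IsRKSolution {ι X : Type*} [Fintype ι] [AddCommGroup X] [Module ℝ X] (B : ButcherTableau ι)
    (f : ℝ → X → X) {N : ℕ} (τ : Fin (N + 1) → ℝ) (y₀ : X)
    (y : Fin (N + 1) → X) (Y : Fin N → ι → X) : Prop :=
  y 0 = y₀ ∧ ∀ n : Fin N,
    (∀ i, Y n i =
      y n.castSucc + stepSize τ n • ∑ j, B.A i j • f (slabTime τ n (B.c j)) (Y n j)) ∧
    y n.succ = y n.castSucc + stepSize τ n • ∑ j, B.b j • f (slabTime τ n (B.c j)) (Y n j)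

/-- `(y, z)` and `(Y, Z)` form a solution of the partitioned Runge-Kutta method that treats `y` with
`B₁` and `z` with `B₂`, for `y' = f₁(t, y, z)`, `z' = f₂(t, y, z)`, on the mesh `τ`. -/
def IsPRKSolution {ι X Z : Type*} [Fintype ι] [AddCommGroup X] [Module ℝ X] [AddCommGroup Z]
    [Module ℝ Z] (B₁ B₂ : ButcherTableau ι) (f₁ : ℝ → X → Z → X) (f₂ : ℝ → X → Z → Z)
    {N : ℕ} (τ : Fin (N + 1) → ℝ) (y₀ : X) (z₀ : Z)
    (y : Fin (N + 1) → X) (z : Fin (N + 1) → Z) (Ys : Fin N → ι → X) (Zs : Fin N → ι → Z) :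
    Prop :=
  y 0 = y₀ ∧ z 0 = z₀ ∧ ∀ n : Fin N,
    (∀ i, Ys n i = y n.castSucc
      + stepSize τ n • ∑ j, B₁.A i j • f₁ (slabTime τ n (B₁.c j)) (Ys n j) (Zs n j)) ∧
    (∀ i, Zs n i = z n.castSucc
      + stepSize τ n • ∑ j, B₂.A i j • f₂ (slabTime τ n (B₂.c j)) (Ys n j) (Zs n j)) ∧
    y n.succ = y n.castSucc
      + stepSize τ n • ∑ j, B₁.b j • f₁ (slabTime τ n (B₁.c j)) (Ys n j) (Zs n j) ∧
    z n.succ = z n.castSucc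
      + stepSize τ n • ∑ j, B₂.b j • f₂ (slabTime τ n (B₂.c j)) (Ys n j) (Zs n j)

/-- The collocation Runge-Kutta method with the given nodes:
`a i j = ∫₀^{c i} ℓ j`, `b j = ∫₀¹ ℓ j`, with `ℓ j` the Lagrange basis of the nodes. -/
def collocation (nodes : Finset ℝ) : ButcherTableau nodes where
  A i j := ∫ s in (0 : ℝ)..i, (Lagrange.basis nodes id (j : ℝ)).eval s
  b j := quadWeight nodes j
  c i := i

/-- The `p`-stage Gauss-Legendre Runge-Kutta method. -/
def gaussLegendre (p : ℕ) : ButcherTableau (gaussNodes p) := collocation (gaussNodes p)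

/-- The `(p + 1)`-stage Lobatto IIIA method: collocation at the Gauss-Lobatto nodes. -/
def lobattoIIIA (p : ℕ) : ButcherTableau (lobattoNodes p) := collocation (lobattoNodes p)

/-- The Lagrange basis of the interior Gauss-Lobatto nodes. -/
def interiorBasis (p : ℕ) (x : ℝ) : ℝ[X] :=
  Lagrange.basis (((lobattoNodes p).erase 0).erase 1) id x

/-- The `(p + 1)`-stage Lobatto IIIB method: discontinuous collocation at the Gauss-Lobatto nodes,
i.e. the stages are the values of the polynomial `v` of degree `p - 1` with
`v(0) = z - h b₀ (v'(0) - f₀)` and `v' = f` at the interior nodes.  Writing `v'` in the Lagrange basis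
`m j` of the interior nodes gives the coefficients `a i 0 = b 0`, `a i 1 = 0` for the end points, and
`a i j = ∫₀^{c i} m j - b 0 * m j (0)` for the interior nodes. -/
def lobattoIIIB (p : ℕ) : ButcherTableau (lobattoNodes p) where
  A i j :=
    if (j : ℝ) = 0 then quadWeight (lobattoNodes p) 0
    else if (j : ℝ) = 1 then 0
    else (∫ s in (0 : ℝ)..i, (interiorBasis p j).eval s)
      - quadWeight (lobattoNodes p) 0 * (interiorBasis p j).eval 0
  b j := quadWeight (lobattoNodes p) j
  c i := i

/-! ### Symplecticity -/

/-- The canonical symplectic form `ω(ξ, η) = (ξ₁, η₂)_{L²(Ω)} - (ξ₂, η₁)_{L²(Ω)}` on `S × S`. -/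
def sympForm {d : ℕ} (Ω : Set (RSpace d)) (S : Submodule ℝ (RSpace d →ᵇ ℝ)) (ξ η : S × S) : ℝ :=
  massForm Ω ξ.1 η.2 - massForm Ω ξ.2 η.1

/-- `Φ` is a symplectic map on the open set `D ⊆ S × S`: it is differentiable there and its
derivative preserves the symplectic form. -/
def IsSymplecticOn {d : ℕ} (Ω : Set (RSpace d)) (S : Submodule ℝ (RSpace d →ᵇ ℝ))
    (Φ : S × S → S × S) (D : Set (S × S)) : Prop :=
  ∀ y ∈ D, DifferentiableAt ℝ Φ y ∧
    ∀ ξ η : S × S, sympForm Ω S (fderiv ℝ Φ y ξ) (fderiv ℝ Φ y η) = sympForm Ω S ξ η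

end

noncomputable section

/-! ### Interpolatory quadrature on `[0, 1]` -/

/-! For fixed time the stiffness, nonlinear and load terms are represented, through the L² inner
product `M` on the finite-dimensional space `S`, by a single vector `acc t u`. Both schemes are thus
discretizations of u'' = acc(t, u), and only positivity and symmetry of `M` matter. On each slab
everything is pulled back to [0, 1], where a trial function is a polynomial P of degree at most p.

Both rules integrate polynomials of degree at most 2p - 1 exactly, which covers the products of ∂ₜU
or V with ∂ₜW, and of ∂ₜV with W, that occur. The exact time integrals are therefore nodal sums as
well, integration by parts survives discretely, and the boundary terms telescope over the mesh. What
remains is a sum over nodes of `M` applied to a residual and a test value. Test functions whose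
nodal values are these residuals force every residual to vanish.

Gauss-Legendre: the reconstruction says P' = hQ at the p nodes, and the scheme then says Q' = h acc
there (`reconstruction_iff`, `scheme_gauss_iff`). These are collocation equations, equivalent to the
Runge-Kutta equations by `collocation_iff`.

Gauss-Lobatto: the velocity polynomial is ∂ₜU itself, of degree p - 1, so the IIIA equations hold
automatically. The residuals, which at the slab ends contain the jump between ∂ₜU and the nodal
velocity, all vanish exactly when the IIIB equations hold (`lobattoResidual_eq_zero_iff`).
Continuous test functions do not see the nodal velocities after the initial one
(`scheme_lobatto_eq`); these are recovered from the residuals at right ends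
(`existsUnique_bilinHybrid`).

Symplecticity: the coefficient condition is integration by parts for primitives of Lagrange basis
polynomials, evaluated by the exact rule. The derivative of `acc` is symmetric for `M`, since `acc`
is the `M`-gradient of a potential. Linearizing one step therefore changes the pairing of
displacement and velocity variations only by a term symmetric in the two directions, which the
antisymmetric form ignores (`prk_flow_symplectic`).

The needed facts on nodes and weights come from Rodrigues' formula: repeated integration by parts
gives orthogonality, and Rolle's theorem counts the roots. -/

theorem degree_mul_lt_of_le_of_lt {p q : ℝ[X]} {m n : ℕ} (hp : p.degree ≤ m) (hq : q.degree < n) :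
    (p * q).degree < (m + n : ℕ) := by
  rcases eq_or_ne p 0 with rfl | hp0
  · simp
  rcases eq_or_ne q 0 with rfl | hq0
  · simp
  rw [degree_eq_natDegree (mul_ne_zero hp0 hq0), natDegree_mul hp0 hq0, Nat.cast_lt]
  rw [degree_eq_natDegree hp0, Nat.cast_le] at hp
  rw [degree_eq_natDegree hq0, Nat.cast_lt] at hq
  omega

theorem degree_mul_lt_of_lt_of_lt {p q : ℝ[X]} {m n : ℕ} (hp : p.degree < m) (hq : q.degree < n) :
    (p * q).degree < (m + n - 1 : ℕ) := by
  rcases eq_or_ne p 0 with rfl | hp0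
  · simp
  rcases eq_or_ne q 0 with rfl | hq0
  · simp
  rw [degree_eq_natDegree (mul_ne_zero hp0 hq0), natDegree_mul hp0 hq0, Nat.cast_lt]
  rw [degree_eq_natDegree hp0, Nat.cast_lt] at hp
  rw [degree_eq_natDegree hq0, Nat.cast_lt] at hq
  omega

theorem degree_derivative_lt_sub_one {q : ℝ[X]} {n : ℕ} (hq : q.degree < n) :
    (derivative q).degree < (n - 1 : ℕ) := by
  rcases eq_or_ne (derivative q) 0 with h0 | h0
  · simp [h0]
  have hq0 : q ≠ 0 := by rintro rfl; simp at h0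
  have hd : q.natDegree ≠ 0 := fun h => h0 (derivative_of_natDegree_zero h)
  have := natDegree_derivative_lt hd
  rw [degree_eq_natDegree h0, Nat.cast_lt]
  rw [degree_eq_natDegree hq0, Nat.cast_lt] at hq
  omega

theorem integral_eval_add (p q : ℝ[X]) :
    ∫ s in (0 : ℝ)..1, (p + q).eval s = (∫ s in (0 : ℝ)..1, p.eval s) + ∫ s in (0 : ℝ)..1, q.eval s := by
  simp only [eval_add]
  exact intervalIntegral.integral_add (p.continuous.intervalIntegrable _ _)
    (q.continuous.intervalIntegrable _ _)

theorem integral_eval_neg (p : ℝ[X]) :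
    ∫ s in (0 : ℝ)..1, (-p).eval s = -∫ s in (0 : ℝ)..1, p.eval s := by
  simp only [eval_neg, intervalIntegral.integral_neg]

theorem integral_eval_C_mul (a : ℝ) (p : ℝ[X]) :
    ∫ s in (0 : ℝ)..1, (C a * p).eval s = a * ∫ s in (0 : ℝ)..1, p.eval s := by
  simp only [eval_mul, eval_C, intervalIntegral.integral_const_mul]

theorem integral_eval_sum {ι : Type*} (t : Finset ι) (p : ι → ℝ[X]) :
    ∫ s in (0 : ℝ)..1, (∑ i ∈ t, p i).eval s = ∑ i ∈ t, ∫ s in (0 : ℝ)..1, (p i).eval s := by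
  simp only [eval_finsetSum]
  exact intervalIntegral.integral_finsetSum fun i _ => (p i).continuous.intervalIntegrable _ _

theorem integral_eval_derivative (p : ℝ[X]) (a b : ℝ) :
    ∫ s in a..b, (derivative p).eval s = p.eval b - p.eval a :=
  intervalIntegral.integral_eq_sub_of_hasDerivAt (fun x _ => p.hasDerivAt x)
    ((derivative p).continuous.intervalIntegrable _ _)

theorem integral_derivative_mul (p q : ℝ[X]) :
    ∫ s in (0 : ℝ)..1, (derivative p * q).eval s
      = p.eval 1 * q.eval 1 - p.eval 0 * q.eval 0 - ∫ s in (0 : ℝ)..1, (p * derivative q).eval s := by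
  have h := integral_eval_derivative (p * q) 0 1
  rw [derivative_mul, integral_eval_add, eval_mul, eval_mul] at h
  linarith

/-- A nonzero polynomial has finitely many roots, so the integrand is positive somewhere inside. The
weight may vanish at the end points, as x(1 - x) does for the interior Lobatto nodes. -/
theorem integral_mul_sq_pos {w q : ℝ[X]} (hw : ∀ x ∈ Ioo (0 : ℝ) 1, 0 < w.eval x) (hq : q ≠ 0) :
    0 < ∫ s in (0 : ℝ)..1, (w * q ^ 2).eval s := by
  have hw' : ∀ x ∈ Icc (0 : ℝ) 1, 0 ≤ w.eval x := by
    intro x hx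
    have hcl : x ∈ closure (Ioo (0 : ℝ) 1) := by rwa [closure_Ioo zero_ne_one]
    exact (isClosed_Ici (a := (0 : ℝ)).preimage w.continuous).closure_subset_iff.2
      (fun y hy => (hw y hy).le) hcl
  obtain ⟨c, hc, hqc⟩ : ∃ c ∈ Ioo (0 : ℝ) 1, q.eval c ≠ 0 := by
    by_contra! h
    exact hq (q.eq_zero_of_infinite_isRoot ((Ioo_infinite zero_lt_one).mono h))
  refine intervalIntegral.integral_pos zero_lt_one (w * q ^ 2).continuous.continuousOn
    (fun x hx => ?_) ⟨c, Ioo_subset_Icc_self hc, ?_⟩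
  · simpa using mul_nonneg (hw' x (Ioc_subset_Icc_self hx)) (sq_nonneg _)
  · simpa using mul_pos (hw c hc) (by positivity)

/-- Interpolatory quadrature with weight `w` is exact up to the degree permitted by the
orthogonality of the nodal polynomial. -/
theorem integral_eq_sum_of_orthogonal (w : ℝ[X]) (nodes : Finset ℝ) (k : ℕ)
    (horth : ∀ q : ℝ[X], q.degree < k →
      ∫ s in (0 : ℝ)..1, (w * (Lagrange.nodal nodes id * q)).eval s = 0)
    {r : ℝ[X]} (hr : r.degree < (nodes.card + k : ℕ)) :
    ∫ s in (0 : ℝ)..1, (w * r).eval s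
      = ∑ i ∈ nodes, (∫ s in (0 : ℝ)..1, (w * Lagrange.basis nodes id i).eval s) * r.eval i := by
  have hmon : (Lagrange.nodal nodes (id : ℝ → ℝ)).Monic := Lagrange.nodal_monic
  set ω := Lagrange.nodal nodes (id : ℝ → ℝ)
  have hdeg : ω.degree = nodes.card := Lagrange.degree_nodal
  -- Division by the nodal polynomial splits `r`: the quotient part is annihilated by orthogonality,
  -- and the remainder is the interpolant of `r` because the nodal polynomial vanishes at the nodes.
  have hquot : (r /ₘ ω).degree < k := by
    rcases lt_or_ge r.degree ω.degree with h | h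
    · rw [(divByMonic_eq_zero_iff hmon).2 h]; simp
    · have h2 := degree_add_divByMonic hmon h
      rcases eq_or_ne (r /ₘ ω) 0 with h0 | h0
      · simp [h0]
      rw [← h2, hdeg, degree_eq_natDegree h0, ← Nat.cast_add, Nat.cast_lt] at hr
      rw [degree_eq_natDegree h0, Nat.cast_lt]
      omega
  have hrem : r %ₘ ω = Lagrange.interpolate nodes id (fun i => r.eval i) := by
    refine Lagrange.eq_interpolate_of_eval_eq _ Function.injective_id.injOn
      (hdeg ▸ degree_modByMonic_lt r hmon) fun i hi => ?_
    conv_rhs => rw [← modByMonic_add_div r ω]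
    have : ω.eval i = 0 := Lagrange.eval_nodal_at_node (v := (id : ℝ → ℝ)) hi
    simp [this]
  conv_lhs => rw [← modByMonic_add_div r ω, mul_add]
  rw [integral_eval_add, horth _ hquot, add_zero, hrem, Lagrange.interpolate_apply, Finset.mul_sum,
    integral_eval_sum]
  refine Finset.sum_congr rfl fun i _ => ?_
  rw [mul_left_comm, integral_eval_C_mul, mul_comm]

/-- Nodes and weights of a Gauss rule for the weight `w`. -/
theorem gauss_rule_pos {w : ℝ[X]} (hw : ∀ x ∈ Ioo (0 : ℝ) 1, 0 < w.eval x) {nodes : Finset ℝ}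
    (hex : ∀ r : ℝ[X], r.degree < (2 * nodes.card : ℕ) →
      ∫ s in (0 : ℝ)..1, (w * r).eval s
        = ∑ i ∈ nodes, (∫ s in (0 : ℝ)..1, (w * Lagrange.basis nodes id i).eval s) * r.eval i)
    {i : ℝ} (hi : i ∈ nodes) :
    i ∈ Ioo (0 : ℝ) 1 ∧ 0 < ∫ s in (0 : ℝ)..1, (w * Lagrange.basis nodes id i).eval s := by
  set ℓ := Lagrange.basis nodes (id : ℝ → ℝ) i with hℓ
  have hcard : 0 < nodes.card := Finset.card_pos.2 ⟨i, hi⟩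
  have hℓ0 : ℓ ≠ 0 := Lagrange.basis_ne_zero Function.injective_id.injOn hi
  have hℓd : ℓ.degree < (nodes.card : ℕ) := by
    rw [Lagrange.degree_basis Function.injective_id.injOn hi, Nat.cast_lt]; omega
  have hsq : (ℓ ^ 2).degree < (nodes.card + nodes.card - 1 : ℕ) := by
    rw [pow_two]; exact degree_mul_lt_of_lt_of_lt hℓd hℓd
  have hev : ∀ j ∈ nodes, j ≠ i → ℓ.eval j = 0 := fun j hj hji =>
    Lagrange.eval_basis_of_ne (v := (id : ℝ → ℝ)) hji.symm hj
  have hev1 : ℓ.eval i = 1 :=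
    Lagrange.eval_basis_self (v := (id : ℝ → ℝ)) Function.injective_id.injOn hi
  -- The polynomial r ℓ² is still integrated exactly, and only the node i survives in the sum. Then
  -- r = 1 shows that the weight is positive, while r = X and r = 1 - X place the node to the right
  -- of 0 and to the left of 1.
  have key : ∀ r : ℝ[X], r.degree ≤ (1 : ℕ) → ∫ s in (0 : ℝ)..1, (w * (r * ℓ ^ 2)).eval s
      = (∫ s in (0 : ℝ)..1, (w * ℓ).eval s) * r.eval i := by
    intro r hr
    have hd := degree_mul_lt_of_le_of_lt hr hsq
    rw [hex _ (hd.trans_le (Nat.cast_le.2 (by omega))), Finset.sum_eq_single_of_mem i hi]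
    · rw [eval_mul (p := r), eval_pow, hev1, one_pow, mul_one]
    · intro j hj hji
      simp [hev j hj hji]
  have hB : 0 < ∫ s in (0 : ℝ)..1, (w * ℓ).eval s := by
    have h := key 1 (by simp)
    rw [one_mul, eval_one, mul_one] at h
    rw [← h]
    exact integral_mul_sq_pos hw hℓ0
  refine ⟨⟨?_, ?_⟩, hB⟩
  · have h := key X (by simp)
    have hpos := integral_mul_sq_pos (w := w * X) (q := ℓ)
      (fun x hx => by simpa using mul_pos (hw x hx) hx.1) hℓ0
    rw [mul_assoc, h, eval_X] at hpos
    exact (pos_iff_pos_of_mul_pos hpos).1 hB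
  · have h := key (1 - X) (by
      refine (degree_sub_le _ _).trans ?_
      simp)
    have hpos := integral_mul_sq_pos (w := w * (1 - X)) (q := ℓ)
      (fun x hx => by simpa using mul_pos (hw x hx) (sub_pos.2 hx.2)) hℓ0
    rw [mul_assoc, h, eval_sub, eval_one, eval_X] at hpos
    exact sub_pos.1 ((pos_iff_pos_of_mul_pos hpos).1 hB)

/-! ### The shifted Legendre polynomial -/

/-- The shifted Legendre polynomial with real coefficients. -/
def realLegendre (p : ℕ) : ℝ[X] := (shiftedLegendre p).map (Int.castRingHom ℝ)

theorem natDegree_realLegendre (p : ℕ) : (realLegendre p).natDegree = p := by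
  rw [realLegendre, natDegree_map_eq_of_injective Int.cast_injective, natDegree_shiftedLegendre]

theorem realLegendre_ne_zero (p : ℕ) : realLegendre p ≠ 0 := by
  intro h
  have h2 := degree_shiftedLegendre p
  rw [realLegendre, Polynomial.map_eq_zero_iff Int.cast_injective] at h
  simp [h] at h2

/-- Rodrigues' formula, the source of both the orthogonality and the number of roots. -/
theorem factorial_mul_realLegendre (p : ℕ) :
    C (p.factorial : ℝ) * realLegendre p = derivative^[p] (X ^ p * (1 - X) ^ p) := by
  have h := congrArg (Polynomial.map (Int.castRingHom ℝ)) (factorial_mul_shiftedLegendre_eq p)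
  rw [← iterate_derivative_map] at h
  simpa [realLegendre] using h

/-- Both end points are roots of multiplicity at least p, and each derivative lowers the
multiplicity by at most one. -/
theorem eval_iterate_derivative_legendre (p k : ℕ) (hk : k < p) :
    (derivative^[k] (X ^ p * (1 - X) ^ p : ℝ[X])).eval 0 = 0 ∧
      (derivative^[k] (X ^ p * (1 - X) ^ p : ℝ[X])).eval 1 = 0 := by
  have hX : (1 - X : ℝ[X]) ≠ 0 := fun h => by simpa using congrArg (eval 0) h
  have h0 : (X ^ p * (1 - X) ^ p : ℝ[X]) ≠ 0 := mul_ne_zero (pow_ne_zero _ X_ne_zero)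
    (pow_ne_zero _ hX)
  constructor
  · refine isRoot_iterate_derivative_of_lt_rootMultiplicity (hk.trans_le ?_)
    rw [le_rootMultiplicity_iff h0]
    simp
  · refine isRoot_iterate_derivative_of_lt_rootMultiplicity (hk.trans_le ?_)
    rw [le_rootMultiplicity_iff h0]
    refine Dvd.dvd.mul_left (pow_dvd_pow_of_dvd ?_ _) _
    exact ⟨-1, by simp⟩

/-- Integration by parts n times moves all derivatives onto q; the boundary terms vanish by `hf`. -/
theorem integral_iterate_derivative_mul {f : ℝ[X]} {n : ℕ}
    (hf : ∀ k < n, (derivative^[k] f).eval 0 = 0 ∧ (derivative^[k] f).eval 1 = 0) {q : ℝ[X]}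
    (hq : derivative^[n] q = 0) : ∫ s in (0 : ℝ)..1, (derivative^[n] f * q).eval s = 0 := by
  induction n generalizing q with
  | zero =>
    have hq' : q = 0 := hq
    simp [hq']
  | succ n ih =>
    rw [Function.iterate_succ_apply', integral_derivative_mul, (hf n n.lt_succ_self).1,
      (hf n n.lt_succ_self).2, ih (fun k hk => hf k (hk.trans n.lt_succ_self))]
    · simp
    · rwa [← Function.iterate_succ_apply]

theorem integral_realLegendre_mul {p : ℕ} {q : ℝ[X]} (hq : q.degree < p) :
    ∫ s in (0 : ℝ)..1, (realLegendre p * q).eval s = 0 := by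
  have h := integral_iterate_derivative_mul (eval_iterate_derivative_legendre p)
    (iterate_derivative_eq_zero_of_degree_lt hq)
  rw [← factorial_mul_realLegendre, mul_assoc, integral_eval_C_mul] at h
  exact (mul_eq_zero.1 h).resolve_left (Nat.cast_ne_zero.2 p.factorial_ne_zero)

theorem iterate_derivative_ne_zero_of_le {f : ℝ[X]} {m n : ℕ} (hmn : m ≤ n)
    (h : derivative^[n] f ≠ 0) : derivative^[m] f ≠ 0 := by
  obtain ⟨k, rfl⟩ := Nat.exists_eq_add_of_le hmn
  intro h0
  apply h
  rw [add_comm, Function.iterate_add_apply, h0, iterate_derivative_zero]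

/-- Induction with Rolle's theorem: k + 2 distinct roots produce k + 1 new ones strictly between
them, and 0 and 1 are still roots as long as the order of the derivative is below p. -/
theorem card_roots_iterate_derivative_legendre (p k : ℕ) (hk : k < p) :
    k + 2 ≤ (derivative^[k] (X ^ p * (1 - X) ^ p : ℝ[X])).roots.toFinset.card := by
  have hne : ∀ j ≤ p, derivative^[j] (X ^ p * (1 - X) ^ p : ℝ[X]) ≠ 0 := fun j hj =>
    iterate_derivative_ne_zero_of_le hj (by
      rw [← factorial_mul_realLegendre]
      exact mul_ne_zero (C_ne_zero.2 (Nat.cast_ne_zero.2 p.factorial_ne_zero))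
        (realLegendre_ne_zero p))
  have hmem : ∀ j < p, ({0, 1} : Finset ℝ) ⊆
      (derivative^[j] (X ^ p * (1 - X) ^ p : ℝ[X])).roots.toFinset := by
    intro j hj x hx
    rw [Multiset.mem_toFinset, mem_roots (hne j hj.le), IsRoot]
    have := eval_iterate_derivative_legendre p j hj
    rcases Finset.mem_insert.1 hx with rfl | hx
    · exact this.1
    · rw [Finset.mem_singleton.1 hx]; exact this.2
  have h2 : ({0, 1} : Finset ℝ).card = 2 := Finset.card_pair zero_ne_one
  induction k with
  | zero => simpa [h2] using Finset.card_le_card (hmem 0 hk)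
  | succ k ih =>
    have h := ih (Nat.lt_of_succ_lt hk)
    have hroll := card_roots_toFinset_le_card_roots_derivative_sdiff_roots_succ
      (derivative^[k] (X ^ p * (1 - X) ^ p : ℝ[X]))
    rw [← Function.iterate_succ_apply' derivative] at hroll
    set A := (derivative^[k] (X ^ p * (1 - X) ^ p : ℝ[X])).roots.toFinset
    set B := (derivative^[k + 1] (X ^ p * (1 - X) ^ p : ℝ[X])).roots.toFinset
    have hsub : (B \ A) ∪ {0, 1} ⊆ B :=
      Finset.union_subset Finset.sdiff_subset (hmem _ hk)
    have hdis : Disjoint (B \ A) {0, 1} :=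
      Finset.sdiff_disjoint.mono_right (hmem k (Nat.lt_of_succ_lt hk))
    have := Finset.card_le_card hsub
    rw [Finset.card_union_of_disjoint hdis, h2] at this
    omega

/-! ### Gauss and Lobatto nodes: number, location, exactness, positive weights. -/

theorem card_gaussNodes {p : ℕ} (hp : 1 ≤ p) : (gaussNodes p).card = p := by
  change (realLegendre p).roots.toFinset.card = p
  apply le_antisymm
  · exact (Multiset.toFinset_card_le _).trans ((card_roots' _).trans (natDegree_realLegendre p).le)
  -- One last use of Rolle: the derivative of order p - 1 has at least p + 1 roots, so the p-th
  -- derivative, a multiple of the Legendre polynomial, has at least p. The end points are no longer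
  -- gained.
  · obtain ⟨k, rfl⟩ := Nat.exists_eq_add_of_le' hp
    have h := card_roots_iterate_derivative_legendre (k + 1) k k.lt_succ_self
    have hroll := card_roots_toFinset_le_derivative
      (derivative^[k] (X ^ (k + 1) * (1 - X) ^ (k + 1) : ℝ[X]))
    rw [← Function.iterate_succ_apply' derivative, ← factorial_mul_realLegendre,
      roots_C_mul _ (Nat.cast_ne_zero.2 (k + 1).factorial_ne_zero)] at hroll
    change _ ≤ (realLegendre (k + 1)).roots.toFinset.card + 1 at hroll
    omega

/-- The interior Gauss-Lobatto nodes. -/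
def lobattoInterior (p : ℕ) : Finset ℝ := (derivative (realLegendre p)).roots.toFinset

theorem card_lobattoInterior {p : ℕ} (hp : 1 ≤ p) : (lobattoInterior p).card = p - 1 := by
  apply le_antisymm
  · refine (Multiset.toFinset_card_le _).trans ((card_roots' _).trans ?_)
    simp [natDegree_realLegendre]
  · have h := card_roots_toFinset_le_derivative (realLegendre p)
    have h2 := card_gaussNodes hp
    change (realLegendre p).roots.toFinset.card = p at h2
    change p - 1 ≤ (derivative (realLegendre p)).roots.toFinset.card
    omega

/-- A polynomial with as many distinct roots as its degree is a constant multiple of the nodal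
polynomial of its roots. This transfers orthogonality from Legendre polynomials to nodal
polynomials. -/
theorem nodal_roots_eq {f : ℝ[X]} (hf : f ≠ 0) (h : f.roots.toFinset.card = f.natDegree) :
    Lagrange.nodal f.roots.toFinset id = C f.leadingCoeff⁻¹ * f := by
  have hlc : f.leadingCoeff ≠ 0 := leadingCoeff_ne_zero.2 hf
  have hdeg : (C f.leadingCoeff⁻¹ * f).degree = f.roots.toFinset.card := by
    rw [degree_C_mul (inv_ne_zero hlc), degree_eq_natDegree hf, h]
  have hnd : (Lagrange.nodal f.roots.toFinset (id : ℝ → ℝ)).degree = f.roots.toFinset.card :=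
    Lagrange.degree_nodal
  refine eq_of_degree_le_of_eval_finset_eq f.roots.toFinset hnd.le (hnd.trans hdeg.symm) ?_ ?_
  · rw [Lagrange.nodal_monic.leadingCoeff, leadingCoeff_C_mul_of_isUnit (inv_ne_zero hlc).isUnit,
      inv_mul_cancel₀ hlc]
  · intro x hx
    have hr : f.eval x = 0 := (mem_roots hf).1 (Multiset.mem_toFinset.1 hx)
    rw [eval_mul, hr, mul_zero]
    exact Lagrange.eval_nodal_at_node (v := (id : ℝ → ℝ)) hx

theorem gauss_exact {p : ℕ} (hp : 1 ≤ p) {r : ℝ[X]} (hr : r.degree < (2 * p : ℕ)) :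
    ∫ s in (0 : ℝ)..1, r.eval s = ∑ i ∈ gaussNodes p, quadWeight (gaussNodes p) i * r.eval i := by
  have h := integral_eq_sum_of_orthogonal 1 (gaussNodes p) p (r := r) (fun q hq => ?_)
    (by rwa [card_gaussNodes hp, ← two_mul])
  · simpa only [one_mul, quadWeight] using h
  · have hn : Lagrange.nodal (gaussNodes p) (id : ℝ → ℝ) = _ :=
      nodal_roots_eq (realLegendre_ne_zero p)
        ((card_gaussNodes hp).trans (natDegree_realLegendre p).symm)
    rw [hn, one_mul, mul_assoc, integral_eval_C_mul]
    exact mul_eq_zero_of_right _ (integral_realLegendre_mul hq)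

theorem gauss_pos {p : ℕ} (hp : 1 ≤ p) {i : ℝ} (hi : i ∈ gaussNodes p) :
    i ∈ Ioo (0 : ℝ) 1 ∧ 0 < quadWeight (gaussNodes p) i := by
  have h := gauss_rule_pos (w := 1) (nodes := gaussNodes p) (by simp) (fun r hr => ?_) hi
  · simpa only [one_mul, quadWeight] using h
  · rw [card_gaussNodes hp] at hr
    simpa only [one_mul, quadWeight] using gauss_exact hp hr

/-- Integrating by parts, the weight x(1 - x) removes the boundary terms and the derivative falls on
x(1 - x)q. The result has degree below p, hence is orthogonal to the Legendre polynomial. -/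
theorem integral_derivative_legendre_mul {p : ℕ} (hp : 1 ≤ p) {q : ℝ[X]}
    (hq : q.degree < (p - 1 : ℕ)) :
    ∫ s in (0 : ℝ)..1, (X * (1 - X) * (derivative (realLegendre p) * q)).eval s = 0 := by
  have hX : (X * (1 - X) : ℝ[X]).degree ≤ (2 : ℕ) := by
    rw [mul_sub, mul_one]
    refine (degree_sub_le _ _).trans (max_le ?_ ?_)
    · rw [degree_X]; norm_num
    · rw [← pow_two, degree_X_pow]
  have hd : (derivative (X * (1 - X) * q)).degree < (p : ℕ) := by
    have h1 := degree_derivative_lt_sub_one (degree_mul_lt_of_le_of_lt hX hq)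
    exact h1.trans_le (Nat.cast_le.2 (by omega))
  rw [show (X * (1 - X) * (derivative (realLegendre p) * q) : ℝ[X])
      = derivative (realLegendre p) * (X * (1 - X) * q) by ring, integral_derivative_mul,
    integral_realLegendre_mul hd]
  simp

theorem derivative_realLegendre_ne_zero {p : ℕ} (hp : 1 ≤ p) : derivative (realLegendre p) ≠ 0 := by
  intro h
  have := derivative_eq_zero.1 h
  rw [natDegree_realLegendre] at this
  omega

theorem nodal_lobattoInterior {p : ℕ} (hp : 1 ≤ p) :
    Lagrange.nodal (lobattoInterior p) (id : ℝ → ℝ) =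
      C (derivative (realLegendre p)).leadingCoeff⁻¹ * derivative (realLegendre p) := by
  refine nodal_roots_eq (derivative_realLegendre_ne_zero hp) ((card_lobattoInterior hp).trans ?_)
  rw [natDegree_derivative, natDegree_realLegendre]

/-- The interior nodes carry a Gauss rule for the weight x(1 - x). Through `gauss_rule_pos` this
places them in the open interval, so that they differ from the two end points. -/
theorem lobattoInterior_exact {p : ℕ} (hp : 1 ≤ p) {r : ℝ[X]} (hr : r.degree < (2 * (p - 1) : ℕ)) :
    ∫ s in (0 : ℝ)..1, (X * (1 - X) * r).eval s = ∑ i ∈ lobattoInterior p,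
      (∫ s in (0 : ℝ)..1, (X * (1 - X) * Lagrange.basis (lobattoInterior p) id i).eval s)
        * r.eval i := by
  refine integral_eq_sum_of_orthogonal _ (lobattoInterior p) (p - 1) (fun q hq => ?_)
    (by rwa [card_lobattoInterior hp, ← two_mul])
  rw [nodal_lobattoInterior hp, mul_assoc (C _), mul_left_comm, integral_eval_C_mul,
    integral_derivative_legendre_mul hp hq, mul_zero]

theorem lobattoInterior_pos {p : ℕ} (hp : 1 ≤ p) {i : ℝ} (hi : i ∈ lobattoInterior p) :
    i ∈ Ioo (0 : ℝ) 1 ∧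
      0 < ∫ s in (0 : ℝ)..1, (X * (1 - X) * Lagrange.basis (lobattoInterior p) id i).eval s := by
  refine gauss_rule_pos (nodes := lobattoInterior p)
    (fun x hx => by simpa using mul_pos hx.1 (sub_pos.2 hx.2)) (fun r hr => ?_) hi
  rw [card_lobattoInterior hp] at hr
  exact lobattoInterior_exact hp hr

theorem lobattoNodes_eq (p : ℕ) : lobattoNodes p = insert 0 (insert 1 (lobattoInterior p)) := rfl

theorem zero_notMem_lobattoInterior {p : ℕ} (hp : 1 ≤ p) : (0 : ℝ) ∉ lobattoInterior p :=
  fun h => (lobattoInterior_pos hp h).1.1.false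

theorem one_notMem_lobattoInterior {p : ℕ} (hp : 1 ≤ p) : (1 : ℝ) ∉ lobattoInterior p :=
  fun h => (lobattoInterior_pos hp h).1.2.false

theorem zero_notMem_insert_one_lobattoInterior {p : ℕ} (hp : 1 ≤ p) :
    (0 : ℝ) ∉ insert 1 (lobattoInterior p) := by
  simp [zero_notMem_lobattoInterior hp]

theorem erase_lobattoNodes {p : ℕ} (hp : 1 ≤ p) :
    ((lobattoNodes p).erase 0).erase 1 = lobattoInterior p := by
  rw [lobattoNodes_eq, Finset.erase_insert (zero_notMem_insert_one_lobattoInterior hp),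
    Finset.erase_insert (one_notMem_lobattoInterior hp)]

theorem interiorBasis_eq {p : ℕ} (hp : 1 ≤ p) (x : ℝ) :
    interiorBasis p x = Lagrange.basis (lobattoInterior p) id x := by
  rw [interiorBasis, erase_lobattoNodes hp]

theorem card_lobattoNodes {p : ℕ} (hp : 1 ≤ p) : (lobattoNodes p).card = p + 1 := by
  rw [lobattoNodes_eq, Finset.card_insert_of_notMem (zero_notMem_insert_one_lobattoInterior hp),
    Finset.card_insert_of_notMem (one_notMem_lobattoInterior hp), card_lobattoInterior hp]
  omega

theorem sum_lobattoNodes {X : Type*} [AddCommMonoid X] {p : ℕ} (hp : 1 ≤ p) (f : ℝ → X) :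
    ∑ i ∈ lobattoNodes p, f i = f 0 + (f 1 + ∑ i ∈ lobattoInterior p, f i) := by
  rw [lobattoNodes_eq, Finset.sum_insert (zero_notMem_insert_one_lobattoInterior hp),
    Finset.sum_insert (one_notMem_lobattoInterior hp)]

theorem zero_mem_lobattoNodes (p : ℕ) : (0 : ℝ) ∈ lobattoNodes p := Finset.mem_insert_self _ _

theorem one_mem_lobattoNodes (p : ℕ) : (1 : ℝ) ∈ lobattoNodes p :=
  Finset.mem_insert_of_mem (Finset.mem_insert_self _ _)

theorem mem_lobattoNodes_of_interior {p : ℕ} {i : ℝ} (hi : i ∈ lobattoInterior p) :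
    i ∈ lobattoNodes p :=
  Finset.mem_insert_of_mem (Finset.mem_insert_of_mem hi)

theorem mem_lobattoNodes_iff {p : ℕ} {i : ℝ} :
    i ∈ lobattoNodes p ↔ i = 0 ∨ i = 1 ∨ i ∈ lobattoInterior p := by
  rw [lobattoNodes_eq, Finset.mem_insert, Finset.mem_insert]

theorem lobattoNodes_subset {p : ℕ} (hp : 1 ≤ p) {i : ℝ} (hi : i ∈ lobattoNodes p) :
    i ∈ Icc (0 : ℝ) 1 := by
  rcases mem_lobattoNodes_iff.1 hi with rfl | rfl | h
  · simp
  · simp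
  · exact Ioo_subset_Icc_self (lobattoInterior_pos hp h).1

/-- The nodal polynomial is x(x - 1) times that of the interior nodes, hence orthogonal to degrees
below p - 1. With p + 1 nodes this gives exactness below (p + 1) + (p - 1) = 2p. -/
theorem lobatto_exact {p : ℕ} (hp : 1 ≤ p) {r : ℝ[X]} (hr : r.degree < (2 * p : ℕ)) :
    ∫ s in (0 : ℝ)..1, r.eval s
      = ∑ i ∈ lobattoNodes p, quadWeight (lobattoNodes p) i * r.eval i := by
  have h := integral_eq_sum_of_orthogonal 1 (lobattoNodes p) (p - 1) (r := r) (fun q hq => ?_)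
    (by rw [card_lobattoNodes hp]; exact hr.trans_le (Nat.cast_le.2 (by omega)))
  · simpa only [one_mul, quadWeight] using h
  · have hn : Lagrange.nodal (lobattoNodes p) (id : ℝ → ℝ)
        = X * (X - 1) * Lagrange.nodal (lobattoInterior p) id := by
      rw [lobattoNodes_eq, Lagrange.nodal_insert_eq_nodal (zero_notMem_insert_one_lobattoInterior hp),
        Lagrange.nodal_insert_eq_nodal (one_notMem_lobattoInterior hp)]
      simp [mul_assoc]
    rw [hn, nodal_lobattoInterior hp, one_mul, show ∀ a b : ℝ[X],
      X * (X - 1) * (a * b) * q = -(a * (X * (1 - X) * (b * q))) by intros; ring, integral_eval_neg,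
      integral_eval_C_mul, integral_derivative_legendre_mul hp hq, mul_zero, neg_zero]

/-- Applied to x(1 - x) times an interior basis polynomial, the Lobatto rule keeps only the term b i
· i(1 - i), which equals a positive weight of the weighted Gauss rule. The signs of the end point
weights are never needed. -/
theorem lobatto_interior_weight_pos {p : ℕ} (hp : 1 ≤ p) {i : ℝ} (hi : i ∈ lobattoInterior p) :
    0 < quadWeight (lobattoNodes p) i := by
  obtain ⟨⟨h0, h1⟩, hB⟩ := lobattoInterior_pos hp hi
  have hd : (X * (1 - X) * Lagrange.basis (lobattoInterior p) id i : ℝ[X]).degree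
      < (2 * p : ℕ) := by
    have hX : (X * (1 - X) : ℝ[X]).degree ≤ (2 : ℕ) := by
      rw [mul_sub, mul_one]
      refine (degree_sub_le _ _).trans (max_le ?_ ?_)
      · rw [degree_X]; norm_num
      · rw [← pow_two, degree_X_pow]
    have hc : 0 < (lobattoInterior p).card := Finset.card_pos.2 ⟨i, hi⟩
    have hb : (Lagrange.basis (lobattoInterior p) (id : ℝ → ℝ) i).degree
        < ((lobattoInterior p).card : ℕ) := by
      rw [Lagrange.degree_basis Function.injective_id.injOn hi, Nat.cast_lt]; omega
    refine (degree_mul_lt_of_le_of_lt hX hb).trans_le (Nat.cast_le.2 ?_)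
    rw [card_lobattoInterior hp] at hc ⊢
    omega
  rw [lobatto_exact hp hd, sum_lobattoNodes hp, Finset.sum_eq_single_of_mem i hi] at hB
  · have h2 : (Lagrange.basis (lobattoInterior p) (id : ℝ → ℝ) i).eval i = 1 :=
      Lagrange.eval_basis_self (v := (id : ℝ → ℝ)) Function.injective_id.injOn hi
    simp only [eval_mul, eval_X, eval_sub, eval_one, h2, zero_mul, mul_zero, sub_self, zero_add,
      mul_one] at hB
    exact (pos_iff_pos_of_mul_pos hB).2 (mul_pos h0 (sub_pos.2 h1))
  · intro j hj hji
    have : (Lagrange.basis (lobattoInterior p) (id : ℝ → ℝ) i).eval j = 0 :=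
      Lagrange.eval_basis_of_ne (v := (id : ℝ → ℝ)) hji.symm hj
    simp [this]

/-! ### Polynomial maps with values in a vector space -/

section PolyMaps

variable {E : Type*} [NormedAddCommGroup E] [NormedSpace ℝ E]

variable (E) in
/-- Polynomial maps `ℝ → E` of degree less than `m`. -/
def polyMaps (m : ℕ) : Submodule ℝ (ℝ → E) :=
  Submodule.span ℝ {f | ∃ (r : ℝ[X]) (x : E), r.degree < m ∧ f = fun t => r.eval t • x}

theorem eval_smul_mem_polyMaps {m : ℕ} {r : ℝ[X]} (hr : r.degree < m) (x : E) :
    (fun t => r.eval t • x) ∈ polyMaps E m :=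
  Submodule.subset_span ⟨r, x, hr, rfl⟩

theorem sum_eval_smul_mem_polyMaps {ι : Type*} (T : Finset ι) {m : ℕ} {r : ι → ℝ[X]}
    (hr : ∀ i ∈ T, (r i).degree < m) (x : ι → E) :
    (fun t => ∑ i ∈ T, (r i).eval t • x i) ∈ polyMaps E m := by
  have : (fun t => ∑ i ∈ T, (r i).eval t • x i) = ∑ i ∈ T, fun t => (r i).eval t • x i := by
    ext t; simp
  rw [this]
  exact Submodule.sum_mem _ fun i hi => eval_smul_mem_polyMaps (hr i hi) _

theorem const_mem_polyMaps {m : ℕ} (hm : 1 ≤ m) (x : E) : (fun _ => x) ∈ polyMaps E m := by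
  have h := eval_smul_mem_polyMaps (m := m) (r := 1)
    (by rw [degree_one]; exact_mod_cast hm) x
  simpa using h

theorem comp_affine_mem_polyMaps {m : ℕ} {P : ℝ → E} (hP : P ∈ polyMaps E m) (a b : ℝ) :
    (fun t => P (a + b * t)) ∈ polyMaps E m := by
  induction hP using Submodule.span_induction with
  | mem f hf =>
    obtain ⟨r, x, hr, rfl⟩ := hf
    have h : (r.comp (C a + C b * X)).degree < m := by
      rcases eq_or_ne (r.comp (C a + C b * X)) 0 with h0 | h0
      · simp [h0]
      have hr0 : r ≠ 0 := by rintro rfl; simp at h0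
      rw [degree_eq_natDegree hr0, Nat.cast_lt] at hr
      rw [degree_eq_natDegree h0, Nat.cast_lt]
      have hl : (C a + C b * X : ℝ[X]).natDegree ≤ 1 := by
        rw [add_comm]; exact natDegree_linear_le
      have h2 := natDegree_comp_le (p := r) (q := C a + C b * X)
      nlinarith
    simpa using eval_smul_mem_polyMaps h x
  | zero => exact Submodule.zero_mem _
  | add f g _ _ hf hg => exact Submodule.add_mem _ hf hg
  | smul c f _ hf => exact Submodule.smul_mem _ c hf

/-- The span suits induction; explicit coefficients match `IsPolyOn`. -/
theorem mem_polyMaps_iff {p : ℕ} {P : ℝ → E} :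
    P ∈ polyMaps E (p + 1) ↔
      ∃ q : Fin (p + 1) → E, ∀ t, P t = ∑ k : Fin (p + 1), t ^ (k : ℕ) • q k := by
  constructor
  · intro hP
    induction hP using Submodule.span_induction with
    | mem f hf =>
      obtain ⟨r, x, hr, rfl⟩ := hf
      refine ⟨fun k => r.coeff k • x, fun t => ?_⟩
      have hn : r.natDegree < p + 1 := by
        rcases eq_or_ne r 0 with rfl | h0
        · simp
        · rwa [degree_eq_natDegree h0, Nat.cast_lt] at hr
      simp only [eval_eq_sum_range' hn, Finset.sum_smul, smul_smul]
      rw [Finset.sum_range]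
      exact Finset.sum_congr rfl fun k _ => by rw [mul_comm]
    | zero => exact ⟨0, by simp⟩
    | add f g _ _ hf hg =>
      obtain ⟨q, hq⟩ := hf
      obtain ⟨q', hq'⟩ := hg
      exact ⟨q + q', fun t => by simp [hq, hq', Finset.sum_add_distrib]⟩
    | smul c f _ hf =>
      obtain ⟨q, hq⟩ := hf
      exact ⟨c • q, fun t => by simp [hq, Finset.smul_sum, smul_comm c]⟩
  · rintro ⟨q, hq⟩
    have h := sum_eval_smul_mem_polyMaps (E := E) Finset.univ (m := p + 1)
      (r := fun k : Fin (p + 1) => X ^ (k : ℕ))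
      (fun k _ => by rw [degree_X_pow]; exact_mod_cast k.2) q
    convert h using 1
    ext t
    simp [hq]

theorem sum_basis_smul_mem_polyMaps (nodes : Finset ℝ) (v : ℝ → E) :
    (fun t => ∑ i ∈ nodes, (Lagrange.basis nodes id i).eval t • v i) ∈ polyMaps E nodes.card := by
  refine sum_eval_smul_mem_polyMaps nodes (fun i hi => ?_) v
  rw [Lagrange.degree_basis Function.injective_id.injOn hi, Nat.cast_lt]
  have := Finset.card_pos.2 ⟨i, hi⟩
  omega

theorem sum_basis_smul_apply {nodes : Finset ℝ} (v : ℝ → E) {i : ℝ} (hi : i ∈ nodes) :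
    ∑ j ∈ nodes, (Lagrange.basis nodes id j).eval i • v j = v i := by
  rw [Finset.sum_eq_single_of_mem i hi]
  · have : (Lagrange.basis nodes (id : ℝ → ℝ) i).eval i = 1 :=
      Lagrange.eval_basis_self (v := (id : ℝ → ℝ)) Function.injective_id.injOn hi
    rw [this, one_smul]
  · intro j hj hji
    have : (Lagrange.basis nodes (id : ℝ → ℝ) j).eval i = 0 :=
      Lagrange.eval_basis_of_ne (v := (id : ℝ → ℝ)) hji hi
    rw [this, zero_smul]

/-- Lagrange interpolation. -/
theorem eq_sum_basis_smul {m : ℕ} {P : ℝ → E} (hP : P ∈ polyMaps E m) {nodes : Finset ℝ}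
    (hm : m ≤ nodes.card) (t : ℝ) :
    P t = ∑ i ∈ nodes, (Lagrange.basis nodes id i).eval t • P i := by
  induction hP using Submodule.span_induction with
  | mem f hf =>
    obtain ⟨r, x, hr, rfl⟩ := hf
    have h := Lagrange.eq_interpolate (s := nodes) (v := (id : ℝ → ℝ))
      Function.injective_id.injOn (hr.trans_le (Nat.cast_le.2 hm))
    have h2 := congrArg (eval t) h
    rw [Lagrange.interpolate_apply, eval_finsetSum] at h2
    simp only [eval_mul, eval_C, id] at h2
    change r.eval t • x = _
    rw [h2, Finset.sum_smul]
    exact Finset.sum_congr rfl fun i _ => by rw [smul_smul, mul_comm]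
  | zero => simp
  | add f g _ _ hf hg => simp only [Pi.add_apply, smul_add, Finset.sum_add_distrib, ← hf, ← hg]
  | smul c f _ hf => rw [Pi.smul_apply, hf, Finset.smul_sum]; simp only [Pi.smul_apply, smul_comm c]

theorem polyMaps_ext {m : ℕ} {P Q : ℝ → E} (hP : P ∈ polyMaps E m) (hQ : Q ∈ polyMaps E m)
    {nodes : Finset ℝ} (hm : m ≤ nodes.card) (h : ∀ i ∈ nodes, P i = Q i) : P = Q := by
  ext t
  rw [eq_sum_basis_smul hP hm, eq_sum_basis_smul hQ hm]
  exact Finset.sum_congr rfl fun i hi => by rw [h i hi]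

theorem exists_polyMap_eq (nodes : Finset ℝ) (v : ℝ → E) :
    ∃ P ∈ polyMaps E nodes.card, ∀ i ∈ nodes, P i = v i :=
  ⟨_, sum_basis_smul_mem_polyMaps nodes v, fun _ hi => sum_basis_smul_apply v hi⟩

theorem hasDerivAt_polyMap {m : ℕ} {P : ℝ → E} (hP : P ∈ polyMaps E m) :
    ∃ Q ∈ polyMaps E (m - 1), ∀ t, HasDerivAt P (Q t) t := by
  induction hP using Submodule.span_induction with
  | mem f hf =>
    obtain ⟨r, x, hr, rfl⟩ := hf
    exact ⟨_, eval_smul_mem_polyMaps (degree_derivative_lt_sub_one hr) x,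
      fun t => (r.hasDerivAt t).smul_const x⟩
  | zero => exact ⟨0, Submodule.zero_mem _, fun t => hasDerivAt_const _ _⟩
  | add f g _ _ hf hg =>
    obtain ⟨q, hq, hq'⟩ := hf
    obtain ⟨r, hr, hr'⟩ := hg
    exact ⟨q + r, Submodule.add_mem _ hq hr, fun t => (hq' t).add (hr' t)⟩
  | smul c f _ hf =>
    obtain ⟨q, hq, hq'⟩ := hf
    exact ⟨c • q, Submodule.smul_mem _ c hq, fun t => (hq' t).const_smul c⟩

theorem differentiable_polyMap {m : ℕ} {P : ℝ → E} (hP : P ∈ polyMaps E m) :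
    Differentiable ℝ P := by
  obtain ⟨Q, _, h⟩ := hasDerivAt_polyMap hP
  exact fun t => (h t).differentiableAt

theorem deriv_mem_polyMaps {m : ℕ} {P : ℝ → E} (hP : P ∈ polyMaps E m) :
    deriv P ∈ polyMaps E (m - 1) := by
  obtain ⟨Q, hQ, h⟩ := hasDerivAt_polyMap hP
  rwa [show deriv P = Q from funext fun t => (h t).deriv]

theorem exists_antiderivative {m : ℕ} {r : ℝ[X]} (hr : r.degree < m) :
    ∃ R : ℝ[X], R.degree < (m + 1 : ℕ) ∧ derivative R = r ∧
      ∀ t, R.eval t = ∫ s in (0 : ℝ)..t, r.eval s := by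
  have hn : r ≠ 0 → r.natDegree < m := fun h0 => by
    rwa [degree_eq_natDegree h0, Nat.cast_lt] at hr
  rcases eq_or_ne r 0 with rfl | h0
  · exact ⟨0, by simp, by simp, by simp⟩
  let R : ℝ[X] := ∑ i ∈ Finset.range m, C (r.coeff i / (i + 1)) * X ^ (i + 1)
  have hR : derivative R = r := by
    rw [as_sum_range_C_mul_X_pow' r (hn h0), derivative_sum]
    refine Finset.sum_congr rfl fun i _ => ?_
    rw [derivative_C_mul_X_pow]
    push_cast
    rw [div_mul_cancel₀ _ (by positivity)]
  refine ⟨R, ?_, hR, fun t => ?_⟩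
  · rw [← mem_degreeLT]
    refine Submodule.sum_mem _ fun i hi => ?_
    rw [mem_degreeLT]
    refine (degree_C_mul_X_pow_le _ _).trans_lt ?_
    rw [Nat.cast_lt]
    have := Finset.mem_range.1 hi
    omega
  · have h := integral_eval_derivative R 0 t
    rw [hR] at h
    rw [h]
    simp [R, eval_finsetSum]

/-- The primitive of an interpolant. -/
theorem exists_primitive (nodes : Finset ℝ) (y : E) (v : ℝ → E) :
    ∃ P ∈ polyMaps E (nodes.card + 1),
      (∀ t, P t = y + ∑ j ∈ nodes, (∫ s in (0 : ℝ)..t, (Lagrange.basis nodes id j).eval s) • v j) ∧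
      (∀ t, HasDerivAt P (∑ j ∈ nodes, (Lagrange.basis nodes id j).eval t • v j) t) ∧
      ∀ i ∈ nodes, deriv P i = v i := by
  have hdeg : ∀ j ∈ nodes, (Lagrange.basis nodes (id : ℝ → ℝ) j).degree < (nodes.card : ℕ) := by
    intro i hi
    rw [Lagrange.degree_basis Function.injective_id.injOn hi, Nat.cast_lt]
    have := Finset.card_pos.2 ⟨i, hi⟩
    omega
  have hex : ∀ j, ∃ R : ℝ[X], j ∈ nodes → R.degree < (nodes.card + 1 : ℕ) ∧
      derivative R = Lagrange.basis nodes id j ∧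
      ∀ t, R.eval t = ∫ s in (0 : ℝ)..t, (Lagrange.basis nodes id j).eval s := by
    intro j
    by_cases hj : j ∈ nodes
    · obtain ⟨R, hR⟩ := exists_antiderivative (hdeg j hj)
      exact ⟨R, fun _ => hR⟩
    · exact ⟨0, fun h => absurd h hj⟩
  choose R hR using hex
  have hder : ∀ t, HasDerivAt (fun t => y + ∑ j ∈ nodes, (R j).eval t • v j)
      (∑ j ∈ nodes, (Lagrange.basis nodes id j).eval t • v j) t := by
    intro t
    refine (HasDerivAt.fun_sum fun j hj => ?_).const_add y
    rw [← (hR j hj).2.1]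
    exact ((R j).hasDerivAt t).smul_const (v j)
  refine ⟨fun t => y + ∑ j ∈ nodes, (R j).eval t • v j, ?_, fun t => ?_, hder, fun i hi => ?_⟩
  · exact Submodule.add_mem _ (const_mem_polyMaps (by omega) y)
      (sum_eval_smul_mem_polyMaps nodes (fun j hj => (hR j hj).1) v)
  · dsimp only
    congr 1
    exact Finset.sum_congr rfl fun j hj => by rw [(hR j hj).2.2 t]
  · rw [(hder i).deriv, sum_basis_smul_apply v hi]

/-- Interpolation reproduces P', so P and the primitive of the interpolant have the same derivative
and the same value at 0. The integrals of the basis polynomials are the coefficients of a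
collocation method. -/
theorem eq_add_sum_integral_basis {m : ℕ} {P : ℝ → E} (hP : P ∈ polyMaps E m) {nodes : Finset ℝ}
    (hm : m - 1 ≤ nodes.card) (t : ℝ) :
    P t = P 0 + ∑ j ∈ nodes,
      (∫ s in (0 : ℝ)..t, (Lagrange.basis nodes id j).eval s) • deriv P j := by
  obtain ⟨Q, _, hQ, hQ', _⟩ := exists_primitive nodes (P 0) (deriv P)
  rw [← hQ]
  have hd := differentiable_polyMap hP
  have h := is_const_of_deriv_eq_zero (f := fun t => P t - Q t)
    (fun t => (hd t).sub (hQ' t).differentiableAt) (fun s => by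
      rw [deriv_fun_sub (hd s) (hQ' s).differentiableAt, (hQ' s).deriv,
        ← eq_sum_basis_smul (deriv_mem_polyMaps hP) hm, sub_self]) t 0
  have h0 : Q 0 = P 0 := by rw [hQ]; simp
  simp only [h0, sub_self] at h
  exact sub_eq_zero.1 h

theorem apply_one_eq_add_sum_quadWeight {m : ℕ} {P : ℝ → E} (hP : P ∈ polyMaps E m)
    {nodes : Finset ℝ} (hm : m - 1 ≤ nodes.card) :
    P 1 = P 0 + ∑ j ∈ nodes, quadWeight nodes j • deriv P j :=
  eq_add_sum_integral_basis hP hm 1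

/-! ### Bilinear forms of polynomial maps: exact quadrature and integration by parts. -/

variable (M : E →L[ℝ] E →L[ℝ] ℝ)

/-- Degrees add, and since the bounds are strict the sum of the two bounds drops by one. This makes
scalar exactness available for `M`. -/
theorem bilin_polyMaps {m n : ℕ} {P Q : ℝ → E} (hP : P ∈ polyMaps E m) (hQ : Q ∈ polyMaps E n) :
    ∃ r : ℝ[X], r.degree < (m + n - 1 : ℕ) ∧ ∀ t, M (P t) (Q t) = r.eval t := by
  simp only [← mem_degreeLT]
  induction hP using Submodule.span_induction with
  | mem f hf =>
    obtain ⟨r, x, hr, rfl⟩ := hf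
    induction hQ using Submodule.span_induction with
    | mem g hg =>
      obtain ⟨q, y, hq, rfl⟩ := hg
      refine ⟨M x y • (r * q), Submodule.smul_mem _ _
        (mem_degreeLT.2 (degree_mul_lt_of_lt_of_lt hr hq)), fun t => ?_⟩
      simp only [map_smul, smul_apply, smul_eq_mul, eval_smul, eval_mul]
      ring
    | zero => exact ⟨0, Submodule.zero_mem _, by simp⟩
    | add f g _ _ hf hg =>
      obtain ⟨q, hq, hq'⟩ := hf
      obtain ⟨r, hr, hr'⟩ := hg
      exact ⟨q + r, Submodule.add_mem _ hq hr, fun t => by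
        rw [Pi.add_apply, map_add, hq', hr', eval_add]⟩
    | smul c f _ hf =>
      obtain ⟨q, hq, hq'⟩ := hf
      exact ⟨c • q, Submodule.smul_mem _ c hq, fun t => by
        rw [Pi.smul_apply, map_smul, hq', eval_smul]⟩
  | zero => exact ⟨0, Submodule.zero_mem _, by simp⟩
  | add f g _ _ hf hg =>
    obtain ⟨q, hq, hq'⟩ := hf
    obtain ⟨r, hr, hr'⟩ := hg
    exact ⟨q + r, Submodule.add_mem _ hq hr, fun t => by
      rw [Pi.add_apply, map_add, add_apply, hq', hr', eval_add]⟩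
  | smul c f _ hf =>
    obtain ⟨q, hq, hq'⟩ := hf
    exact ⟨c • q, Submodule.smul_mem _ c hq, fun t => by
      rw [Pi.smul_apply, map_smul, smul_apply, hq', eval_smul]⟩

/-- The interpolatory rule with these nodes is exact for degree less than `k`. -/
def IsExactRule (nodes : Finset ℝ) (k : ℕ) : Prop :=
  ∀ r : ℝ[X], r.degree < k → ∫ s in (0 : ℝ)..1, r.eval s = ∑ i ∈ nodes, quadWeight nodes i * r.eval i

theorem IsExactRule.bilin {nodes : Finset ℝ} {k m n : ℕ} (h : IsExactRule nodes k)
    {P Q : ℝ → E} (hP : P ∈ polyMaps E m) (hQ : Q ∈ polyMaps E n) (hk : m + n - 1 ≤ k) :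
    ∫ s in (0 : ℝ)..1, M (P s) (Q s) = ∑ i ∈ nodes, quadWeight nodes i * M (P i) (Q i) := by
  obtain ⟨r, hr, hr'⟩ := bilin_polyMaps M hP hQ
  simp only [hr']
  exact h r (hr.trans_le (Nat.cast_le.2 hk))

theorem integral_bilin_deriv {m n : ℕ} {P Q : ℝ → E} (hP : P ∈ polyMaps E m)
    (hQ : Q ∈ polyMaps E n) :
    ∫ s in (0 : ℝ)..1, M (P s) (deriv Q s)
      = M (P 1) (Q 1) - M (P 0) (Q 0) - ∫ s in (0 : ℝ)..1, M (deriv P s) (Q s) := by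
  have c1 : Continuous fun s => M (P s) (deriv Q s) := by
    have h1 := (differentiable_polyMap hP).continuous
    have h2 := (differentiable_polyMap (deriv_mem_polyMaps hQ)).continuous
    fun_prop
  have c2 : Continuous fun s => M (deriv P s) (Q s) := by
    have h1 := (differentiable_polyMap hQ).continuous
    have h2 := (differentiable_polyMap (deriv_mem_polyMaps hP)).continuous
    fun_prop
  have h := intervalIntegral.integral_eq_sub_of_hasDerivAt (a := 0) (b := 1)
    (f := fun s => M (P s) (Q s))
    (fun s _ => ContinuousLinearMap.hasDerivAt_of_bilinear (B := M)
      (fun _ => (differentiable_polyMap hP s).hasDerivAt)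
      (fun _ => (differentiable_polyMap hQ s).hasDerivAt))
    ((c1.add c2).intervalIntegrable _ _)
  rw [intervalIntegral.integral_add (c1.intervalIntegrable _ _) (c2.intervalIntegrable _ _)] at h
  linarith

end PolyMaps

/-! ### Time slabs -/

section Slabs

variable {E : Type*} [NormedAddCommGroup E] [NormedSpace ℝ E] {N : ℕ} {τ : Fin (N + 1) → ℝ}

theorem stepSize_pos (hτ : StrictMono τ) (n : Fin N) : 0 < stepSize τ n :=
  sub_pos.2 (hτ n.castSucc_lt_succ)

@[simp] theorem slabTime_zero (n : Fin N) : slabTime τ n 0 = τ n.castSucc := by simp [slabTime]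

@[simp] theorem slabTime_one (n : Fin N) : slabTime τ n 1 = τ n.succ := by
  simp [slabTime, stepSize]

theorem slabTime_mem (hτ : StrictMono τ) (n : Fin N) {s : ℝ} (hs : s ∈ Icc (0 : ℝ) 1) :
    slabTime τ n s ∈ Icc (τ n.castSucc) (τ n.succ) := by
  have h := stepSize_pos hτ n
  have h2 : τ n.succ = τ n.castSucc + stepSize τ n := by simp [stepSize]
  rw [slabTime, h2]
  constructor <;> nlinarith [hs.1, hs.2]

theorem slabTime_mem_Ioo (hτ : StrictMono τ) (n : Fin N) {s : ℝ} (hs : s ∈ Ioo (0 : ℝ) 1) :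
    slabTime τ n s ∈ Ioo (τ n.castSucc) (τ n.succ) := by
  have h := stepSize_pos hτ n
  have h2 : τ n.succ = τ n.castSucc + stepSize τ n := by simp [stepSize]
  rw [slabTime, h2]
  constructor <;> nlinarith [hs.1, hs.2]

theorem slabTime_div (hτ : StrictMono τ) (n : Fin N) (t : ℝ) :
    slabTime τ n ((t - τ n.castSucc) / stepSize τ n) = t := by
  rw [slabTime, div_mul_cancel₀ _ (stepSize_pos hτ n).ne']
  ring

theorem div_mem_Icc (hτ : StrictMono τ) (n : Fin N) {t : ℝ}
    (ht : t ∈ Icc (τ n.castSucc) (τ n.succ)) :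
    (t - τ n.castSucc) / stepSize τ n ∈ Icc (0 : ℝ) 1 := by
  have h := stepSize_pos hτ n
  refine ⟨div_nonneg (sub_nonneg.2 ht.1) h.le, (div_le_one h).2 ?_⟩
  simpa [stepSize] using ht.2

theorem div_mem_Ioo (hτ : StrictMono τ) (n : Fin N) {t : ℝ}
    (ht : t ∈ Ioo (τ n.castSucc) (τ n.succ)) :
    (t - τ n.castSucc) / stepSize τ n ∈ Ioo (0 : ℝ) 1 := by
  have h := stepSize_pos hτ n
  refine ⟨div_pos (sub_pos.2 ht.1) h, (div_lt_one h).2 ?_⟩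
  simpa [stepSize] using ht.2

theorem exists_slab (hτ : StrictMono τ) (hN : N ≠ 0) {t : ℝ}
    (ht : t ∈ Icc (τ 0) (τ (Fin.last N))) :
    ∃ n : Fin N, ∃ s ∈ Icc (0 : ℝ) 1, t = slabTime τ n s := by
  have key : ∀ k : Fin (N + 1), k ≠ 0 → t ≤ τ k →
      ∃ n : Fin N, t ∈ Icc (τ n.castSucc) (τ n.succ) := by
    intro k
    induction k using Fin.induction with
    | zero => exact fun h => absurd rfl h
    | succ k ih =>
      intro _ hk
      by_cases h : τ k.castSucc ≤ t
      · exact ⟨k, h, hk⟩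
      · refine ih (fun h0 => h (h0 ▸ ht.1)) (not_le.1 h).le
  obtain ⟨n, hn⟩ := key (Fin.last N) (by
    intro h
    exact hN (by simpa using congrArg Fin.val h)) ht.2
  exact ⟨n, _, div_mem_Icc hτ n hn, (slabTime_div hτ n t).symm⟩

theorem isPolyOn_iff (hτ : StrictMono τ) {p : ℕ} {U : ℝ → E} (n : Fin N) :
    IsPolyOn (τ n.castSucc) (τ n.succ) p U ↔
      ∃ P ∈ polyMaps E (p + 1), ∀ s ∈ Icc (0 : ℝ) 1, U (slabTime τ n s) = P s := by
  have h := stepSize_pos hτ n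
  constructor
  · rintro ⟨q, hq⟩
    have hP := comp_affine_mem_polyMaps
      (mem_polyMaps_iff.2 ⟨q, fun t => (rfl : _ = ∑ k : Fin (p + 1), t ^ (k : ℕ) • q k)⟩)
      (τ n.castSucc) (stepSize τ n)
    refine ⟨_, hP, fun s hs => ?_⟩
    rw [hq _ (slabTime_mem hτ n hs), slabTime, mul_comm s]
  · rintro ⟨P, hP, hP'⟩
    obtain ⟨q, hq⟩ := mem_polyMaps_iff.1
      (comp_affine_mem_polyMaps hP (-τ n.castSucc / stepSize τ n) (stepSize τ n)⁻¹)
    refine ⟨q, fun t ht => ?_⟩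
    rw [← hq]
    conv_lhs => rw [← slabTime_div hτ n t]
    rw [hP' _ (div_mem_Icc hτ n ht)]
    congr 1
    field_simp
    ring

/-- `P n`, `n = 0, …, N - 1`, are the polynomials in the reference variable `s ∈ [0, 1]` that
represent `U` on the slabs. -/
def IsSlabRep (τ : Fin (N + 1) → ℝ) (p : ℕ) (U : ℝ → E) (P : Fin N → ℝ → E) : Prop :=
  (∀ n, P n ∈ polyMaps E (p + 1)) ∧ ∀ n, ∀ s ∈ Icc (0 : ℝ) 1, U (slabTime τ n s) = P n s

theorem isTrial_iff (hτ : StrictMono τ) {p : ℕ} {U : ℝ → E} :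
    IsTrial τ p U ↔ ∃ P, IsSlabRep τ p U P := by
  constructor
  · intro h
    choose P hP hP' using fun n => (isPolyOn_iff hτ n).1 (h n)
    exact ⟨P, hP, hP'⟩
  · rintro ⟨P, hP, hP'⟩ n
    exact (isPolyOn_iff hτ n).2 ⟨P n, hP n, hP' n⟩

theorem IsSlabRep.apply_zero {p : ℕ} {U : ℝ → E} {P : Fin N → ℝ → E} (h : IsSlabRep τ p U P)
    (n : Fin N) : P n 0 = U (τ n.castSucc) := by
  rw [← h.2 n 0 (by simp), slabTime_zero]

theorem IsSlabRep.apply_one {p : ℕ} {U : ℝ → E} {P : Fin N → ℝ → E} (h : IsSlabRep τ p U P)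
    (n : Fin N) : P n 1 = U (τ n.succ) := by
  rw [← h.2 n 1 (by simp), slabTime_one]

theorem IsSlabRep.eqOn (hτ : StrictMono τ) (hN : N ≠ 0) {p : ℕ} {U V : ℝ → E}
    {P : Fin N → ℝ → E} (hU : IsSlabRep τ p U P) (hV : IsSlabRep τ p V P) :
    EqOn U V (Icc (τ 0) (τ (Fin.last N))) := by
  intro t ht
  obtain ⟨n, s, hs, rfl⟩ := exists_slab hτ hN ht
  rw [hU.2 n s hs, hV.2 n s hs]

/-- Polynomials on the slabs with matching values at the mesh nodes form a trial function. -/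
theorem exists_isSlabRep (hτ : StrictMono τ) {p : ℕ} {P : Fin N → ℝ → E}
    (hP : ∀ n, P n ∈ polyMaps E (p + 1)) (w : Fin (N + 1) → E) (h0 : ∀ n, P n 0 = w n.castSucc)
    (h1 : ∀ n, P n 1 = w n.succ) (hN : N ≠ 0) :
    ∃ U : ℝ → E, IsSlabRep τ p U P ∧ ∀ n, U (τ n) = w n := by
  classical
  let ref (n : Fin N) (t : ℝ) : ℝ := (t - τ n.castSucc) / stepSize τ n
  -- A point in two different slabs is their common mesh node, where both polynomials take the
  -- prescribed value `w`.
  have hlt : ∀ m n : Fin N, m < n → ∀ t, t ∈ Icc (τ m.castSucc) (τ m.succ) →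
      t ∈ Icc (τ n.castSucc) (τ n.succ) → P m (ref m t) = P n (ref n t) := by
    intro m n hmn t hm hn
    have hle : m.succ ≤ n.castSucc := by
      rw [Fin.le_def]; simpa using hmn
    have h2 : τ m.succ = τ n.castSucc :=
      le_antisymm (hτ.monotone hle) (hn.1.trans hm.2)
    have h3 : m.succ = n.castSucc := hτ.injective h2
    have ht : t = τ m.succ := le_antisymm hm.2 (h2 ▸ hn.1)
    have e1 : ref m t = 1 := by
      change (t - τ m.castSucc) / stepSize τ m = 1
      rw [ht]; exact div_self (stepSize_pos hτ m).ne'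
    have e2 : ref n t = 0 := by
      change (t - τ n.castSucc) / stepSize τ n = 0
      rw [ht, h2, sub_self, zero_div]
    rw [e1, e2, h1, h0, h3]
  have hcons : ∀ m n : Fin N, ∀ t, t ∈ Icc (τ m.castSucc) (τ m.succ) →
      t ∈ Icc (τ n.castSucc) (τ n.succ) → P m (ref m t) = P n (ref n t) := by
    intro m n t hm hn
    rcases lt_trichotomy m n with h | rfl | h
    · exact hlt m n h t hm hn
    · rfl
    · exact (hlt n m h t hn hm).symm
  -- By `hcons` the choice among the slabs containing t is immaterial; the value 0 is used only off
  -- the mesh.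
  let U : ℝ → E := fun t =>
    if h : ∃ n : Fin N, t ∈ Icc (τ n.castSucc) (τ n.succ) then P h.choose (ref h.choose t) else 0
  have hU : IsSlabRep τ p U P := by
    refine ⟨hP, fun n s hs => ?_⟩
    have hex : ∃ n' : Fin N, slabTime τ n s ∈ Icc (τ n'.castSucc) (τ n'.succ) :=
      ⟨n, slabTime_mem hτ n hs⟩
    change dite _ _ _ = _
    rw [dif_pos hex, hcons _ n _ hex.choose_spec (slabTime_mem hτ n hs)]
    congr 1
    change (slabTime τ n s - τ n.castSucc) / stepSize τ n = s
    rw [slabTime, add_sub_cancel_left, mul_div_cancel_right₀ _ (stepSize_pos hτ n).ne']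
  refine ⟨U, hU, fun n => ?_⟩
  induction n using Fin.cases with
  | zero =>
    have := hU.apply_zero ⟨0, Nat.pos_of_ne_zero hN⟩
    rw [h0] at this
    exact this.symm
  | succ n => rw [← hU.apply_one, h1]

theorem hasDerivWithinAt_slab (hτ : StrictMono τ) {n : Fin N} {V Q : ℝ → E}
    (hV : ∀ s ∈ Icc (0 : ℝ) 1, V (slabTime τ n s) = Q s) (hQ : Differentiable ℝ Q) {s : ℝ}
    (hs : s ∈ Icc (0 : ℝ) 1) :
    HasDerivWithinAt V ((stepSize τ n)⁻¹ • deriv Q s) (Icc (τ n.castSucc) (τ n.succ))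
      (slabTime τ n s) := by
  have h := stepSize_pos hτ n
  have e : (slabTime τ n s - τ n.castSucc) / stepSize τ n = s := by
    rw [slabTime, add_sub_cancel_left, mul_div_cancel_right₀ _ h.ne']
  have hd : HasDerivAt (fun t => Q ((t - τ n.castSucc) / stepSize τ n))
      ((stepSize τ n)⁻¹ • deriv Q s) (slabTime τ n s) := by
    have h1 : HasDerivAt (fun t => (t - τ n.castSucc) / stepSize τ n) (stepSize τ n)⁻¹
        (slabTime τ n s) := by
      simpa using ((hasDerivAt_id (slabTime τ n s)).sub_const (τ n.castSucc)).div_const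
        (stepSize τ n)
    exact HasDerivAt.scomp _ (by rw [e]; exact (hQ s).hasDerivAt) h1
  refine hd.hasDerivWithinAt.congr_of_mem (fun t ht => ?_) (slabTime_mem hτ n hs)
  conv_lhs => rw [← slabTime_div hτ n t]
  rw [hV _ (div_mem_Icc hτ n ht)]

theorem slabDeriv_slabTime (hτ : StrictMono τ) {n : Fin N} {V Q : ℝ → E}
    (hV : ∀ s ∈ Icc (0 : ℝ) 1, V (slabTime τ n s) = Q s) (hQ : Differentiable ℝ Q) {s : ℝ}
    (hs : s ∈ Icc (0 : ℝ) 1) :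
    slabDeriv τ V n (slabTime τ n s) = (stepSize τ n)⁻¹ • deriv Q s :=
  (hasDerivWithinAt_slab hτ hV hQ hs).derivWithin
    (uniqueDiffOn_Icc (hτ n.castSucc_lt_succ) _ (slabTime_mem hτ n hs))

theorem deriv_slabTime (hτ : StrictMono τ) {n : Fin N} {V Q : ℝ → E}
    (hV : ∀ s ∈ Icc (0 : ℝ) 1, V (slabTime τ n s) = Q s) (hQ : Differentiable ℝ Q) {s : ℝ}
    (hs : s ∈ Ioo (0 : ℝ) 1) :
    deriv V (slabTime τ n s) = (stepSize τ n)⁻¹ • deriv Q s := by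
  have h := slabTime_mem_Ioo hτ n hs
  exact ((hasDerivWithinAt_slab hτ hV hQ (Ioo_subset_Icc_self hs)).hasDerivAt
    (Icc_mem_nhds h.1 h.2)).deriv

/-- Agreement is required only on the open slab, because the two-sided derivative of a trial
function need not be meaningful at mesh nodes; integrals do not see these points. -/
theorem integral_slab (hτ : StrictMono τ) (n : Fin N) {f G : ℝ → ℝ} (hG : Continuous G)
    (hf : ∀ s ∈ Ioo (0 : ℝ) 1, f (slabTime τ n s) = G s) :
    IntervalIntegrable f volume (τ n.castSucc) (τ n.succ) ∧
      ∫ t in (τ n.castSucc)..(τ n.succ), f t = stepSize τ n * ∫ s in (0 : ℝ)..1, G s := by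
  constructor
  · have hc : Continuous fun t => G ((t - τ n.castSucc) / stepSize τ n) := by fun_prop
    refine (hc.intervalIntegrable (τ n.castSucc) (τ n.succ)).congr_uIoo fun t ht => ?_
    rw [uIoo_of_le (hτ n.castSucc_lt_succ).le] at ht
    conv_rhs => rw [← slabTime_div hτ n t]
    rw [hf _ (div_mem_Ioo hτ n ht)]
  · have h := intervalIntegral.mul_integral_comp_add_mul (a := 0) (b := 1) (f := f) (stepSize τ n)
      (τ n.castSucc)
    rw [mul_zero, add_zero, mul_one, show τ n.castSucc + stepSize τ n = τ n.succ by
      simp [stepSize]] at h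
    rw [← h]
    congr 1
    refine intervalIntegral.integral_congr_uIoo fun s hs => ?_
    rw [uIoo_of_le zero_le_one] at hs
    rw [← hf s hs, slabTime, mul_comm s]

theorem integral_slabs (hτ : StrictMono τ) {f : ℝ → ℝ} {G : Fin N → ℝ → ℝ}
    (hG : ∀ n, Continuous (G n)) (hf : ∀ n, ∀ s ∈ Ioo (0 : ℝ) 1, f (slabTime τ n s) = G n s) :
    ∫ t in (τ 0)..(τ (Fin.last N)), f t = ∑ n, stepSize τ n * ∫ s in (0 : ℝ)..1, G n s := by
  -- The mesh continued to all natural indices; the default value beyond N is never used.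
  let a : ℕ → ℝ := fun k => if h : k < N + 1 then τ ⟨k, h⟩ else 0
  have ha : ∀ k (h : k < N + 1), a k = τ ⟨k, h⟩ := fun k h => dif_pos h
  have e1 : ∀ n : Fin N, a n = τ n.castSucc := fun n => ha _ _
  have e2 : ∀ n : Fin N, a (n + 1) = τ n.succ := fun n => ha _ _
  have h := intervalIntegral.sum_integral_adjacent_intervals (f := f) (μ := volume) (a := a)
    (n := N) (fun k hk => by
      have := (integral_slab hτ ⟨k, hk⟩ (hG ⟨k, hk⟩) (hf ⟨k, hk⟩)).1
      rw [← e1, ← e2] at this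
      exact this)
  rw [show τ 0 = a 0 from (ha 0 (by omega)).symm,
    show τ (Fin.last N) = a N from (ha N (by omega)).symm, ← h, Finset.sum_range]
  refine Finset.sum_congr rfl fun n _ => ?_
  rw [e1, e2, (integral_slab hτ n (hG n) (hf n)).2]

theorem sum_succ_sub_castSucc {N : ℕ} (f : Fin (N + 1) → ℝ) :
    ∑ n : Fin N, (f n.succ - f n.castSucc) = f (Fin.last N) - f 0 := by
  induction N with
  | zero => simp
  | succ N ih =>
    rw [Fin.sum_univ_castSucc]
    have := ih (fun n => f n.castSucc)
    simp only [Fin.succ_castSucc, Fin.succ_last] at this ⊢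
    rw [this]
    simp

end Slabs

/-! ### The time discretization of `u'' = acc(t, u)` -/

section Recursion

theorem exists_forward_rec {E : Type*} {N : ℕ} (a : E) (φ : Fin N → E → E) :
    ∃ w : Fin (N + 1) → E, w 0 = a ∧ ∀ n, w n.succ = φ n (w n.castSucc) :=
  ⟨fun k => Fin.induction (motive := fun _ => E) a (fun n x => φ n x) k, rfl, fun _ => rfl⟩

/-- Test functions must vanish at the final time, so their nodal values can be constructed from the
last slab backwards. -/
theorem exists_backward_rec {E : Type*} {N : ℕ} (a : E) (φ : Fin N → E → E) :
    ∃ w : Fin (N + 1) → E, w (Fin.last N) = a ∧ ∀ n, w n.castSucc = φ n (w n.succ) :=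
  ⟨fun k => Fin.reverseInduction (motive := fun _ => E) a (fun n x => φ n x) k,
    Fin.reverseInduction_last, Fin.reverseInduction_castSucc⟩

theorem eq_zero_of_sum_sum_eq_zero {N : ℕ} {nodes : Finset ℝ} {c : Fin N → ℝ → ℝ}
    (hc : ∀ n, ∀ i ∈ nodes, 0 ≤ c n i) (h : ∑ n, ∑ i ∈ nodes, c n i = 0) :
    ∀ n, ∀ i ∈ nodes, c n i = 0 := by
  intro n
  have h1 := (Finset.sum_eq_zero_iff_of_nonneg
    (fun n _ => Finset.sum_nonneg (hc n))).1 h n (Finset.mem_univ n)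
  exact (Finset.sum_eq_zero_iff_of_nonneg (hc n)).1 h1

end Recursion

section Schemes

variable {E : Type*} [NormedAddCommGroup E] [NormedSpace ℝ E] (M : E →L[ℝ] E →L[ℝ] ℝ)
  (acc : ℝ → E → E) (nodes : Finset ℝ) {N : ℕ} (τ : Fin (N + 1) → ℝ) (p : ℕ)

/-- The second-order-in-time scheme for `u'' = acc(t, u)`. -/
def BilinScheme (U₀ V₀ : E) (U : ℝ → E) : Prop :=
  IsTrial τ p U ∧ U (τ 0) = U₀ ∧
  ∀ W : ℝ → E, IsTrial τ p W → W (τ (Fin.last N)) = 0 →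
    -(∫ t in (τ 0)..(τ (Fin.last N)), M (deriv U t) (deriv W t))
      - ∑ n, slabQuad nodes τ n (fun t => M (acc t (U t)) (W t)) = M V₀ (W (τ 0))

/-- Reconstructed velocities with respect to the inner product `M`. -/
def BilinReconstruction (V₀ : E) (U Vt : ℝ → E) : Prop :=
  IsTrial τ p Vt ∧ Vt (τ 0) = V₀ ∧
  ∀ W : ℝ → E, IsTrial τ p W →
    ∫ t in (τ 0)..(τ (Fin.last N)), M (Vt t) (deriv W t)
      = ∫ t in (τ 0)..(τ (Fin.last N)), M (deriv U t) (deriv W t)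

/-- Hybrid velocities with respect to the inner product `M`. -/
def BilinHybrid (V₀ : E) (U : ℝ → E) (Vh : Fin (N + 1) → E) : Prop :=
  Vh 0 = V₀ ∧
  ∀ (n : Fin N) (l : ℝ → E), IsPolyOn (τ n.castSucc) (τ n.succ) p l →
    (∫ t in (τ n.castSucc)..(τ n.succ), M (slabDeriv τ (slabDeriv τ U n) n t) (l t))
      + M (Vh n.succ - slabDeriv τ U n (τ n.succ)) (l (τ n.succ))
      - M (Vh n.castSucc - slabDeriv τ U n (τ n.castSucc)) (l (τ n.castSucc))
      - slabQuad nodes τ n (fun t => M (acc t (U t)) (l t)) = 0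

variable {nodes τ p}

theorem IsSlabRep.continuous {U : ℝ → E} {P : Fin N → ℝ → E} (h : IsSlabRep τ p U P) (n : Fin N) :
    Continuous (P n) :=
  (differentiable_polyMap (h.1 n)).continuous

theorem IsSlabRep.differentiable {U : ℝ → E} {P : Fin N → ℝ → E} (h : IsSlabRep τ p U P)
    (n : Fin N) : Differentiable ℝ (P n) :=
  differentiable_polyMap (h.1 n)

theorem IsSlabRep.deriv_mem {U : ℝ → E} {P : Fin N → ℝ → E} (h : IsSlabRep τ p U P)
    (n : Fin N) : deriv (P n) ∈ polyMaps E p := by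
  have := deriv_mem_polyMaps (h.1 n)
  rwa [Nat.add_sub_cancel] at this

theorem IsSlabRep.continuous_deriv {U : ℝ → E} {P : Fin N → ℝ → E} (h : IsSlabRep τ p U P)
    (n : Fin N) : Continuous (deriv (P n)) :=
  (differentiable_polyMap (h.deriv_mem n)).continuous

theorem IsSlabRep.deriv_eq (hτ : StrictMono τ) {U : ℝ → E} {P : Fin N → ℝ → E}
    (h : IsSlabRep τ p U P) (n : Fin N) {s : ℝ} (hs : s ∈ Ioo (0 : ℝ) 1) :
    deriv U (slabTime τ n s) = (stepSize τ n)⁻¹ • deriv (P n) s :=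
  deriv_slabTime hτ (h.2 n) (h.differentiable n) hs

theorem integral_deriv_deriv (hτ : StrictMono τ) {U W : ℝ → E} {P R : Fin N → ℝ → E}
    (hU : IsSlabRep τ p U P) (hW : IsSlabRep τ p W R) :
    ∫ t in (τ 0)..(τ (Fin.last N)), M (deriv U t) (deriv W t)
      = ∑ n, (stepSize τ n)⁻¹ * ∫ s in (0 : ℝ)..1, M (deriv (P n) s) (deriv (R n) s) := by
  rw [integral_slabs hτ (G := fun n s => (stepSize τ n)⁻¹ * ((stepSize τ n)⁻¹ *
    M (deriv (P n) s) (deriv (R n) s)))]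
  · refine Finset.sum_congr rfl fun n _ => ?_
    have h := (stepSize_pos hτ n).ne'
    rw [intervalIntegral.integral_const_mul, intervalIntegral.integral_const_mul,
      mul_inv_cancel_left₀ h]
  · intro n
    have h1 := hU.continuous_deriv n
    have h2 := hW.continuous_deriv n
    fun_prop
  · intro n s hs
    rw [hU.deriv_eq hτ n hs, hW.deriv_eq hτ n hs]
    simp

theorem integral_apply_deriv (hτ : StrictMono τ) {V W : ℝ → E} {Q R : Fin N → ℝ → E}
    (hV : IsSlabRep τ p V Q) (hW : IsSlabRep τ p W R) :
    ∫ t in (τ 0)..(τ (Fin.last N)), M (V t) (deriv W t)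
      = ∑ n, ∫ s in (0 : ℝ)..1, M (Q n s) (deriv (R n) s) := by
  rw [integral_slabs hτ (G := fun n s => (stepSize τ n)⁻¹ * M (Q n s) (deriv (R n) s))]
  · refine Finset.sum_congr rfl fun n _ => ?_
    have h := (stepSize_pos hτ n).ne'
    rw [intervalIntegral.integral_const_mul, mul_inv_cancel_left₀ h]
  · intro n
    have h1 := hV.continuous n
    have h2 := hW.continuous_deriv n
    fun_prop
  · intro n s hs
    rw [hV.2 n s (Ioo_subset_Icc_self hs), hW.deriv_eq hτ n hs]
    simp

theorem slabQuad_eq (hn : ∀ i ∈ nodes, i ∈ Icc (0 : ℝ) 1) {U W : ℝ → E} {P R : Fin N → ℝ → E}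
    (hU : IsSlabRep τ p U P) (hW : IsSlabRep τ p W R) (n : Fin N) :
    slabQuad nodes τ n (fun t => M (acc t (U t)) (W t))
      = stepSize τ n * ∑ i ∈ nodes,
          quadWeight nodes i * M (acc (slabTime τ n i) (P n i)) (R n i) := by
  rw [slabQuad]
  congr 1
  refine Finset.sum_congr rfl fun i hi => ?_
  rw [hU.2 n i (hn i hi), hW.2 n i (hn i hi)]

/-- A Gauss rule with `p` nodes. -/
structure IsGaussRule (nodes : Finset ℝ) (p : ℕ) : Prop where
  card : nodes.card = p
  mem : ∀ i ∈ nodes, i ∈ Ioo (0 : ℝ) 1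
  pos : ∀ i ∈ nodes, 0 < quadWeight nodes i
  exact : IsExactRule nodes (2 * p)

theorem IsGaussRule.mem_Icc (hG : IsGaussRule nodes p) : ∀ i ∈ nodes, i ∈ Icc (0 : ℝ) 1 :=
  fun i hi => Ioo_subset_Icc_self (hG.mem i hi)

theorem IsGaussRule.zero_notMem (hG : IsGaussRule nodes p) : (0 : ℝ) ∉ nodes :=
  fun h => (hG.mem 0 h).1.false

theorem IsGaussRule.one_notMem (hG : IsGaussRule nodes p) : (1 : ℝ) ∉ nodes :=
  fun h => (hG.mem 1 h).2.false

/-! ### Gauss-Legendre quadrature in time. -/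

variable {M acc}

theorem eq_zero_of_forall_quad_eq_zero (hpos : ∀ x, x ≠ 0 → 0 < M x x)
    (hw : ∀ i ∈ nodes, 0 < quadWeight nodes i) {v : Fin N → ℝ → E}
    (h : ∑ n, ∑ i ∈ nodes, quadWeight nodes i * M (v n i) (v n i) = 0) :
    ∀ n, ∀ i ∈ nodes, v n i = 0 := by
  have hnn : ∀ x, 0 ≤ M x x := fun x => by
    rcases eq_or_ne x 0 with rfl | hx
    · simp
    · exact (hpos x hx).le
  intro n i hi
  have h1 := eq_zero_of_sum_sum_eq_zero
    (fun n i hi => mul_nonneg (hw i hi).le (hnn (v n i))) h n i hi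
  by_contra hne
  exact (mul_pos (hw i hi) (hpos _ hne)).ne' h1

/-- The integrands have degree at most 2p - 1, so both sides are nodal sums. On every slab the
derivative of a test function can take any values at the p nodes, as continuity only fixes
integration constants. Hence the defect itself can serve as ∂ₜW. -/
theorem reconstruction_iff (hτ : StrictMono τ) (hN : N ≠ 0) (hpos : ∀ x, x ≠ 0 → 0 < M x x)
    (hG : IsGaussRule nodes p) {U V : ℝ → E} {P Q : Fin N → ℝ → E}
    (hU : IsSlabRep τ p U P) (hV : IsSlabRep τ p V Q) :
    (∀ W : ℝ → E, IsTrial τ p W →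
      ∫ t in (τ 0)..(τ (Fin.last N)), M (V t) (deriv W t)
        = ∫ t in (τ 0)..(τ (Fin.last N)), M (deriv U t) (deriv W t)) ↔
    ∀ n, ∀ i ∈ nodes, deriv (P n) i = stepSize τ n • Q n i := by
  have key : ∀ (W : ℝ → E) (R : Fin N → ℝ → E), IsSlabRep τ p W R →
      (∫ t in (τ 0)..(τ (Fin.last N)), M (V t) (deriv W t))
        - ∫ t in (τ 0)..(τ (Fin.last N)), M (deriv U t) (deriv W t)
      = ∑ n, ∑ i ∈ nodes, quadWeight nodes i *
          M (Q n i - (stepSize τ n)⁻¹ • deriv (P n) i) (deriv (R n) i) := by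
    intro W R hW
    rw [integral_apply_deriv M hτ hV hW, integral_deriv_deriv M hτ hU hW, ← Finset.sum_sub_distrib]
    refine Finset.sum_congr rfl fun n _ => ?_
    rw [hG.exact.bilin M (hV.1 n) (hW.deriv_mem n) (by omega),
      hG.exact.bilin M (hU.deriv_mem n) (hW.deriv_mem n) (by omega), Finset.mul_sum,
      ← Finset.sum_sub_distrib]
    refine Finset.sum_congr rfl fun i _ => ?_
    simp only [map_sub, map_smul, sub_apply, smul_apply, smul_eq_mul]
    ring
  constructor
  · intro h
    let v : Fin N → ℝ → E := fun n i => Q n i - (stepSize τ n)⁻¹ • deriv (P n) i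
    -- The mesh values of the test function: its increment over a slab is the quadrature of the
    -- prescribed derivative `v`.
    obtain ⟨w, -, hw⟩ := exists_forward_rec (0 : E)
      (fun n x => x + ∑ j ∈ nodes, quadWeight nodes j • v n j)
    choose R hR hR1 _ hR3 using fun n => exists_primitive nodes (w n.castSucc) (v n)
    have hR' : ∀ n, R n ∈ polyMaps E (p + 1) := fun n => by
      have := hR n; rwa [hG.card] at this
    obtain ⟨W, hW, -⟩ := exists_isSlabRep hτ hR' w (fun n => by simp [hR1])
      (fun n => by rw [hR1, hw]; rfl) hN
    have h2 := key W R hW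
    rw [h W ((isTrial_iff hτ).2 ⟨R, hW⟩), sub_self] at h2
    have h3 : ∑ n, ∑ i ∈ nodes, quadWeight nodes i * M (v n i) (v n i) = 0 := by
      rw [h2]
      exact Finset.sum_congr rfl fun n _ => Finset.sum_congr rfl fun i hi => by rw [hR3 n i hi]
    intro n i hi
    have h4 := eq_zero_of_forall_quad_eq_zero hpos hG.pos h3 n i hi
    rw [sub_eq_zero.1 h4, smul_inv_smul₀ (stepSize_pos hτ n).ne']
  · intro h W hW
    obtain ⟨R, hR⟩ := (isTrial_iff hτ).1 hW
    rw [← sub_eq_zero, key W R hR]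
    refine Finset.sum_eq_zero fun n _ => Finset.sum_eq_zero fun i hi => ?_
    rw [h n i hi, inv_smul_smul₀ (stepSize_pos hτ n).ne', sub_self]
    simp

/-- At the nodes ∂ₜU can be replaced by the continuous function V, so a slabwise integration by
parts leaves boundary terms that telescope to the initial pairing. The test values at all Gauss
nodes are then free. -/
theorem scheme_gauss_iff (hτ : StrictMono τ) (hN : N ≠ 0) (hpos : ∀ x, x ≠ 0 → 0 < M x x)
    (hG : IsGaussRule nodes p) {U V : ℝ → E} {P Q : Fin N → ℝ → E}
    (hU : IsSlabRep τ p U P) (hV : IsSlabRep τ p V Q)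
    (hPQ : ∀ n, ∀ i ∈ nodes, deriv (P n) i = stepSize τ n • Q n i) :
    (∀ W : ℝ → E, IsTrial τ p W → W (τ (Fin.last N)) = 0 →
      -(∫ t in (τ 0)..(τ (Fin.last N)), M (deriv U t) (deriv W t))
        - ∑ n, slabQuad nodes τ n (fun t => M (acc t (U t)) (W t)) = M (V (τ 0)) (W (τ 0))) ↔
    ∀ n, ∀ i ∈ nodes, deriv (Q n) i = stepSize τ n • acc (slabTime τ n i) (P n i) := by
  have key : ∀ (W : ℝ → E) (R : Fin N → ℝ → E), IsSlabRep τ p W R → W (τ (Fin.last N)) = 0 →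
      -(∫ t in (τ 0)..(τ (Fin.last N)), M (deriv U t) (deriv W t))
        - ∑ n, slabQuad nodes τ n (fun t => M (acc t (U t)) (W t)) - M (V (τ 0)) (W (τ 0))
      = ∑ n, ∑ i ∈ nodes, quadWeight nodes i *
          M (deriv (Q n) i - stepSize τ n • acc (slabTime τ n i) (P n i)) (R n i) := by
    intro W R hW hWT
    -- Exactness is used three times: to pass from P' to Q at the nodes, to return to the integral
    -- of M(Q, R'), and, after integration by parts, for M(Q', R).
    have hslab : ∀ n, (stepSize τ n)⁻¹ * ∫ s in (0 : ℝ)..1, M (deriv (P n) s) (deriv (R n) s)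
        = (M (V (τ n.succ)) (W (τ n.succ)) - M (V (τ n.castSucc)) (W (τ n.castSucc)))
          - ∑ i ∈ nodes, quadWeight nodes i * M (deriv (Q n) i) (R n i) := by
      intro n
      have e1 := integral_bilin_deriv M (hV.1 n) (hW.1 n)
      rw [hG.exact.bilin M (hV.1 n) (hW.deriv_mem n) (by omega),
        hG.exact.bilin M (hV.deriv_mem n) (hW.1 n) (by omega), hV.apply_one, hW.apply_one,
        hV.apply_zero, hW.apply_zero] at e1
      rw [hG.exact.bilin M (hU.deriv_mem n) (hW.deriv_mem n) (by omega), ← e1, Finset.mul_sum]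
      refine Finset.sum_congr rfl fun i hi => ?_
      rw [hPQ n i hi, map_smul, smul_apply, smul_eq_mul]
      field_simp [(stepSize_pos hτ n).ne']
    have htel := sum_succ_sub_castSucc (fun n => M (V (τ n)) (W (τ n)))
    rw [integral_deriv_deriv M hτ hU hW, Finset.sum_congr rfl fun n _ => hslab n,
      Finset.sum_sub_distrib, htel, hWT, map_zero,
      Finset.sum_congr rfl fun n _ => slabQuad_eq M acc hG.mem_Icc hU hW n]
    simp only [map_sub, map_smul, sub_apply, smul_apply, smul_eq_mul, mul_sub,
      Finset.sum_sub_distrib, Finset.mul_sum]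
    have : ∀ n i, stepSize τ n * (quadWeight nodes i * M (acc (slabTime τ n i) (P n i)) (R n i))
        = quadWeight nodes i * (stepSize τ n * M (acc (slabTime τ n i) (P n i)) (R n i)) :=
      fun n i => by ring
    simp only [this]
    ring
  constructor
  · intro h
    let v : Fin N → ℝ → E := fun n i => deriv (Q n) i - stepSize τ n • acc (slabTime τ n i) (P n i)
    have hcard : (insert 1 nodes).card = p + 1 := by
      rw [Finset.card_insert_of_notMem hG.one_notMem, hG.card]
    -- The p Gauss nodes and the right end give p + 1 interpolation conditions. The right value `x`
    -- comes from the next slab, and the resulting value at 0 is passed on to the previous one.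
    choose R hR hR' using fun (n : Fin N) (x : E) =>
      exists_polyMap_eq (insert 1 nodes) (fun i => if i = 1 then x else v n i)
    obtain ⟨w, hwT, hw⟩ := exists_backward_rec (0 : E) (fun n x => R n x 0)
    obtain ⟨W, hW, hWw⟩ := exists_isSlabRep hτ (P := fun n => R n (w n.succ))
      (fun n => by have := hR n (w n.succ); rwa [hcard] at this) w (fun n => (hw n).symm)
      (fun n => by rw [hR' n _ 1 (Finset.mem_insert_self _ _), if_pos rfl]) hN
    have hWT : W (τ (Fin.last N)) = 0 := by rw [hWw, hwT]
    have h2 := key W _ hW hWT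
    rw [h W ((isTrial_iff hτ).2 ⟨_, hW⟩) hWT, sub_self] at h2
    have h3 : ∑ n, ∑ i ∈ nodes, quadWeight nodes i * M (v n i) (v n i) = 0 := by
      rw [h2]
      refine Finset.sum_congr rfl fun n _ => Finset.sum_congr rfl fun i hi => ?_
      rw [hR' n _ i (Finset.mem_insert_of_mem hi), if_neg]
      rintro rfl
      exact hG.one_notMem hi
    intro n i hi
    exact sub_eq_zero.1 (eq_zero_of_forall_quad_eq_zero hpos hG.pos h3 n i hi)
  · intro h W hW hWT
    obtain ⟨R, hR⟩ := (isTrial_iff hτ).1 hW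
    rw [← sub_eq_zero, key W R hR hWT]
    refine Finset.sum_eq_zero fun n _ => Finset.sum_eq_zero fun i hi => ?_
    rw [h n i hi, sub_self]
    simp

theorem bilinScheme_and_reconstruction_iff (hτ : StrictMono τ) (hN : N ≠ 0)
    (hpos : ∀ x, x ≠ 0 → 0 < M x x) (hG : IsGaussRule nodes p) {U V : ℝ → E}
    {P Q : Fin N → ℝ → E} (hU : IsSlabRep τ p U P) (hV : IsSlabRep τ p V Q) {U₀ V₀ : E} :
    (BilinScheme M acc nodes τ p U₀ V₀ U ∧ BilinReconstruction M τ p V₀ U V) ↔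
      (U (τ 0) = U₀ ∧ V (τ 0) = V₀) ∧ ∀ n, ∀ i ∈ nodes, deriv (P n) i = stepSize τ n • Q n i ∧
        deriv (Q n) i = stepSize τ n • acc (slabTime τ n i) (P n i) := by
  constructor
  · rintro ⟨⟨-, hU0, hS⟩, -, rfl, hR⟩
    have h1 := (reconstruction_iff hτ hN hpos hG hU hV).1 hR
    have h2 := (scheme_gauss_iff hτ hN hpos hG hU hV h1).1 hS
    exact ⟨⟨hU0, rfl⟩, fun n i hi => ⟨h1 n i hi, h2 n i hi⟩⟩
  · rintro ⟨⟨hU0, rfl⟩, h⟩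
    have h1 : ∀ n, ∀ i ∈ nodes, deriv (P n) i = stepSize τ n • Q n i := fun n i hi => (h n i hi).1
    exact ⟨⟨(isTrial_iff hτ).2 ⟨P, hU⟩, hU0,
      (scheme_gauss_iff hτ hN hpos hG hU hV h1).2 fun n i hi => (h n i hi).2⟩,
      (isTrial_iff hτ).2 ⟨Q, hV⟩, rfl, (reconstruction_iff hτ hN hpos hG hU hV).2 h1⟩

/-- By `reconstruction_iff` the values at the p Gauss nodes are known. Together with the left end
value they determine a polynomial of degree at most p, whose right end value starts the next slab.
-/
theorem exists_bilinReconstruction (hτ : StrictMono τ) (hN : N ≠ 0)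
    (hpos : ∀ x, x ≠ 0 → 0 < M x x) (hG : IsGaussRule nodes p) {U : ℝ → E} (hU : IsTrial τ p U)
    (V₀ : E) :
    ∃ V : ℝ → E, BilinReconstruction M τ p V₀ U V ∧
      ∀ V' : ℝ → E, BilinReconstruction M τ p V₀ U V' →
        EqOn V' V (Icc (τ 0) (τ (Fin.last N))) := by
  obtain ⟨P, hP⟩ := (isTrial_iff hτ).1 hU
  have hcard : (insert 0 nodes).card = p + 1 := by
    rw [Finset.card_insert_of_notMem hG.zero_notMem, hG.card]
  have hne : ∀ i ∈ nodes, i ≠ 0 := by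
    rintro i hi rfl
    exact hG.zero_notMem hi
  choose R hR hR' using fun (n : Fin N) (x : E) => exists_polyMap_eq (insert 0 nodes)
    (fun i => if i = 0 then x else (stepSize τ n)⁻¹ • deriv (P n) i)
  obtain ⟨w, hw0, hw⟩ := exists_forward_rec V₀ (fun n x => R n x 1)
  obtain ⟨V, hV, hVw⟩ := exists_isSlabRep hτ (P := fun n => R n (w n.castSucc))
    (fun n => by have := hR n (w n.castSucc); rwa [hcard] at this) w
    (fun n => by rw [hR' n _ 0 (Finset.mem_insert_self _ _), if_pos rfl]) (fun n => (hw n).symm) hN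
  have hnod : ∀ n, ∀ i ∈ nodes, deriv (P n) i = stepSize τ n • R n (w n.castSucc) i := by
    intro n i hi
    rw [hR' n _ i (Finset.mem_insert_of_mem hi), if_neg (hne i hi),
      smul_inv_smul₀ (stepSize_pos hτ n).ne']
  refine ⟨V, ⟨(isTrial_iff hτ).2 ⟨_, hV⟩, by rw [hVw, hw0],
    (reconstruction_iff hτ hN hpos hG hP hV).2 hnod⟩, ?_⟩
  rintro V' ⟨hV't, hV'0, hV'⟩
  obtain ⟨Q, hQ⟩ := (isTrial_iff hτ).1 hV't
  have hnod' := (reconstruction_iff hτ hN hpos hG hP hQ).1 hV'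
  have hslab : ∀ n : Fin N, V' (τ n.castSucc) = w n.castSucc → Q n = R n (w n.castSucc) := by
    intro n hn
    refine polyMaps_ext (hQ.1 n) (hV.1 n) hcard.ge fun i hi => ?_
    rcases Finset.mem_insert.1 hi with rfl | hi
    · rw [hQ.apply_zero, hn, hR' n _ 0 (Finset.mem_insert_self _ _), if_pos rfl]
    · have := hnod n i hi
      rw [hnod' n i hi] at this
      exact smul_right_injective E (stepSize_pos hτ n).ne' this
  have hall : ∀ k : Fin (N + 1), V' (τ k) = w k := by
    intro k
    induction k using Fin.induction with
    | zero => rw [hV'0, hw0]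
    | succ n ih => rw [← hQ.apply_one, hslab n ih, hw]
  have hQR : Q = fun n => R n (w n.castSucc) := funext fun n => hslab n (hall _)
  exact (hQR ▸ hQ).eqOn hτ hN hV

/-! ### Collocation -/

/-- Forwards, P is the integral of the interpolant of P'. Backwards, the stage equations make P
agree with the primitive of the interpolant of `k` at 0 and at the p nodes, enough to identify them.
-/
theorem collocation_iff {P : ℝ → E} (hP : P ∈ polyMaps E (p + 1)) (hcard : nodes.card = p)
    (h0 : (0 : ℝ) ∉ nodes) (k : ℝ → E) :
    (∀ i ∈ nodes, deriv P i = k i) ↔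
      (∀ i ∈ nodes, P i = P 0 + ∑ j ∈ nodes,
        (∫ s in (0 : ℝ)..i, (Lagrange.basis nodes id j).eval s) • k j) ∧
      P 1 = P 0 + ∑ j ∈ nodes, quadWeight nodes j • k j := by
  constructor
  · intro h
    have h1 := eq_add_sum_integral_basis hP (nodes := nodes) (by omega)
    have h2 : ∀ t, P t = P 0 + ∑ j ∈ nodes,
        (∫ s in (0 : ℝ)..t, (Lagrange.basis nodes id j).eval s) • k j := fun t => by
      rw [h1 t]
      congr 1
      exact Finset.sum_congr rfl fun j hj => by rw [h j hj]
    exact ⟨fun i _ => h2 i, h2 1⟩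
  · rintro ⟨h, -⟩
    obtain ⟨K, hK, hK1, -, hK3⟩ := exists_primitive nodes (P 0) k
    rw [hcard] at hK
    have hPK : P = K := by
      refine polyMaps_ext hP hK (nodes := insert 0 nodes)
        (by rw [Finset.card_insert_of_notMem h0, hcard]) fun i hi => ?_
      rcases Finset.mem_insert.1 hi with rfl | hi
      · rw [hK1]; simp
      · rw [h i hi, hK1]
    intro i hi
    rw [hPK, hK3 i hi]

/-- The Runge-Kutta equations of a collocation method, in components. -/
theorem isRKSolution_collocation_iff {U₀ V₀ : E} {y : Fin (N + 1) → E × E}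
    {Y : Fin N → nodes → E × E} :
    IsRKSolution (collocation nodes) (fun t y => (y.2, acc t y.1)) τ (U₀, V₀) y Y ↔
      IsPRKSolution (collocation nodes) (collocation nodes) (fun _ _ v => v) (fun t u _ => acc t u)
        τ U₀ V₀ (fun n => (y n).1) (fun n => (y n).2) (fun n i => (Y n i).1)
        (fun n i => (Y n i).2) := by
  simp only [IsRKSolution, IsPRKSolution, Prod.ext_iff, Prod.fst_add, Prod.snd_add, Prod.smul_fst,
    Prod.smul_snd, Prod.fst_sum, Prod.snd_sum, forall_and]
  tauto

theorem isPRKSolution_collocation_iff (hG : IsGaussRule nodes p)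
    {U V : ℝ → E} {P Q : Fin N → ℝ → E} (hU : IsSlabRep τ p U P) (hV : IsSlabRep τ p V Q)
    {U₀ V₀ : E} :
    IsPRKSolution (collocation nodes) (collocation nodes) (fun _ _ v => v) (fun t u _ => acc t u)
        τ U₀ V₀ (fun n => U (τ n)) (fun n => V (τ n)) (fun n i => U (slabTime τ n i))
        (fun n i => V (slabTime τ n i)) ↔
      (U (τ 0) = U₀ ∧ V (τ 0) = V₀) ∧ ∀ n, ∀ i ∈ nodes, deriv (P n) i = stepSize τ n • Q n i ∧
        deriv (Q n) i = stepSize τ n • acc (slabTime τ n i) (P n i) := by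
  have hUn : ∀ n (i : nodes), U (slabTime τ n i) = P n i := fun n i =>
    hU.2 n i (hG.mem_Icc i i.2)
  have hVn : ∀ n (i : nodes), V (slabTime τ n i) = Q n i := fun n i =>
    hV.2 n i (hG.mem_Icc i i.2)
  have hc := fun n => collocation_iff (hU.1 n) hG.card hG.zero_notMem
    (fun i => stepSize τ n • Q n i)
  have hc' := fun n => collocation_iff (hV.1 n) hG.card hG.zero_notMem
    (fun i => stepSize τ n • acc (slabTime τ n i) (P n i))
  simp only [IsPRKSolution, hUn, hVn, collocation, forall_and, hc, hc']
  simp only [Finset.smul_sum, smul_comm (stepSize τ _), hU.apply_zero, hU.apply_one, hV.apply_zero,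
    hV.apply_one, Subtype.forall]
  simp only [← Finset.sum_coe_sort nodes]
  tauto

theorem exists_collocation_trial (hτ : StrictMono τ) (hN : N ≠ 0) (hcard : nodes.card = p)
    (k : Fin N → ℝ → E) (y : Fin (N + 1) → E)
    (hy : ∀ n, y n.succ = y n.castSucc + ∑ j ∈ nodes, quadWeight nodes j • k n j) :
    ∃ (U : ℝ → E) (P : Fin N → ℝ → E), IsSlabRep τ p U P ∧ (∀ n, U (τ n) = y n) ∧
      ∀ n t, P n t = y n.castSucc + ∑ j ∈ nodes,
        (∫ s in (0 : ℝ)..t, (Lagrange.basis nodes id j).eval s) • k n j := by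
  choose R hR hR1 _ _ using fun n => exists_primitive nodes (y n.castSucc) (k n)
  have hR' : ∀ n, R n ∈ polyMaps E (p + 1) := fun n => by
    have := hR n; rwa [hcard] at this
  obtain ⟨U, hU, hUy⟩ := exists_isSlabRep hτ hR' y (fun n => by simp [hR1])
    (fun n => by rw [hR1, hy]; rfl) hN
  exact ⟨U, R, hU, hUy, hR1⟩

/-- The stage equations of a collocation method determine a trial function. -/
theorem exists_collocation_trial_of_stages (hτ : StrictMono τ) (hN : N ≠ 0)
    (hG : IsGaussRule nodes p) {y : Fin (N + 1) → E} {Y K : Fin N → nodes → E}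
    (hY : ∀ n i, Y n i = y n.castSucc
      + stepSize τ n • ∑ j : nodes, (collocation nodes).A i j • K n j)
    (hy : ∀ n, y n.succ = y n.castSucc
      + stepSize τ n • ∑ j : nodes, (collocation nodes).b j • K n j) :
    ∃ U : ℝ → E, IsTrial τ p U ∧ (∀ n, U (τ n) = y n) ∧
      (∀ (n : Fin N) (i : nodes), U (slabTime τ n i) = Y n i) ∧
      ∀ U' : ℝ → E, IsTrial τ p U' → (∀ n, U' (τ n) = y n) →
        (∀ (n : Fin N) (i : nodes), U' (slabTime τ n i) = Y n i) →
        EqOn U' U (Icc (τ 0) (τ (Fin.last N))) := by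
  classical
  -- The scaled stage slopes, extended from the nodes to ℝ by a value that no sum over the nodes
  -- sees.
  let k : Fin N → ℝ → E := fun n j => if h : j ∈ nodes then stepSize τ n • K n ⟨j, h⟩ else 0
  have hk : ∀ n (j : nodes), k n j = stepSize τ n • K n j := fun n j => dif_pos j.2
  obtain ⟨U, P, hU, hUy, hP⟩ := exists_collocation_trial hτ hN hG.card k y (fun n => by
    rw [hy, ← Finset.sum_coe_sort nodes]
    simp only [hk, Finset.smul_sum, smul_comm (stepSize τ n)]
    rfl)
  have hPY : ∀ n (i : nodes), P n i = Y n i := by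
    intro n i
    rw [hY, hP, ← Finset.sum_coe_sort nodes]
    simp only [hk, Finset.smul_sum, smul_comm (stepSize τ n)]
    rfl
  refine ⟨U, (isTrial_iff hτ).2 ⟨P, hU⟩, hUy, fun n i => ?_, fun U' hU' hy' hY' => ?_⟩
  · rw [hU.2 n i (hG.mem_Icc i i.2), hPY]
  · obtain ⟨P', hP'⟩ := (isTrial_iff hτ).1 hU'
    have hPP : P' = P := by
      funext n
      refine polyMaps_ext (hP'.1 n) (hU.1 n) (nodes := insert 0 nodes)
        (by rw [Finset.card_insert_of_notMem hG.zero_notMem, hG.card]) fun i hi => ?_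
      rcases Finset.mem_insert.1 hi with rfl | hi
      · rw [hP'.apply_zero, hU.apply_zero, hy', hUy]
      · rw [← hP'.2 n i (hG.mem_Icc i hi), hPY n ⟨i, hi⟩]
        exact hY' n ⟨i, hi⟩
    exact (hPP ▸ hP').eqOn hτ hN hU

end Schemes

/-! ### Gauss-Lobatto quadrature in time -/

section Lobatto

variable {E : Type*} [NormedAddCommGroup E] [NormedSpace ℝ E] {M : E →L[ℝ] E →L[ℝ] ℝ}
  {acc : ℝ → E → E} {N : ℕ} {τ : Fin (N + 1) → ℝ} {p : ℕ}

/-- Residual at the node `i` of the momentum equation on a slab of length `h`, for the velocity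
`V` in the reference variable, the nodal accelerations `a` and the hybrid velocities `v₀`, `v₁`. -/
def lobattoResidual (p : ℕ) (h : ℝ) (V a : ℝ → E) (v₀ v₁ : E) (i : ℝ) : E :=
  quadWeight (lobattoNodes p) i • (deriv V i - h • a i)
    + (if i = 1 then v₁ - V 1 else 0) - (if i = 0 then v₀ - V 0 else 0)

/-- The coefficients of Lobatto IIIB. -/
def lobattoIIIBCoeff (p : ℕ) (t j : ℝ) : ℝ :=
  if j = 0 then quadWeight (lobattoNodes p) 0
  else if j = 1 then 0
  else (∫ s in (0 : ℝ)..t, (interiorBasis p j).eval s)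
    - quadWeight (lobattoNodes p) 0 * (interiorBasis p j).eval 0

/-- Placing the jumps in the residuals at the end nodes makes the discrete momentum balance a plain
pairing with the nodal values of the test function. -/
theorem sum_lobattoResidual (h : ℝ) (V a : ℝ → E) (v₀ v₁ : E) (R : ℝ → E) :
    ∑ i ∈ lobattoNodes p, M (lobattoResidual p h V a v₀ v₁ i) (R i)
      = ∑ i ∈ lobattoNodes p, quadWeight (lobattoNodes p) i * M (deriv V i) (R i)
        - h * ∑ i ∈ lobattoNodes p, quadWeight (lobattoNodes p) i * M (a i) (R i)
        + M (v₁ - V 1) (R 1) - M (v₀ - V 0) (R 0) := by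
  have e : ∀ i, M (lobattoResidual p h V a v₀ v₁ i) (R i)
      = quadWeight (lobattoNodes p) i * M (deriv V i) (R i)
        - h * (quadWeight (lobattoNodes p) i * M (a i) (R i))
        + (if i = 1 then M (v₁ - V 1) (R 1) else 0) - (if i = 0 then M (v₀ - V 0) (R 0) else 0) := by
    intro i
    rw [lobattoResidual]
    by_cases h1 : i = 1
    · subst h1
      simp only [if_true, one_ne_zero, if_false, sub_zero, map_add, map_sub, map_smul, add_apply,
        sub_apply, smul_apply, smul_eq_mul]
      ring
    · by_cases h0 : i = 0
      · subst h0
        simp only [if_true, zero_ne_one, if_false, add_zero, map_sub, map_smul,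
          sub_apply, smul_apply, smul_eq_mul]
        ring
      · simp only [h0, h1, if_false, sub_zero, add_zero, map_sub, map_smul,
          sub_apply, smul_apply, smul_eq_mul]
        ring
  rw [Finset.sum_congr rfl fun i _ => e i]
  simp only [Finset.sum_sub_distrib, Finset.sum_add_distrib, ← Finset.mul_sum,
    Finset.sum_ite_eq', one_mem_lobattoNodes, zero_mem_lobattoNodes, if_true]

/-- This is the test with constants: the rule integrates V' to V 1 - V 0, which cancels against the
jumps and leaves the velocity update. -/
theorem sum_lobattoResidual' (hp : 1 ≤ p) (h : ℝ) {V : ℝ → E} (hV : V ∈ polyMaps E p) (a : ℝ → E)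
    (v₀ v₁ : E) :
    ∑ i ∈ lobattoNodes p, lobattoResidual p h V a v₀ v₁ i
      = v₁ - v₀ - h • ∑ i ∈ lobattoNodes p, quadWeight (lobattoNodes p) i • a i := by
  have hV1 := apply_one_eq_add_sum_quadWeight hV (nodes := lobattoNodes p)
    (by rw [card_lobattoNodes hp]; omega)
  simp only [lobattoResidual, smul_sub, Finset.sum_sub_distrib, Finset.sum_add_distrib,
    Finset.sum_ite_eq', one_mem_lobattoNodes, zero_mem_lobattoNodes, if_true,
    smul_comm _ h, ← Finset.smul_sum]
  rw [hV1]
  abel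

theorem sum_lobattoIIIBCoeff_smul (hp : 1 ≤ p) (t : ℝ) (a : ℝ → E) :
    ∑ j ∈ lobattoNodes p, lobattoIIIBCoeff p t j • a j
      = quadWeight (lobattoNodes p) 0 • a 0
        - quadWeight (lobattoNodes p) 0 • ∑ j ∈ lobattoInterior p,
          (Lagrange.basis (lobattoInterior p) id j).eval 0 • a j
        + ∑ j ∈ lobattoInterior p,
          (∫ s in (0 : ℝ)..t, (Lagrange.basis (lobattoInterior p) id j).eval s) • a j := by
  rw [sum_lobattoNodes hp]
  have e : ∀ j ∈ lobattoInterior p, lobattoIIIBCoeff p t j • a j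
      = (∫ s in (0 : ℝ)..t, (Lagrange.basis (lobattoInterior p) id j).eval s) • a j
        - quadWeight (lobattoNodes p) 0 • (Lagrange.basis (lobattoInterior p) id j).eval 0 • a j := by
    intro j hj
    have h0 : j ≠ 0 := by rintro rfl; exact zero_notMem_lobattoInterior hp hj
    have h1 : j ≠ 1 := by rintro rfl; exact one_notMem_lobattoInterior hp hj
    rw [lobattoIIIBCoeff, if_neg h0, if_neg h1, interiorBasis_eq hp, sub_smul, mul_smul]
  rw [Finset.sum_congr rfl e, Finset.sum_sub_distrib, ← Finset.smul_sum]
  simp only [lobattoIIIBCoeff, if_true, one_ne_zero, if_false, zero_smul, zero_add]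
  abel

/-- Discontinuous collocation. -/
theorem lobattoResidual_eq_zero_iff (hp : 1 ≤ p) (h : ℝ) {V : ℝ → E} (hV : V ∈ polyMaps E p)
    (a : ℝ → E) (v₀ v₁ : E) :
    (∀ i ∈ lobattoNodes p, lobattoResidual p h V a v₀ v₁ i = 0) ↔
      (∀ i ∈ lobattoNodes p, V i = v₀ + h • ∑ j ∈ lobattoNodes p, lobattoIIIBCoeff p i j • a j) ∧
      v₁ = v₀ + h • ∑ j ∈ lobattoNodes p, quadWeight (lobattoNodes p) j • a j := by
  have hcard := card_lobattoInterior hp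
  have hres0 : lobattoResidual p h V a v₀ v₁ 0
      = quadWeight (lobattoNodes p) 0 • (deriv V 0 - h • a 0) - (v₀ - V 0) := by
    simp [lobattoResidual]
  have hresi : ∀ i ∈ lobattoInterior p, lobattoResidual p h V a v₀ v₁ i
      = quadWeight (lobattoNodes p) i • (deriv V i - h • a i) := by
    intro j hj
    have h0 : j ≠ 0 := by rintro rfl; exact zero_notMem_lobattoInterior hp hj
    have h1 : j ≠ 1 := by rintro rfl; exact one_notMem_lobattoInterior hp hj
    simp [lobattoResidual, h0, h1]
  have hsum := sum_lobattoResidual' hp h hV a v₀ v₁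
  -- V' has degree at most p - 2, so the p - 1 interior values determine it, in particular its value
  -- at 0 that enters the residual there. This is the origin of the terms m j (0) in the IIIB
  -- coefficients.
  have hV'0 := eq_sum_basis_smul (deriv_mem_polyMaps hV) (nodes := lobattoInterior p) hcard.ge 0
  constructor
  · intro hr
    have hint : ∀ i ∈ lobattoInterior p, deriv V i = h • a i := by
      intro i hi
      have h1 := hr i (mem_lobattoNodes_of_interior hi)
      rw [hresi i hi] at h1
      exact sub_eq_zero.1 ((smul_eq_zero.1 h1).resolve_left (lobatto_interior_weight_pos hp hi).ne')
    constructor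
    · intro i _
      have hVi := eq_add_sum_integral_basis hV (nodes := lobattoInterior p) hcard.ge i
      have h0 := hr 0 (zero_mem_lobattoNodes p)
      rw [hres0] at h0
      have hV0 : V 0 = v₀ - quadWeight (lobattoNodes p) 0 • (deriv V 0 - h • a 0) := by
        rw [sub_eq_zero.1 h0]; abel
      rw [Finset.sum_congr rfl fun j hj => by rw [hint j hj]] at hV'0 hVi
      rw [hVi, hV0, hV'0, sum_lobattoIIIBCoeff_smul hp]
      simp only [smul_comm _ h, ← Finset.smul_sum, smul_add, smul_sub]
      abel
    · rw [Finset.sum_eq_zero hr] at hsum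
      rw [sub_sub, eq_comm, sub_eq_zero] at hsum
      exact hsum
  · rintro ⟨hst, hv1⟩
    -- The IIIB stage formula depends on the stage only through the upper limit of the integrals, so
    -- the stages are the nodal values of this primitive.
    obtain ⟨K, hK, hK1, -, hK3⟩ := exists_primitive (lobattoInterior p)
      (v₀ + h • (quadWeight (lobattoNodes p) 0 • a 0 - quadWeight (lobattoNodes p) 0 •
        ∑ j ∈ lobattoInterior p, (Lagrange.basis (lobattoInterior p) id j).eval 0 • a j))
      (fun j => h • a j)
    have hVK : V = K := by
      rw [hcard, Nat.sub_add_cancel hp] at hK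
      refine polyMaps_ext hV hK (nodes := lobattoNodes p)
        (by rw [card_lobattoNodes hp]; omega) fun i hi => ?_
      rw [hst i hi, hK1, sum_lobattoIIIBCoeff_smul hp]
      simp only [smul_comm _ h, ← Finset.smul_sum, smul_add, smul_sub]
      abel
    have hint : ∀ i ∈ lobattoInterior p, deriv V i = h • a i := by
      intro i hi
      rw [hVK, hK3 i hi]
    have hri : ∀ i ∈ lobattoInterior p, lobattoResidual p h V a v₀ v₁ i = 0 := by
      intro i hi
      rw [hresi i hi, hint i hi, sub_self, smul_zero]
    have hr0 : lobattoResidual p h V a v₀ v₁ 0 = 0 := by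
      have hV0 : V 0 = _ := hst 0 (zero_mem_lobattoNodes p)
      rw [hres0, hV0, hV'0, sum_lobattoIIIBCoeff_smul hp,
        Finset.sum_congr rfl fun j hj => by rw [hint j hj]]
      simp only [smul_comm _ h, ← Finset.smul_sum, smul_add, smul_sub,
        intervalIntegral.integral_same, zero_smul, Finset.sum_const_zero, smul_zero]
      abel
    -- The stage equations give the residuals at 0 and at the interior nodes. By the update equation
    -- all residuals sum to zero, so the one at 1 vanishes too.
    rw [sum_lobattoNodes hp, hr0, Finset.sum_eq_zero hri, zero_add, add_zero, hv1] at hsum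
    have hr1 : lobattoResidual p h V a v₀ v₁ 1 = 0 := by
      rw [hv1, hsum]; abel
    intro i hi
    rcases mem_lobattoNodes_iff.1 hi with rfl | rfl | hi
    · exact hr0
    · exact hr1
    · exact hri i hi

/-- The time derivative of a trial function on a slab, in the reference variable. -/
def refVelocity (τ : Fin (N + 1) → ℝ) (P : Fin N → ℝ → E) (n : Fin N) : ℝ → E :=
  fun s => (stepSize τ n)⁻¹ • deriv (P n) s

theorem IsSlabRep.refVelocity_mem {U : ℝ → E} {P : Fin N → ℝ → E} (hU : IsSlabRep τ p U P)
    (n : Fin N) : refVelocity τ P n ∈ polyMaps E p :=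
  Submodule.smul_mem _ _ (hU.deriv_mem n)

theorem IsSlabRep.slabDeriv_eq (hτ : StrictMono τ) {U : ℝ → E} {P : Fin N → ℝ → E}
    (hU : IsSlabRep τ p U P) (n : Fin N) {s : ℝ} (hs : s ∈ Icc (0 : ℝ) 1) :
    slabDeriv τ U n (slabTime τ n s) = refVelocity τ P n s :=
  slabDeriv_slabTime hτ (hU.2 n) (hU.differentiable n) hs

theorem IsSlabRep.slabDeriv_slabDeriv_eq (hτ : StrictMono τ) {U : ℝ → E} {P : Fin N → ℝ → E}
    (hU : IsSlabRep τ p U P) (n : Fin N) {s : ℝ} (hs : s ∈ Icc (0 : ℝ) 1) :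
    slabDeriv τ (slabDeriv τ U n) n (slabTime τ n s)
      = (stepSize τ n)⁻¹ • deriv (refVelocity τ P n) s :=
  slabDeriv_slabTime hτ (fun _ hs => hU.slabDeriv_eq hτ n hs)
    (differentiable_polyMap (hU.refVelocity_mem n)) hs

/-- The residuals of a trial function. -/
def slabResidual (acc : ℝ → E → E) (p : ℕ) (τ : Fin (N + 1) → ℝ) (P : Fin N → ℝ → E)
    (v : Fin (N + 1) → E) (n : Fin N) (i : ℝ) : E :=
  lobattoResidual p (stepSize τ n) (refVelocity τ P n) (fun i => acc (slabTime τ n i) (P n i))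
    (v n.castSucc) (v n.succ) i

/-- The pairing of V' with λ has degree at most 2p - 2, so its integral is a nodal sum, and all
terms combine into the residuals. -/
theorem hybrid_functional_eq (hτ : StrictMono τ) (hp : 1 ≤ p) {U l : ℝ → E} {P : Fin N → ℝ → E}
    (hU : IsSlabRep τ p U P) (v : Fin (N + 1) → E) (n : Fin N) {L : ℝ → E}
    (hL : L ∈ polyMaps E (p + 1)) (hl : ∀ s ∈ Icc (0 : ℝ) 1, l (slabTime τ n s) = L s) :
    (∫ t in (τ n.castSucc)..(τ n.succ), M (slabDeriv τ (slabDeriv τ U n) n t) (l t))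
      + M (v n.succ - slabDeriv τ U n (τ n.succ)) (l (τ n.succ))
      - M (v n.castSucc - slabDeriv τ U n (τ n.castSucc)) (l (τ n.castSucc))
      - slabQuad (lobattoNodes p) τ n (fun t => M (acc t (U t)) (l t))
    = ∑ i ∈ lobattoNodes p, M (slabResidual acc p τ P v n i) (L i) := by
  have h := (stepSize_pos hτ n).ne'
  have hV := hU.refVelocity_mem n
  have hVd := deriv_mem_polyMaps hV
  have e0 := hU.slabDeriv_eq hτ n (s := 0) (by simp)
  have e1 := hU.slabDeriv_eq hτ n (s := 1) (by simp)
  have l0 := hl 0 (by simp)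
  have l1 := hl 1 (by simp)
  rw [slabTime_zero] at e0 l0
  rw [slabTime_one] at e1 l1
  have hc : Continuous fun s => (stepSize τ n)⁻¹ * M (deriv (refVelocity τ P n) s) (L s) := by
    have h1 := (differentiable_polyMap hVd).continuous
    have h2 := (differentiable_polyMap hL).continuous
    fun_prop
  have hint := (integral_slab hτ n
    (f := fun t => M (slabDeriv τ (slabDeriv τ U n) n t) (l t)) hc (fun s hs => by
      rw [hU.slabDeriv_slabDeriv_eq hτ n (Ioo_subset_Icc_self hs), hl s (Ioo_subset_Icc_self hs),
        map_smul, smul_apply, smul_eq_mul])).2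
  have hex : IsExactRule (lobattoNodes p) (2 * p) := fun r hr => lobatto_exact hp hr
  rw [hint, intervalIntegral.integral_const_mul, mul_inv_cancel_left₀ h,
    hex.bilin M hVd hL (by omega), e0, e1, l0, l1]
  simp only [slabResidual]
  rw [sum_lobattoResidual, slabQuad]
  have : ∑ i ∈ lobattoNodes p, quadWeight (lobattoNodes p) i *
        M (acc (slabTime τ n i) (U (slabTime τ n i))) (l (slabTime τ n i))
      = ∑ i ∈ lobattoNodes p, quadWeight (lobattoNodes p) i *
        M (acc (slabTime τ n i) (P n i)) (L i) :=
    Finset.sum_congr rfl fun i hi => by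
      rw [hU.2 n i (lobattoNodes_subset hp hi), hl i (lobattoNodes_subset hp hi)]
  rw [this]
  ring

theorem eq_zero_of_forall_sum_eq_zero (hpos : ∀ x, x ≠ 0 → 0 < M x x) {nodes : Finset ℝ}
    {r : Fin N → ℝ → E} (h : ∑ n, ∑ i ∈ nodes, M (r n i) (r n i) = 0) :
    ∀ n, ∀ i ∈ nodes, r n i = 0 := by
  have hnn : ∀ x, 0 ≤ M x x := fun x => by
    rcases eq_or_ne x 0 with rfl | hx
    · simp
    · exact (hpos x hx).le
  intro n i hi
  by_contra hne
  exact (hpos _ hne).ne' (eq_zero_of_sum_sum_eq_zero (fun n i _ => hnn (r n i)) h n i hi)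

/-- On a single slab λ may take any values at the p + 1 nodes, so the residual itself is an
admissible test. The residual already contains the weights, so no sign of the weights is required.
-/
theorem bilinHybrid_iff (hτ : StrictMono τ) (hp : 1 ≤ p) (hpos : ∀ x, x ≠ 0 → 0 < M x x)
    {U : ℝ → E} {P : Fin N → ℝ → E} (hU : IsSlabRep τ p U P) {V₀ : E} {v : Fin (N + 1) → E} :
    BilinHybrid M acc (lobattoNodes p) τ p V₀ U v ↔
      v 0 = V₀ ∧ ∀ n, ∀ i ∈ lobattoNodes p, slabResidual acc p τ P v n i = 0 := by
  refine and_congr_right fun _ => ⟨fun h n => ?_, fun h n l hl => ?_⟩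
  · obtain ⟨L, hL, hL'⟩ := exists_polyMap_eq (lobattoNodes p) (slabResidual acc p τ P v n)
    rw [card_lobattoNodes hp] at hL
    have hnode : ∀ s ∈ Icc (0 : ℝ) 1,
        L ((slabTime τ n s - τ n.castSucc) / stepSize τ n) = L s := fun s _ => by
      rw [slabTime, add_sub_cancel_left, mul_div_cancel_right₀ _ (stepSize_pos hτ n).ne']
    have h1 := h n (fun t => L ((t - τ n.castSucc) / stepSize τ n))
      ((isPolyOn_iff hτ n).2 ⟨L, hL, hnode⟩)
    rw [hybrid_functional_eq hτ hp hU v n hL hnode] at h1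
    rw [Finset.sum_congr rfl fun i hi => by rw [hL' i hi]] at h1
    have h2 := eq_zero_of_forall_sum_eq_zero (N := 1) hpos
      (r := fun _ => slabResidual acc p τ P v n) (by simpa using h1)
    exact h2 0
  · obtain ⟨L, hL, hL'⟩ := (isPolyOn_iff hτ n).1 hl
    rw [hybrid_functional_eq hτ hp hU v n hL hL']
    exact Finset.sum_eq_zero fun i hi => by rw [h n i hi]; simp

/-- The nodal velocities `v` are arbitrary here: since W is continuous, their contributions from
neighbouring slabs cancel and only `v 0` remains. This freedom is used to choose `v` conveniently.
-/
theorem scheme_lobatto_eq (hτ : StrictMono τ) (hp : 1 ≤ p) {U W : ℝ → E} {P R : Fin N → ℝ → E}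
    (hU : IsSlabRep τ p U P) (hW : IsSlabRep τ p W R) (hWT : W (τ (Fin.last N)) = 0)
    (v : Fin (N + 1) → E) :
    -(∫ t in (τ 0)..(τ (Fin.last N)), M (deriv U t) (deriv W t))
      - ∑ n, slabQuad (lobattoNodes p) τ n (fun t => M (acc t (U t)) (W t)) - M (v 0) (W (τ 0))
    = ∑ n, ∑ i ∈ lobattoNodes p, M (slabResidual acc p τ P v n i) (R n i) := by
  have hex : IsExactRule (lobattoNodes p) (2 * p) := fun r hr => lobatto_exact hp hr
  have hslab : ∀ n, (stepSize τ n)⁻¹ * ∫ s in (0 : ℝ)..1, M (deriv (P n) s) (deriv (R n) s)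
      = (M (v n.succ) (W (τ n.succ)) - M (v n.castSucc) (W (τ n.castSucc)))
        - slabQuad (lobattoNodes p) τ n (fun t => M (acc t (U t)) (W t))
        - ∑ i ∈ lobattoNodes p, M (slabResidual acc p τ P v n i) (R n i) := by
    intro n
    have hV := hU.refVelocity_mem n
    have e1 := integral_bilin_deriv M hV (hW.1 n)
    rw [hex.bilin M (deriv_mem_polyMaps hV) (hW.1 n) (by omega), hW.apply_zero,
      hW.apply_one] at e1
    have e2 : ∫ s in (0 : ℝ)..1, M (refVelocity τ P n s) (deriv (R n) s)
        = (stepSize τ n)⁻¹ * ∫ s in (0 : ℝ)..1, M (deriv (P n) s) (deriv (R n) s) := by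
      rw [← intervalIntegral.integral_const_mul]
      simp only [refVelocity, map_smul, smul_apply, smul_eq_mul]
    rw [← e2, e1, slabQuad_eq M acc (fun i hi => lobattoNodes_subset hp hi) hU hW]
    simp only [slabResidual]
    rw [sum_lobattoResidual, hW.apply_zero, hW.apply_one]
    simp only [map_sub, sub_apply]
    ring
  have htel := sum_succ_sub_castSucc (fun n => M (v n) (W (τ n)))
  rw [integral_deriv_deriv M hτ hU hW, Finset.sum_congr rfl fun n _ => hslab n,
    Finset.sum_sub_distrib, Finset.sum_sub_distrib, htel, hWT, map_zero]
  ring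

theorem bilinScheme_of_hybrid (hτ : StrictMono τ) (hp : 1 ≤ p) (hpos : ∀ x, x ≠ 0 → 0 < M x x)
    {U : ℝ → E} (hU : IsTrial τ p U) {V₀ : E} {v : Fin (N + 1) → E}
    (hv : BilinHybrid M acc (lobattoNodes p) τ p V₀ U v) :
    BilinScheme M acc (lobattoNodes p) τ p (U (τ 0)) V₀ U := by
  refine ⟨hU, rfl, fun W hW hWT => ?_⟩
  obtain ⟨P, hP⟩ := (isTrial_iff hτ).1 hU
  obtain ⟨R, hR⟩ := (isTrial_iff hτ).1 hW
  obtain ⟨rfl, hr⟩ := (bilinHybrid_iff hτ hp hpos hP).1 hv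
  rw [← sub_eq_zero, scheme_lobatto_eq hτ hp hP hR hWT v]
  refine Finset.sum_eq_zero fun n _ => Finset.sum_eq_zero fun i hi => ?_
  rw [hr n i hi]
  simp

/-- A vanishing residual at the right end of a slab is an explicit formula for the nodal velocity
there, which gives uniqueness. With this choice the remaining residuals are compatible with a
continuous test function, so the scheme forces them to vanish. -/
theorem existsUnique_bilinHybrid (hτ : StrictMono τ) (hN : N ≠ 0) (hp : 1 ≤ p)
    (hpos : ∀ x, x ≠ 0 → 0 < M x x) {U : ℝ → E} {U₀ V₀ : E}
    (hS : BilinScheme M acc (lobattoNodes p) τ p U₀ V₀ U) :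
    ∃! v, BilinHybrid M acc (lobattoNodes p) τ p V₀ U v := by
  obtain ⟨hU, -, hW⟩ := hS
  obtain ⟨P, hP⟩ := (isTrial_iff hτ).1 hU
  have hres1 : ∀ (v : Fin (N + 1) → E) n, slabResidual acc p τ P v n 1 = 0 ↔
      v n.succ = refVelocity τ P n 1 - quadWeight (lobattoNodes p) 1 •
        (deriv (refVelocity τ P n) 1 - stepSize τ n • acc (slabTime τ n 1) (P n 1)) := by
    intro v n
    rw [slabResidual, lobattoResidual, if_pos rfl, if_neg one_ne_zero, sub_zero, ← sub_eq_zero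
      (a := v n.succ)]
    constructor <;> intro h <;> rw [← h] <;> abel
  obtain ⟨v, hv0, hv⟩ := exists_forward_rec V₀ (fun n _ => refVelocity τ P n 1 -
    quadWeight (lobattoNodes p) 1 •
        (deriv (refVelocity τ P n) 1 - stepSize τ n • acc (slabTime τ n 1) (P n 1)))
  have hr1 : ∀ n, slabResidual acc p τ P v n 1 = 0 := fun n => (hres1 v n).2 (hv n)
  refine ⟨v, (bilinHybrid_iff hτ hp hpos hP).2 ⟨hv0, ?_⟩, fun v' hv' => ?_⟩
  -- The test function takes at each mesh node the residual of the slab to its right, and 0 at the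
  -- final time.
  · let w : Fin (N + 1) → E := fun k => Fin.lastCases (motive := fun _ => E) 0
      (fun n => slabResidual acc p τ P v n 0) k
    have hwT : w (Fin.last N) = 0 := Fin.lastCases_last
    have hw : ∀ n : Fin N, w n.castSucc = slabResidual acc p τ P v n 0 := fun n =>
      Fin.lastCases_castSucc _
    choose R hR hR' using fun n : Fin N => exists_polyMap_eq (lobattoNodes p)
      (fun i => if i = 1 then w n.succ else slabResidual acc p τ P v n i)
    simp only [card_lobattoNodes hp] at hR
    obtain ⟨W, hWR, hWw⟩ := exists_isSlabRep hτ hR w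
      (fun n => by rw [hR' n 0 (zero_mem_lobattoNodes p), if_neg zero_ne_one, hw])
      (fun n => by rw [hR' n 1 (one_mem_lobattoNodes p), if_pos rfl]) hN
    have hWT : W (τ (Fin.last N)) = 0 := by rw [hWw, hwT]
    have h2 := scheme_lobatto_eq (M := M) (acc := acc) hτ hp hP hWR hWT v
    rw [hW W ((isTrial_iff hτ).2 ⟨R, hWR⟩) hWT, hv0, sub_self] at h2
    refine eq_zero_of_forall_sum_eq_zero hpos (h2.trans ?_).symm
    refine Finset.sum_congr rfl fun n _ => Finset.sum_congr rfl fun i hi => ?_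
    rw [hR' n i hi]
    -- At the right end the test value belongs to the next slab, but there the residual is zero, so
    -- the mismatch costs nothing.
    split_ifs with hi1
    · rw [hi1, hr1]; simp
    · rfl
  · obtain ⟨hv'0, hr'⟩ := (bilinHybrid_iff hτ hp hpos hP).1 hv'
    funext k
    induction k using Fin.cases with
    | zero => rw [hv'0, hv0]
    | succ n => rw [hv n, (hres1 v' n).1 (hr' n 1 (one_mem_lobattoNodes p))]

/-- For a trial function the IIIA equations are identities, since P' is reproduced by interpolation
at the p + 1 nodes. All the content lies in the IIIB equations, which are the vanishing of the
residuals. -/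
theorem isPRKSolution_lobatto_iff (hτ : StrictMono τ) (hp : 1 ≤ p)
    {U : ℝ → E} {P : Fin N → ℝ → E} (hU : IsSlabRep τ p U P) {U₀ V₀ : E} {v : Fin (N + 1) → E} :
    IsPRKSolution (lobattoIIIA p) (lobattoIIIB p) (fun _ _ v => v) (fun t u _ => acc t u)
        τ U₀ V₀ (fun n => U (τ n)) v (fun n i => U (slabTime τ n i))
        (fun n i => slabDeriv τ U n (slabTime τ n i)) ↔
      U (τ 0) = U₀ ∧ v 0 = V₀ ∧
        ∀ n, ∀ i ∈ lobattoNodes p, slabResidual acc p τ P v n i = 0 := by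
  have hUn : ∀ n (i : lobattoNodes p), U (slabTime τ n i) = P n i := fun n i =>
    hU.2 n i (lobattoNodes_subset hp i.2)
  have hVn : ∀ n (i : lobattoNodes p), slabDeriv τ U n (slabTime τ n i) = refVelocity τ P n i :=
    fun n i => hU.slabDeriv_eq hτ n (lobattoNodes_subset hp i.2)
  have hr := fun n => lobattoResidual_eq_zero_iff hp (stepSize τ n) (hU.refVelocity_mem n)
    (fun i => acc (slabTime τ n i) (P n i)) (v n.castSucc) (v n.succ)
  have hA : ∀ n t, P n t = U (τ n.castSucc) + stepSize τ n • ∑ j : lobattoNodes p,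
      (∫ s in (0 : ℝ)..t, (Lagrange.basis (lobattoNodes p) id (j : ℝ)).eval s) •
        refVelocity τ P n j := by
    intro n t
    have h := eq_add_sum_integral_basis (hU.1 n) (nodes := lobattoNodes p)
      (by rw [card_lobattoNodes hp]; omega) t
    rw [← Finset.sum_coe_sort, hU.apply_zero] at h
    rw [h]
    simp only [refVelocity, smul_comm _ (stepSize τ n)⁻¹, ← Finset.smul_sum]
    rw [inv_smul_smul₀ (stepSize_pos hτ n).ne']
  refine and_congr_right fun _ => and_congr_right fun _ => forall_congr' fun n => ?_
  simp only [slabResidual, hr n]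
  constructor
  · rintro ⟨-, h2, -, h4⟩
    constructor
    · intro i hi
      have h := h2 ⟨i, hi⟩
      rw [hVn] at h
      rw [h, ← Finset.sum_coe_sort (lobattoNodes p)]
      simp only [hUn]
      rfl
    · rw [h4, ← Finset.sum_coe_sort (lobattoNodes p)]
      simp only [hUn]
      rfl
  · rintro ⟨h2, h4⟩
    refine ⟨fun i => ?_, fun i => ?_, ?_, ?_⟩
    · rw [hUn, hA]
      simp only [hVn]
      rfl
    · rw [hVn, h2 i i.2, ← Finset.sum_coe_sort (lobattoNodes p)]
      simp only [hUn]
      rfl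
    · have h := hA n 1
      rw [hU.apply_one] at h
      rw [h]
      simp only [hVn]
      rfl
    · rw [h4, ← Finset.sum_coe_sort (lobattoNodes p)]
      simp only [hUn]
      rfl

theorem bilinScheme_and_hybrid_iff (hτ : StrictMono τ) (hp : 1 ≤ p)
    (hpos : ∀ x, x ≠ 0 → 0 < M x x) {U : ℝ → E} (hU : IsTrial τ p U) {U₀ V₀ : E}
    {v : Fin (N + 1) → E} :
    (BilinScheme M acc (lobattoNodes p) τ p U₀ V₀ U ∧
        BilinHybrid M acc (lobattoNodes p) τ p V₀ U v) ↔
      IsPRKSolution (lobattoIIIA p) (lobattoIIIB p) (fun _ _ v => v) (fun t u _ => acc t u)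
        τ U₀ V₀ (fun n => U (τ n)) v (fun n i => U (slabTime τ n i))
        (fun n i => slabDeriv τ U n (slabTime τ n i)) := by
  obtain ⟨P, hP⟩ := (isTrial_iff hτ).1 hU
  rw [isPRKSolution_lobatto_iff hτ hp hP, ← bilinHybrid_iff hτ hp hpos hP]
  constructor
  · rintro ⟨⟨-, hU0, -⟩, hH⟩
    exact ⟨hU0, hH⟩
  · rintro ⟨rfl, hH⟩
    exact ⟨bilinScheme_of_hybrid hτ hp hpos hU hH, hH⟩

/-- Every solution of the Lobatto IIIA/IIIB pair comes from exactly one trial function. -/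
theorem exists_lobatto_trial_of_stages (hτ : StrictMono τ) (hN : N ≠ 0) (hp : 1 ≤ p) {U₀ V₀ : E}
    {y z : Fin (N + 1) → E} {Y Z : Fin N → lobattoNodes p → E}
    (h : IsPRKSolution (lobattoIIIA p) (lobattoIIIB p) (fun _ _ v => v) (fun t u _ => acc t u)
      τ U₀ V₀ y z Y Z) :
    ∃ U : ℝ → E, (IsTrial τ p U ∧ (∀ n, U (τ n) = y n) ∧
        (∀ (n : Fin N) (i : lobattoNodes p), U (slabTime τ n i) = Y n i) ∧
        (∀ (n : Fin N) (i : lobattoNodes p), slabDeriv τ U n (slabTime τ n i) = Z n i)) ∧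
      ∀ U' : ℝ → E,
        (IsTrial τ p U' ∧ (∀ n, U' (τ n) = y n) ∧
          (∀ (n : Fin N) (i : lobattoNodes p), U' (slabTime τ n i) = Y n i) ∧
          (∀ (n : Fin N) (i : lobattoNodes p), slabDeriv τ U' n (slabTime τ n i) = Z n i)) →
        EqOn U' U (Icc (τ 0) (τ (Fin.last N))) := by
  classical
  obtain ⟨-, -, h⟩ := h
  have hcard := card_lobattoInterior hp
  let a : Fin N → ℝ → E := fun n j =>
    if hj : j ∈ lobattoNodes p then acc (slabTime τ n j) (Y n ⟨j, hj⟩) else 0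
  have ha : ∀ n (j : lobattoNodes p), a n j = acc (slabTime τ n j) (Y n j) := fun n j =>
    dif_pos j.2
  -- The p + 1 velocity stages are not independent: by the IIIB formula they lie on a polynomial of
  -- degree at most p - 1, so they can be the derivative of a displacement of degree p.
  have hZ : ∀ n : Fin N, ∃ K ∈ polyMaps E p, ∀ i : lobattoNodes p, K i = Z n i := by
    intro n
    obtain ⟨K, hK, hK1, -, -⟩ := exists_primitive (lobattoInterior p)
      (z n.castSucc + stepSize τ n • (quadWeight (lobattoNodes p) 0 • a n 0 -
        quadWeight (lobattoNodes p) 0 • ∑ j ∈ lobattoInterior p,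
          (Lagrange.basis (lobattoInterior p) id j).eval 0 • a n j))
      (fun j => stepSize τ n • a n j)
    rw [hcard, Nat.sub_add_cancel hp] at hK
    refine ⟨K, hK, fun i => ?_⟩
    have e : ∑ j : lobattoNodes p, (lobattoIIIB p).A i j • acc (slabTime τ n j) (Y n j)
        = ∑ j ∈ lobattoNodes p, lobattoIIIBCoeff p i j • a n j := by
      rw [← Finset.sum_coe_sort (lobattoNodes p)]
      simp only [ha]
      rfl
    have h2 := (h n).2.1 i
    change _ = _ + _ • ∑ j : lobattoNodes p, (lobattoIIIB p).A i j • acc (slabTime τ n j) (Y n j)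
      at h2
    rw [h2, e, hK1, sum_lobattoIIIBCoeff_smul hp]
    simp only [smul_comm _ (stepSize τ n), ← Finset.smul_sum, smul_add, smul_sub]
    abel
  choose K hK hKZ using hZ
  -- Any p nodes reproduce `K`. Dropping one keeps the primitive in degree at most p, which all p +
  -- 1 nodes would not show directly.
  have hcard' : ((lobattoNodes p).erase 0).card = p := by
    rw [Finset.card_erase_of_mem (zero_mem_lobattoNodes p), card_lobattoNodes hp,
      Nat.add_sub_cancel]
  choose P hP hP1 hP2 _ using fun n : Fin N => exists_primitive ((lobattoNodes p).erase 0)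
    (y n.castSucc) (fun i => stepSize τ n • K n i)
  simp only [hcard'] at hP
  have hPd : ∀ n s, deriv (P n) s = stepSize τ n • K n s := by
    intro n s
    rw [(hP2 n s).deriv, eq_sum_basis_smul (hK n) (nodes := (lobattoNodes p).erase 0) hcard'.ge s]
    simp only [smul_comm _ (stepSize τ n), ← Finset.smul_sum]
  have hP0 : ∀ n, P n 0 = y n.castSucc := fun n => by rw [hP1]; simp
  -- The same primitive expressed with all p + 1 nodes, which yields the IIIA coefficients.
  have hPt : ∀ n t, P n t = y n.castSucc + stepSize τ n • ∑ j : lobattoNodes p,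
      (∫ s in (0 : ℝ)..t, (Lagrange.basis (lobattoNodes p) id (j : ℝ)).eval s) • Z n j := by
    intro n t
    have h := eq_add_sum_integral_basis (hP n) (nodes := lobattoNodes p)
      (by rw [card_lobattoNodes hp]; omega) t
    rw [← Finset.sum_coe_sort, hP0] at h
    rw [h]
    simp only [hPd, hKZ, smul_comm _ (stepSize τ n), ← Finset.smul_sum]
  have hP1' : ∀ n, P n 1 = y n.succ := by
    intro n
    rw [hPt, (h n).2.2.1]
    rfl
  have hPY : ∀ n (i : lobattoNodes p), P n i = Y n i := by
    intro n i
    rw [hPt, (h n).1 i]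
    rfl
  obtain ⟨U, hU, hUy⟩ := exists_isSlabRep hτ hP y hP0 hP1' hN
  refine ⟨U, ⟨(isTrial_iff hτ).2 ⟨P, hU⟩, hUy, fun n i => ?_, fun n i => ?_⟩, ?_⟩
  · rw [hU.2 n i (lobattoNodes_subset hp i.2), hPY]
  · rw [hU.slabDeriv_eq hτ n (lobattoNodes_subset hp i.2), refVelocity, hPd,
      inv_smul_smul₀ (stepSize_pos hτ n).ne', hKZ]
  · rintro U' ⟨hU't, -, hU'Y, -⟩
    obtain ⟨P', hP'⟩ := (isTrial_iff hτ).1 hU't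
    have hPP : P' = P := by
      funext n
      refine polyMaps_ext (hP'.1 n) (hP n) (nodes := lobattoNodes p)
        (card_lobattoNodes hp).ge fun i hi => ?_
      rw [← hP'.2 n i (lobattoNodes_subset hp hi), hPY n ⟨i, hi⟩]
      exact hU'Y n ⟨i, hi⟩
    exact (hPP ▸ hP').eqOn hτ hN hU

end Lobatto

/-! ### Symplecticity -/

/-! ### Symplecticity conditions on the coefficients. -/

section SymplecticConditions

variable {nodes : Finset ℝ} {p : ℕ}

theorem degree_basis_lt {i : ℝ} (hi : i ∈ nodes) :
    (Lagrange.basis nodes (id : ℝ → ℝ) i).degree < (nodes.card : ℕ) := by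
  rw [Lagrange.degree_basis Function.injective_id.injOn hi, Nat.cast_lt]
  have := Finset.card_pos.2 ⟨i, hi⟩
  omega

theorem sum_mul_eval_basis (b f : ℝ → ℝ) {i : ℝ} (hi : i ∈ nodes) :
    ∑ k ∈ nodes, b k * ((Lagrange.basis nodes id i).eval k * f k) = b i * f i := by
  rw [Finset.sum_eq_single_of_mem i hi]
  · have : (Lagrange.basis nodes (id : ℝ → ℝ) i).eval i = 1 :=
      Lagrange.eval_basis_self (v := (id : ℝ → ℝ)) Function.injective_id.injOn hi
    rw [this, one_mul]
  · intro j hj hji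
    have : (Lagrange.basis nodes (id : ℝ → ℝ) i).eval j = 0 :=
      Lagrange.eval_basis_of_ne (v := (id : ℝ → ℝ)) hji.symm hj
    rw [this, zero_mul, mul_zero]

/-- For the primitives F, G of two basis polynomials, the integral of F'G + FG' is F(1)G(1) = b i b
j. Both products have degree at most 2p - 1, so the rule is exact and each nodal sum collapses to
one term. -/
theorem IsGaussRule.symplectic (hG : IsGaussRule nodes p) (i j : nodes) :
    (collocation nodes).b i * (collocation nodes).A i j
      + (collocation nodes).b j * (collocation nodes).A j i
      = (collocation nodes).b i * (collocation nodes).b j := by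
  obtain ⟨F, hF, hF', hFi⟩ := exists_antiderivative (degree_basis_lt i.2)
  obtain ⟨G, hG', hG'', hGi⟩ := exists_antiderivative (degree_basis_lt j.2)
  have hdi := degree_basis_lt i.2
  have hdj := degree_basis_lt j.2
  rw [hG.card] at hF hG' hdi hdj
  have e := integral_derivative_mul F G
  rw [hF', hG'', hG.exact _ ((degree_mul_lt_of_lt_of_lt hdi hG').trans_le
      (Nat.cast_le.2 (by omega))),
    hG.exact _ ((degree_mul_lt_of_lt_of_lt hF hdj).trans_le (Nat.cast_le.2 (by omega)))] at e
  simp only [eval_mul] at e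
  rw [sum_mul_eval_basis _ _ i.2] at e
  simp only [mul_comm (eval _ F)] at e
  rw [sum_mul_eval_basis _ (fun k => eval k F) j.2] at e
  simp only [hFi, hGi, intervalIntegral.integral_same, mul_zero, sub_zero] at e
  change quadWeight nodes i * (∫ s in (0 : ℝ)..i, _) + quadWeight nodes j * (∫ s in (0 : ℝ)..j, _)
    = (∫ s in (0 : ℝ)..1, _) * (∫ s in (0 : ℝ)..1, _)
  linarith

/-- The end point columns are immediate. For interior j the Gauss argument is repeated with G the
primitive of the interior basis polynomial m. As m need not vanish at 0 and 1, extra terms appear;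
F(0) = 0, F(1) = b i and the quadrature of m reduce them to the correction b 0 m(0) in the IIIB
coefficient. -/
theorem lobatto_symplectic (hp : 1 ≤ p) (i j : lobattoNodes p) :
    (lobattoIIIA p).b i * (lobattoIIIB p).A i j + (lobattoIIIA p).b j * (lobattoIIIA p).A j i
      = (lobattoIIIA p).b i * (lobattoIIIA p).b j := by
  obtain ⟨i, hi⟩ := i
  obtain ⟨j, hj⟩ := j
  set b := quadWeight (lobattoNodes p) with hb
  change b i * lobattoIIIBCoeff p i j
    + b j * (∫ s in (0 : ℝ)..j, (Lagrange.basis (lobattoNodes p) id i).eval s) = b i * b j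
  rcases mem_lobattoNodes_iff.1 hj with rfl | rfl | hji
  · simp only [lobattoIIIBCoeff, if_true, intervalIntegral.integral_same, mul_zero, add_zero]
    rfl
  · simp only [lobattoIIIBCoeff, one_ne_zero, if_false, if_true, mul_zero, zero_add]
    exact mul_comm _ _
  have h0 : j ≠ 0 := by rintro rfl; exact zero_notMem_lobattoInterior hp hji
  have h1 : j ≠ 1 := by rintro rfl; exact one_notMem_lobattoInterior hp hji
  rw [lobattoIIIBCoeff, if_neg h0, if_neg h1, interiorBasis_eq hp]
  set m := Lagrange.basis (lobattoInterior p) id j with hm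
  have hdm : m.degree < (p - 1 : ℕ) := by
    have := degree_basis_lt hji
    rwa [card_lobattoInterior hp] at this
  have hdi := degree_basis_lt hi
  obtain ⟨F, hF, hF', hFi⟩ := exists_antiderivative hdi
  obtain ⟨G, hG, hG', hGi⟩ := exists_antiderivative hdm
  rw [card_lobattoNodes hp] at hdi hF
  have hp2 : 2 ≤ p := by
    have := Finset.card_pos.2 ⟨j, hji⟩
    rw [card_lobattoInterior hp] at this
    omega
  have hm0 : ∀ k ∈ lobattoInterior p, k ≠ j → m.eval k = 0 := fun k hk hkj =>
    Lagrange.eval_basis_of_ne (v := (id : ℝ → ℝ)) hkj.symm hk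
  have hmj : m.eval j = 1 :=
    Lagrange.eval_basis_self (v := (id : ℝ → ℝ)) Function.injective_id.injOn hji
  -- Besides j, the two end points survive, because m is a basis polynomial for the interior nodes
  -- only.
  have hsum : ∀ f : ℝ → ℝ, ∑ k ∈ lobattoNodes p, b k * (f k * m.eval k)
      = b 0 * (f 0 * m.eval 0) + (b 1 * (f 1 * m.eval 1) + b j * f j) := by
    intro f
    rw [sum_lobattoNodes hp, Finset.sum_eq_single_of_mem j hji, hmj, mul_one]
    intro k hk hkj
    rw [hm0 k hk hkj, mul_zero, mul_zero]
  have em := lobatto_exact hp (r := m) (hdm.trans_le (Nat.cast_le.2 (by omega)))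
  have em' := hsum (fun _ => 1)
  simp only [one_mul, mul_one] at em'
  rw [← hb, em'] at em
  have e1 := lobatto_exact hp ((degree_mul_lt_of_lt_of_lt hdi hG).trans_le
      (Nat.cast_le.2 (by omega)))
  have e2 := lobatto_exact hp ((degree_mul_lt_of_lt_of_lt hF hdm).trans_le
      (Nat.cast_le.2 (by omega)))
  have e := integral_derivative_mul F G
  simp only [eval_mul] at e1 e2
  rw [sum_mul_eval_basis _ (fun k => eval k G) hi, ← hb] at e1
  rw [← hb, hsum (fun k => eval k F)] at e2
  rw [hF', hG'] at e
  simp only [eval_mul] at e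
  rw [e1, e2] at e
  have hbi : F.eval 1 = b i := hFi 1
  rw [hbi] at e
  simp only [hFi, hGi, intervalIntegral.integral_same, mul_zero, zero_mul, sub_zero, em] at e ⊢
  linarith

end SymplecticConditions

/-! ### Linearized flows of partitioned Runge-Kutta methods. -/

section SymplecticFlow

variable {E : Type*} [NormedAddCommGroup E] [NormedSpace ℝ E] {M : E →L[ℝ] E →L[ℝ] ℝ}
  {acc : ℝ → E → E} {N : ℕ} {τ : Fin (N + 1) → ℝ} {ι : Type*} [Fintype ι]

/-- In the expanded product the double sum with b i b j splits by `hs` into two parts. One turns r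
into the stages W, the other turns q into the stages U. -/
theorem prk_bilin_step {A A' : ι → ι → ℝ} {b : ι → ℝ}
    (hs : ∀ i j, b i * A' i j + b j * A j i = b i * b j) (h : ℝ) {q r : E} {U V W K : ι → E}
    (hU : ∀ i, U i = q + h • ∑ j, A i j • V j) (hW : ∀ i, W i = r + h • ∑ j, A' i j • K j) :
    M (q + h • ∑ i, b i • V i) (r + h • ∑ i, b i • K i)
      = M q r + h * ∑ i, b i * (M (V i) (W i) + M (U i) (K i)) := by
  have e1 : ∑ i, b i * M (V i) (W i)
      = ∑ i, b i * M (V i) r + h * ∑ i, ∑ j, (b i * A' i j) * M (V i) (K j) := by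
    rw [Finset.mul_sum, ← Finset.sum_add_distrib]
    refine Finset.sum_congr rfl fun i _ => ?_
    rw [hW, map_add, map_smul, map_sum]
    simp only [map_smul, smul_eq_mul, mul_add, Finset.mul_sum]
    congr 1
    exact Finset.sum_congr rfl fun j _ => by ring
  have e2 : ∑ i, b i * M (U i) (K i)
      = ∑ i, b i * M q (K i) + h * ∑ i, ∑ j, (b j * A j i) * M (V i) (K j) := by
    rw [Finset.sum_comm (f := fun i j => (b j * A j i) * M (V i) (K j)), Finset.mul_sum,
      ← Finset.sum_add_distrib]
    refine Finset.sum_congr rfl fun i _ => ?_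
    rw [hU, map_add, map_smul, map_sum]
    simp only [map_smul, add_apply, smul_apply, _root_.sum_apply, smul_eq_mul, mul_add,
      Finset.mul_sum]
    congr 1
    exact Finset.sum_congr rfl fun j _ => by ring
  have e3 : M (h • ∑ i, b i • V i) (h • ∑ i, b i • K i)
      = h * (h * ∑ i, ∑ j, (b i * b j) * M (V i) (K j)) := by
    simp only [map_smul, map_sum, smul_apply, _root_.sum_apply, smul_eq_mul,
      Finset.mul_sum]
    rw [Finset.sum_comm]
    exact Finset.sum_congr rfl fun i _ => Finset.sum_congr rfl fun j _ => by ring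
  have e4 : ∑ i, ∑ j, (b i * b j) * M (V i) (K j)
      = ∑ i, ∑ j, (b i * A' i j) * M (V i) (K j) + ∑ i, ∑ j, (b j * A j i) * M (V i) (K j) := by
    simp only [← Finset.sum_add_distrib, ← add_mul, hs]
  have e5 : M q (h • ∑ i, b i • K i) = h * ∑ i, b i * M q (K i) := by
    simp only [map_smul, map_sum, smul_eq_mul]
  have e6 : M (h • ∑ i, b i • V i) r = h * ∑ i, b i * M (V i) r := by
    simp only [map_smul, map_sum, smul_apply, _root_.sum_apply, smul_eq_mul]
  rw [map_add M, add_apply, map_add (M q), map_add (M _), e3, e5, e6, e4]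
  simp only [mul_add, Finset.sum_add_distrib] at e1 e2 ⊢
  rw [e1, e2]
  ring

/-- A differentiable flow of a partitioned Runge-Kutta method that satisfies the symplecticity
conditions is symplectic. -/
theorem prk_flow_symplectic (hM : ∀ x y, M x y = M y x)
    (hacc : ∀ t, Differentiable ℝ (acc t))
    (hacc' : ∀ t u x y, M (fderiv ℝ (acc t) u x) y = M (fderiv ℝ (acc t) u y) x)
    {B₁ B₂ : ButcherTableau ι} (hb : ∀ i, B₂.b i = B₁.b i)
    (hs : ∀ i j, B₁.b i * B₂.A i j + B₁.b j * B₁.A j i = B₁.b i * B₁.b j)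
    {D : Set (E × E)} (hD : IsOpen D) {q r : E × E → Fin (N + 1) → E}
    {Qs Rs : E × E → Fin N → ι → E}
    (hsol : ∀ y ∈ D, IsPRKSolution B₁ B₂ (fun _ _ v => v) (fun t u _ => acc t u) τ y.1 y.2
      (q y) (r y) (Qs y) (Rs y))
    (hQ : ∀ n i, DifferentiableOn ℝ (fun y => Qs y n i) D) (n : Fin (N + 1)) :
    ∀ y ∈ D, ∃ q' r' : E × E →L[ℝ] E, HasFDerivAt (fun y => q y n) q' y ∧
      HasFDerivAt (fun y => r y n) r' y ∧
      ∀ ξ η, M (q' ξ) (r' η) - M (r' ξ) (q' η) = M ξ.1 η.2 - M ξ.2 η.1 := by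
  induction n using Fin.induction with
  | zero =>
    intro y hy
    refine ⟨ContinuousLinearMap.fst ℝ E E, ContinuousLinearMap.snd ℝ E E, ?_, ?_, fun _ _ => rfl⟩
    · refine (hasFDerivAt_fst (𝕜 := ℝ) (E := E) (F := E) (p := y)).congr_of_eventuallyEq ?_
      filter_upwards [hD.mem_nhds hy] with z hz using (hsol z hz).1
    · refine (hasFDerivAt_snd (𝕜 := ℝ) (E := E) (F := E) (p := y)).congr_of_eventuallyEq ?_
      filter_upwards [hD.mem_nhds hy] with z hz using (hsol z hz).2.1
  | succ n ih =>
    intro y hy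
    obtain ⟨q', r', hq, hr, hω⟩ := ih y hy
    have hQ' : ∀ i, HasFDerivAt (fun y => Qs y n i) (fderiv ℝ (fun y => Qs y n i) y) y := fun i =>
      ((hQ n i).differentiableAt (hD.mem_nhds hy)).hasFDerivAt
    set h := stepSize τ n with hh
    set U' : ι → E × E →L[ℝ] E := fun i => fderiv ℝ (fun y => Qs y n i) y with hU'
    set a' : ι → E →L[ℝ] E := fun i => fderiv ℝ (acc (slabTime τ n (B₂.c i))) (Qs y n i) with ha'
    set K' : ι → E × E →L[ℝ] E := fun i => (a' i).comp (U' i) with hK'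
    have hK : ∀ i, HasFDerivAt (fun y => acc (slabTime τ n (B₂.c i)) (Qs y n i)) (K' i) y :=
      fun i => ((hacc _ _).hasFDerivAt).comp y (hQ' i)
    set V' : ι → E × E →L[ℝ] E := fun i => r' + h • ∑ j, B₂.A i j • K' j with hV'
    -- Velocity stages are explicit in the displacement stages and the old velocity, so only the
    -- displacement stages need assumed differentiability.
    have hR : ∀ i, HasFDerivAt (fun y => Rs y n i) (V' i) y := by
      intro i
      refine HasFDerivAt.congr_of_eventuallyEq (f := fun y => r y n.castSucc
        + h • ∑ j, B₂.A i j • acc (slabTime τ n (B₂.c j)) (Qs y n j)) ?_ ?_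
      · exact hr.add ((HasFDerivAt.fun_sum fun j _ => (hK j).const_smul (B₂.A i j)).const_smul h)
      · filter_upwards [hD.mem_nhds hy] with z hz using ((hsol z hz).2.2 n).2.1 i
    -- The displacement stages are defined implicitly. Their derivatives satisfy the linearized
    -- stage equation by uniqueness of the derivative, without the implicit function theorem.
    have hUeq : ∀ i, U' i = q' + h • ∑ j, B₁.A i j • V' j := by
      intro i
      refine (hQ' i).unique (HasFDerivAt.congr_of_eventuallyEq (f := fun y => q y n.castSucc
        + h • ∑ j, B₁.A i j • Rs y n j) ?_ ?_)
      · exact hq.add ((HasFDerivAt.fun_sum fun j _ => (hR j).const_smul (B₁.A i j)).const_smul h)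
      · filter_upwards [hD.mem_nhds hy] with z hz using ((hsol z hz).2.2 n).1 i
    refine ⟨q' + h • ∑ j, B₁.b j • V' j, r' + h • ∑ j, B₁.b j • K' j, ?_, ?_, fun ξ η => ?_⟩
    · refine HasFDerivAt.congr_of_eventuallyEq (f := fun y => q y n.castSucc
        + h • ∑ j, B₁.b j • Rs y n j) ?_ ?_
      · exact hq.add ((HasFDerivAt.fun_sum fun j _ => (hR j).const_smul (B₁.b j)).const_smul h)
      · filter_upwards [hD.mem_nhds hy] with z hz using ((hsol z hz).2.2 n).2.2.1
    · refine HasFDerivAt.congr_of_eventuallyEq (f := fun y => r y n.castSucc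
        + h • ∑ j, B₁.b j • acc (slabTime τ n (B₂.c j)) (Qs y n j)) ?_ ?_
      · exact hr.add ((HasFDerivAt.fun_sum fun j _ => (hK j).const_smul (B₁.b j)).const_smul h)
      · filter_upwards [hD.mem_nhds hy] with z hz
        rw [((hsol z hz).2.2 n).2.2.2]
        simp only [hb, hh]
    · have step : ∀ ξ η, M ((q' + h • ∑ j, B₁.b j • V' j) ξ) ((r' + h • ∑ j, B₁.b j • K' j) η)
          = M (q' ξ) (r' η)
            + h * ∑ i, B₁.b i * (M (V' i ξ) (V' i η) + M (U' i ξ) (K' i η)) := by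
        intro ξ η
        have e := prk_bilin_step (M := M) hs h (q := q' ξ) (r := r' η) (U := fun i => U' i ξ)
          (V := fun i => V' i ξ) (W := fun i => V' i η) (K := fun i => K' i η)
          (fun i => by
            rw [hUeq i]
            simp only [add_apply, smul_apply, _root_.sum_apply])
          (fun i => by
            change (r' + h • ∑ j, B₂.A i j • K' j) η = _
            simp only [add_apply, smul_apply, _root_.sum_apply])
        rw [← e]
        simp only [add_apply, smul_apply, _root_.sum_apply]
      -- The increment of the pairing is symmetric in the two directions, by the symmetry of `M` and
      -- of the derivative of `acc`; it disappears on antisymmetrization.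
      have hsymm : ∀ i, M (V' i ξ) (V' i η) + M (U' i ξ) (K' i η)
          = M (V' i η) (V' i ξ) + M (U' i η) (K' i ξ) := by
        intro i
        rw [hM (V' i ξ), hM (U' i ξ), hM (U' i η)]
        congr 1
        exact hacc' _ _ _ _
      rw [hM _ ((q' + h • ∑ j, B₁.b j • V' j) η), step ξ η, step η ξ,
        Finset.sum_congr rfl fun i _ => by rw [hsymm i], ← hω ξ η, hM (r' ξ)]
      ring

end SymplecticFlow

/-! ### Finite element functions -/

section FiniteElements

variable {d : ℕ} {Ω : Set (RSpace d)}

theorem contDiff_eval_mvPolynomial (q : MvPolynomial (Fin d) ℝ) :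
    ContDiff ℝ 1 fun x : RSpace d => MvPolynomial.eval (fun i => x i) q := by
  induction q using MvPolynomial.induction_on with
  | C a => simpa using contDiff_const
  | add p q hp hq => simpa using hp.add hq
  | mul_X p i hp =>
    simp only [map_mul, MvPolynomial.eval_X]
    exact hp.mul (by fun_prop)

theorem isCompact_space {K : Geometry.SimplicialComplex ℝ (RSpace d)} (hKfin : K.faces.Finite) :
    IsCompact K.space :=
  hKfin.isCompact_biUnion fun s _ => s.finite_toSet.isCompact_convexHull (𝕜 := ℝ)

/-- Boundaries of the finitely many convex cells are null sets. A face with interior points has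
affinely spanning, affinely independent vertices, hence d + 1 of them, so lower-dimensional faces do
not matter. -/
theorem ae_mem_interior_cell {K : Geometry.SimplicialComplex ℝ (RSpace d)}
    (hKfin : K.faces.Finite) (hK : K.space = closure Ω) (hΩ : IsOpen Ω) :
    ∀ᵐ x ∂volume.restrict Ω, ∃ s ∈ K.faces, s.card = d + 1 ∧
      x ∈ interior (convexHull ℝ (s : Set (RSpace d))) := by
  have h1 : ∀ᵐ x ∂volume.restrict Ω, ∀ s ∈ K.faces,
      x ∉ frontier (convexHull ℝ (s : Set (RSpace d))) := by
    refine ae_restrict_of_ae ((ae_ball_iff hKfin.countable).2 fun s _ => ?_)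
    exact measure_eq_zero_iff_ae_notMem.1 ((convex_convexHull ℝ _).addHaar_frontier volume)
  filter_upwards [h1, ae_restrict_mem hΩ.measurableSet] with x hx hxΩ
  have hxK : x ∈ K.space := hK ▸ subset_closure hxΩ
  obtain ⟨s, hs, hxs⟩ := Geometry.SimplicialComplex.mem_space_iff.1 hxK
  have hint : x ∈ interior (convexHull ℝ (s : Set (RSpace d))) := by
    by_contra h
    exact hx s hs ⟨subset_closure hxs, h⟩
  refine ⟨s, hs, ?_, hint⟩
  have hspan := interior_convexHull_nonempty_iff_affineSpan_eq_top.1 ⟨x, hint⟩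
  have hind := K.indep hs
  have h2 := (hind.affineSpan_eq_top_iff_card_eq_finrank_add_one).1 (by simpa using hspan)
  simpa using h2

theorem eventuallyEq_cell {f g : RSpace d → ℝ} {A : Set (RSpace d)} (h : ∀ x ∈ A, f x = g x)
    {x : RSpace d} (hx : x ∈ interior A) : f =ᶠ[nhds x] g := by
  filter_upwards [mem_interior_iff_mem_nhds.1 hx] with y hy using h y hy

/-- Near an interior point of a cell the function is a fixed polynomial, whose gradient is bounded
on the compact cell; there are finitely many cells. -/
theorem exists_gradient_bound {K : Geometry.SimplicialComplex ℝ (RSpace d)}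
    (hKfin : K.faces.Finite) (hK : K.space = closure Ω) (hΩ : IsOpen Ω) {p : ℕ}
    {u : RSpace d →ᵇ ℝ} (hu : u ∈ feSpace Ω K p) :
    ∃ C, ∀ᵐ x ∂volume.restrict Ω, DifferentiableAt ℝ u x ∧ ‖gradient u x‖ ≤ C := by
  have hC : ∀ s : Finset (RSpace d), ∃ C, s ∈ K.faces → s.card = d + 1 →
      ∀ x ∈ interior (convexHull ℝ (s : Set (RSpace d))),
        DifferentiableAt ℝ u x ∧ ‖gradient u x‖ ≤ C := by
    intro s
    by_cases h : s ∈ K.faces ∧ s.card = d + 1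
    · obtain ⟨q, -, hq⟩ := hu.2 s h.1 h.2
      have hsm := contDiff_eval_mvPolynomial q
      obtain ⟨C, hC⟩ := (s.finite_toSet.isCompact_convexHull (𝕜 := ℝ)).exists_bound_of_continuousOn
        (hsm.continuous_fderiv one_ne_zero).continuousOn
      refine ⟨C, fun _ _ x hx => ?_⟩
      have he := eventuallyEq_cell hq hx
      refine ⟨(hsm.differentiable one_ne_zero x).congr_of_eventuallyEq he, ?_⟩
      rw [gradient, LinearIsometryEquiv.norm_map, he.fderiv_eq]
      exact hC x (interior_subset hx)
    · exact ⟨0, fun h1 h2 => absurd ⟨h1, h2⟩ h⟩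
  choose C hC using hC
  obtain ⟨B, hB⟩ := (hKfin.image C).bddAbove
  refine ⟨B, ?_⟩
  filter_upwards [ae_mem_interior_cell hKfin hK hΩ] with x ⟨s, hs, hcard, hx⟩
  obtain ⟨h1, h2⟩ := hC s hs hcard x hx
  exact ⟨h1, h2.trans (hB ⟨s, hs, rfl⟩)⟩

/-- Restriction to the d-simplices lands in finitely many finite-dimensional polynomial spaces. It
is injective because these cells cover Ω up to a null set and the functions are continuous and
vanish off Ω. -/
theorem finiteDimensional_feSpace {K : Geometry.SimplicialComplex ℝ (RSpace d)}
    (hKfin : K.faces.Finite) (hK : K.space = closure Ω) (hΩ : IsOpen Ω) (p : ℕ) :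
    FiniteDimensional ℝ (feSpace Ω K p) := by
  let I := {s : Finset (RSpace d) // s ∈ K.faces ∧ s.card = d + 1}
  have : Finite I := (hKfin.subset fun s hs => hs.1).to_subtype
  let ev (s : I) : MvPolynomial.restrictTotalDegree (Fin d) ℝ p →ₗ[ℝ]
      (convexHull ℝ (s.1 : Set (RSpace d)) → ℝ) :=
    { toFun := fun q x => MvPolynomial.eval (fun i => x.1 i) q.1
      map_add' := fun q r => by ext x; simp
      map_smul' := fun a q => by ext x; simp [MvPolynomial.smul_eval] }
  let res (s : I) : feSpace Ω K p →ₗ[ℝ] LinearMap.range (ev s) :=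
    LinearMap.codRestrict _
      { toFun := fun u x => u.1 x.1
        map_add' := fun u v => by ext x; simp
        map_smul' := fun a u => by ext x; simp }
      (fun u => by
        obtain ⟨q, hq, hq'⟩ := u.2.2 s.1 s.2.1 s.2.2
        exact ⟨⟨q, (MvPolynomial.mem_restrictTotalDegree _ _ _).2 hq⟩, by
          ext x
          exact (hq' x.1 x.2).symm⟩)
  refine Module.Finite.of_injective (LinearMap.pi res)
    fun u v huv => ?_
  have hcell : ∀ s ∈ K.faces, s.card = d + 1 → ∀ x ∈ convexHull ℝ (s : Set (RSpace d)),
      u.1 x = v.1 x := by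
    intro s hs hcard x hx
    have h1 := congrArg Subtype.val (congrFun huv ⟨s, hs, hcard⟩)
    exact congrFun h1 ⟨x, hx⟩
  have hae : ∀ᵐ x ∂volume.restrict Ω, u.1 x = v.1 x := by
    filter_upwards [ae_mem_interior_cell hKfin hK hΩ] with x ⟨s, hs, hcard, hx⟩
    exact hcell s hs hcard x (interior_subset hx)
  have heq : EqOn u.1 v.1 Ω :=
    Measure.eqOn_open_of_ae_eq hae hΩ u.1.continuous.continuousOn v.1.continuous.continuousOn
  ext x
  by_cases hx : x ∈ Ω
  · exact heq hx
  · exact (u.2.1 x hx).trans (v.2.1 x hx).symm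

end FiniteElements

/-! ### The semi-discrete system -/

section SemiDiscrete

variable {d : ℕ} {Ω : Set (RSpace d)} {c : RSpace d → ℝ} {E : Type*} [NormedAddCommGroup E]
  [NormedSpace ℝ E] {ι : E → (RSpace d →ᵇ ℝ)}

/-- `ι` realizes `E` as a finite dimensional space of functions that vanish off `Ω` and have
bounded gradients, and `c` is a bounded coefficient. -/
structure IsDiscretization (Ω : Set (RSpace d)) (c : RSpace d → ℝ) (ι : E → (RSpace d →ᵇ ℝ)) :
    Prop where
  isOpen : IsOpen Ω
  finite : IsFiniteMeasure (volume.restrict Ω)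
  finiteDimensional : FiniteDimensional ℝ E
  map_add : ∀ u v, ι (u + v) = ι u + ι v
  map_smul : ∀ (a : ℝ) u, ι (a • u) = a • ι u
  norm_map : ∀ u, ‖ι u‖ = ‖u‖
  eq_zero : ∀ u, ∀ x ∉ Ω, ι u x = 0
  gradient_bound : ∀ u, ∃ C, ∀ᵐ x ∂volume.restrict Ω,
    DifferentiableAt ℝ (ι u) x ∧ ‖gradient (ι u) x‖ ≤ C
  coeff_meas : AEStronglyMeasurable c (volume.restrict Ω)
  coeff_bound : ∃ C, ∀ x ∈ Ω, ‖c x‖ ≤ C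

theorem integrable_mul_bcf {f : RSpace d → ℝ}
    (hf : Integrable f (volume.restrict Ω)) (w : RSpace d →ᵇ ℝ) :
    Integrable (fun x => f x * w x) (volume.restrict Ω) :=
  hf.mul_bdd (c := ‖w‖) w.continuous.aestronglyMeasurable
    (ae_of_all _ fun x => w.norm_coe_le_norm x)

theorem integrable_bcf (hS : IsDiscretization Ω c ι) (u : RSpace d →ᵇ ℝ) :
    Integrable u (volume.restrict Ω) := by
  have := hS.finite
  exact u.integrable _

theorem exists_bound_comp_bcf {g : ℝ → ℝ} (hg : Continuous g) (r : ℝ) :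
    ∃ C, ∀ u : RSpace d →ᵇ ℝ, ‖u‖ ≤ r → ∀ x, ‖g (u x)‖ ≤ C := by
  obtain ⟨C, hC⟩ := (isCompact_Icc (a := -r) (b := r)).exists_bound_of_continuousOn hg.continuousOn
  refine ⟨C, fun u hu x => hC _ ?_⟩
  have := (u.norm_coe_le_norm x).trans hu
  rw [Real.norm_eq_abs, abs_le] at this
  exact this

theorem integrable_comp_bcf (hS : IsDiscretization Ω c ι) {g : ℝ → ℝ} (hg : Continuous g)
    (u : RSpace d →ᵇ ℝ) : Integrable (fun x => g (u x)) (volume.restrict Ω) := by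
  have := hS.finite
  obtain ⟨C, hC⟩ := exists_bound_comp_bcf (d := d) hg ‖u‖
  exact Integrable.of_bound (hg.comp u.continuous).aestronglyMeasurable C
    (ae_of_all _ fun x => hC u le_rfl x)

theorem integrable_load (hS : IsDiscretization Ω c ι) (f : Lp ℝ 2 (volume.restrict Ω)) :
    Integrable f (volume.restrict Ω) := by
  have := hS.finite
  exact (Lp.memLp f).integrable one_le_two

theorem measurable_gradient (u : RSpace d → ℝ) : Measurable (gradient u) :=
  (InnerProductSpace.toDual ℝ (RSpace d)).symm.continuous.measurable.comp (measurable_fderiv ℝ u)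

theorem integrable_stiff (hS : IsDiscretization Ω c ι) (u w : E) :
    Integrable (fun x => c x ^ 2 * inner ℝ (gradient (ι u) x)
      (gradient (ι w) x)) (volume.restrict Ω) := by
  have := hS.finite
  obtain ⟨B, hB⟩ := hS.coeff_bound
  obtain ⟨C, hC⟩ := hS.gradient_bound u
  obtain ⟨C', hC'⟩ := hS.gradient_bound w
  refine Integrable.of_bound ?_ (B ^ 2 * (C * C')) ?_
  · exact (hS.coeff_meas.pow 2).mul ((measurable_gradient _).stronglyMeasurable.inner
      (measurable_gradient _).stronglyMeasurable).aestronglyMeasurable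
  · filter_upwards [hC, hC', ae_restrict_mem hS.isOpen.measurableSet] with x h1 h2 hx
    rw [norm_mul, norm_pow]
    have h3 := hB x hx
    have h4 : ‖inner ℝ (gradient (ι u) x) (gradient (ι w) x)‖
        ≤ C * C' := (norm_inner_le_norm _ _).trans
      (mul_le_mul h1.2 h2.2 (norm_nonneg _) ((norm_nonneg _).trans h1.2))
    gcongr

/-- The mass form as a bilinear form on the discrete space. -/
def massBilin (hS : IsDiscretization Ω c ι) : E →ₗ[ℝ] E →ₗ[ℝ] ℝ :=
  LinearMap.mk₂ ℝ (fun u w => massForm Ω (ι u) (ι w))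
    (fun u v w => by
      simp only [massForm, hS.map_add, BoundedContinuousFunction.coe_add, Pi.add_apply,
        add_mul]
      exact integral_add (integrable_mul_bcf (integrable_bcf hS _) _)
        (integrable_mul_bcf (integrable_bcf hS _) _))
    (fun a u w => by
      simp only [massForm, hS.map_smul, BoundedContinuousFunction.coe_smul, smul_eq_mul,
        mul_assoc]
      exact integral_const_mul _ _)
    (fun u v w => by
      simp only [massForm, hS.map_add, BoundedContinuousFunction.coe_add, Pi.add_apply,
        mul_add]
      exact integral_add (integrable_mul_bcf (integrable_bcf hS _) _)
        (integrable_mul_bcf (integrable_bcf hS _) _))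
    (fun a u w => by
      simp only [massForm, hS.map_smul, BoundedContinuousFunction.coe_smul, smul_eq_mul,
        mul_left_comm _ a]
      exact integral_const_mul _ _)

theorem massBilin_apply (hS : IsDiscretization Ω c ι) (u w : E) :
    massBilin hS u w = massForm Ω (ι u) (ι w) := rfl

theorem stiffForm_comm (u w : RSpace d →ᵇ ℝ) : stiffForm Ω c u w = stiffForm Ω c w u := by
  simp only [stiffForm, real_inner_comm]

theorem massForm_comm (u w : RSpace d →ᵇ ℝ) : massForm Ω u w = massForm Ω w u := by
  simp only [massForm, mul_comm]

theorem stiffForm_add_left (hS : IsDiscretization Ω c ι) (u v w : E) :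
    stiffForm Ω c (ι (u + v)) (ι w) = stiffForm Ω c (ι u) (ι w) + stiffForm Ω c (ι v) (ι w) := by
  obtain ⟨C, hC⟩ := hS.gradient_bound u
  obtain ⟨C', hC'⟩ := hS.gradient_bound v
  rw [stiffForm, stiffForm, stiffForm, ← integral_add (integrable_stiff hS u w)
    (integrable_stiff hS v w)]
  refine integral_congr_ae ?_
  filter_upwards [hC, hC'] with x h1 h2
  have h : gradient (ι (u + v)) x
      = gradient (ι u) x + gradient (ι v) x := by
    rw [gradient, gradient, gradient, hS.map_add, BoundedContinuousFunction.coe_add,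
      fderiv_add h1.1 h2.1, map_add]
  rw [h, inner_add_left, mul_add]

theorem stiffForm_smul_left (hS : IsDiscretization Ω c ι) (a : ℝ) (u w : E) :
    stiffForm Ω c (ι (a • u)) (ι w) = a * stiffForm Ω c (ι u) (ι w) := by
  obtain ⟨C, hC⟩ := hS.gradient_bound u
  rw [stiffForm, stiffForm, ← integral_const_mul]
  refine integral_congr_ae ?_
  filter_upwards [hC] with x h1
  have h : gradient (ι (a • u)) x
      = a • gradient (ι u) x := by
    rw [gradient, gradient, hS.map_smul, show ⇑(a • ι u) = a • ⇑(ι u) from rfl, fderiv_const_smul h1.1, map_smul]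
  rw [h, real_inner_smul_left]
  ring

/-- The stiffness form as a bilinear form on the discrete space. -/
def stiffBilin (hS : IsDiscretization Ω c ι) : E →ₗ[ℝ] E →ₗ[ℝ] ℝ :=
  LinearMap.mk₂ ℝ (fun u w => stiffForm Ω c (ι u) (ι w))
    (stiffForm_add_left hS) (fun a u w => stiffForm_smul_left hS a u w)
    (fun u v w => by
      rw [stiffForm_comm (ι u), stiffForm_add_left hS, stiffForm_comm (ι v), stiffForm_comm (ι w)])
    (fun a u w => by
      rw [stiffForm_comm (ι u), stiffForm_smul_left hS, stiffForm_comm (ι w), smul_eq_mul])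

/-- The functional `(f, w) - (g(u), w)` on the discrete space. -/
def forceFunctional (hS : IsDiscretization Ω c ι) {g : ℝ → ℝ} (hg : Continuous g)
    (f : Lp ℝ 2 (volume.restrict Ω)) (u : E) : E →ₗ[ℝ] ℝ where
  toFun w := loadForm Ω f (ι w) - nonlinForm Ω g (ι u) (ι w)
  map_add' v w := by
    have h1 : loadForm Ω f (ι (v + w)) = loadForm Ω f (ι v) + loadForm Ω f (ι w) := by
      simp only [loadForm, hS.map_add, BoundedContinuousFunction.coe_add, Pi.add_apply,
        mul_add]
      exact integral_add (integrable_mul_bcf (integrable_load hS f) _)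
        (integrable_mul_bcf (integrable_load hS f) _)
    have h2 : nonlinForm Ω g (ι u) (ι (v + w))
        = nonlinForm Ω g (ι u) (ι v) + nonlinForm Ω g (ι u) (ι w) := by
      simp only [nonlinForm, hS.map_add, BoundedContinuousFunction.coe_add, Pi.add_apply,
        mul_add]
      exact integral_add (integrable_mul_bcf (integrable_comp_bcf hS hg _) _)
        (integrable_mul_bcf (integrable_comp_bcf hS hg _) _)
    rw [h1, h2]
    ring
  map_smul' a w := by
    have h1 : loadForm Ω f (ι (a • w)) = a * loadForm Ω f (ι w) := by
      simp only [loadForm, hS.map_smul, BoundedContinuousFunction.coe_smul, smul_eq_mul,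
        mul_left_comm _ a]
      exact integral_const_mul _ _
    have h2 : nonlinForm Ω g (ι u) (ι (a • w)) = a * nonlinForm Ω g (ι u) (ι w) := by
      simp only [nonlinForm, hS.map_smul, BoundedContinuousFunction.coe_smul, smul_eq_mul,
        mul_left_comm _ a]
      exact integral_const_mul _ _
    rw [h1, h2, RingHom.id_apply, smul_eq_mul]
    ring

/-- A nonzero element is nonzero at a point of Ω, as it vanishes elsewhere, and by continuity on an
open set of positive measure. -/
theorem massForm_self_pos (hS : IsDiscretization Ω c ι) {u : E} (hu : u ≠ 0) :
    0 < massForm Ω (ι u) (ι u) := by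
  obtain ⟨x, hx⟩ : ∃ x, (ι u) x ≠ 0 := by
    by_contra! h
    exact hu (norm_eq_zero.1 (by
      rw [← hS.norm_map, show ι u = 0 from BoundedContinuousFunction.ext h, norm_zero]))
  have hxΩ : x ∈ Ω := by
    by_contra h
    exact hx (hS.eq_zero u x h)
  rw [massForm, setIntegral_pos_iff_support_of_nonneg_ae
    (ae_of_all _ fun y => mul_self_nonneg _)
    (integrable_mul_bcf (integrable_bcf hS _) _)]
  have hopen : IsOpen (Function.support (fun y => (ι u) y * (ι u) y) ∩ Ω) :=
    (((ι u).continuous.mul (ι u).continuous).isOpen_support).inter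
      hS.isOpen
  exact hopen.measure_pos volume ⟨x, by simpa using hx, hxΩ⟩

theorem massBilin_injective (hS : IsDiscretization Ω c ι) : Function.Injective (massBilin hS) := by
  refine (injective_iff_map_eq_zero _).2 fun u hu => ?_
  by_contra h
  exact (massForm_self_pos hS h).ne' (by rw [← massBilin_apply hS, hu]; rfl)

/-- Definiteness makes the map into the dual injective; equality of dimensions makes it onto. -/
theorem exists_massBilin_eq (hS : IsDiscretization Ω c ι) (f : E →ₗ[ℝ] ℝ) :
    ∃ a, massBilin hS a = f := by
  have := hS.finiteDimensional
  have h := (LinearMap.injective_iff_surjective_of_finrank_eq_finrank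
    (f := massBilin hS) (Subspace.dual_finrank_eq (K := ℝ) (V := E)).symm).1
    (massBilin_injective hS)
  exact h f

variable {g : ℝ → ℝ} {F : ℝ → Lp ℝ 2 (volume.restrict Ω)}

theorem existsUnique_acceleration (hS : IsDiscretization Ω c ι) (hg : Continuous g) (t : ℝ) (u : E) :
    ∃! a : E, ∀ w, massForm Ω (ι a) (ι w) + stiffForm Ω c (ι u) (ι w) + nonlinForm Ω g (ι u) (ι w)
      = loadForm Ω (F t) (ι w) := by
  obtain ⟨a, ha⟩ := exists_massBilin_eq hS (forceFunctional hS hg (F t) u - stiffBilin hS u)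
  have ha' : ∀ w, massForm Ω (ι a) (ι w)
      = loadForm Ω (F t) (ι w) - nonlinForm Ω g (ι u) (ι w) - stiffForm Ω c (ι u) (ι w) :=
    fun w => LinearMap.congr_fun ha w
  refine ⟨a, fun w => by linarith [ha' w], fun b hb => massBilin_injective hS ?_⟩
  ext w
  change massForm Ω (ι b) (ι w) = massForm Ω (ι a) (ι w)
  linarith [ha' w, hb w]

/-- `acc` is the acceleration of the semi-discrete wave equation. -/
def IsAccelerationMap (Ω : Set (RSpace d)) (c : RSpace d → ℝ) (g : ℝ → ℝ)
    (F : ℝ → Lp ℝ 2 (volume.restrict Ω)) {X : Type*} (ι : X → (RSpace d →ᵇ ℝ)) (acc : ℝ → X → X) :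
    Prop :=
  ∀ t u w, massForm Ω (ι (acc t u)) (ι w) + stiffForm Ω c (ι u) (ι w)
    + nonlinForm Ω g (ι u) (ι w) = loadForm Ω (F t) (ι w)

/-! ### Differentiability of the acceleration and symmetry of its derivative. -/

variable {acc : ℝ → E → E}

/-- Evaluation of the functions at a point. -/
def evalAt (hS : IsDiscretization Ω c ι) (x : RSpace d) : E →L[ℝ] ℝ :=
  LinearMap.mkContinuous
    { toFun := fun u => ι u x
      map_add' := fun u v => by rw [hS.map_add]; rfl
      map_smul' := fun a u => by rw [hS.map_smul]; rfl } 1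
    fun u => by
      rw [one_mul, ← hS.norm_map u]
      exact (ι u).norm_coe_le_norm x

theorem norm_evalAt_le (hS : IsDiscretization Ω c ι) (x : RSpace d) : ‖evalAt hS x‖ ≤ 1 :=
  LinearMap.mkContinuous_norm_le _ zero_le_one _

/-- Differentiation under the integral: on the unit ball around u the sup norms are bounded, so g'
is evaluated on a compact interval and a constant dominates. Integrability is recorded to evaluate
the derivative in a direction later. -/
theorem hasFDerivAt_nonlinForm (hS : IsDiscretization Ω c ι) (hg : ContDiff ℝ 1 g) (u w : E) :
    HasFDerivAt (fun v : E => nonlinForm Ω g (ι v) (ι w))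
      (∫ x in Ω, (deriv g ((ι u) x) * (ι w) x) • evalAt hS x) u ∧
    Integrable (fun x => (deriv g ((ι u) x) * (ι w) x)
      • evalAt hS x) (volume.restrict Ω) := by
  have := hS.finite
  have := hS.finiteDimensional
  have hg' : Continuous (deriv g) := hg.continuous_deriv le_rfl
  obtain ⟨C, hC⟩ := exists_bound_comp_bcf (d := d) hg' (‖(ι u)‖ + 1)
  have hev : Continuous fun x => evalAt hS x :=
    continuous_clm_apply.2 fun v => (ι v).continuous
  have hmeas : ∀ v : E, AEStronglyMeasurable (fun x => (deriv g ((ι v) x)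
      * (ι w) x) • evalAt hS x) (volume.restrict Ω) := fun v =>
    (((hg'.comp (ι v).continuous).mul (ι w).continuous).smul
      hev).aestronglyMeasurable
  have hbound : ∀ x, ∀ v ∈ Metric.ball u 1, ‖(deriv g ((ι v) x)
      * (ι w) x) • evalAt hS x‖ ≤ C * ‖(ι w)‖ * 1 := by
    intro x v hv
    have hv' : ‖(ι v)‖ ≤ ‖(ι u)‖ + 1 := by
      have h1 : ‖v - u‖ < 1 := by rwa [mem_ball_iff_norm] at hv
      have h2 := norm_le_norm_add_norm_sub' v u
      rw [hS.norm_map, hS.norm_map]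
      linarith
    have h3 := hC (ι v) hv' x
    have hC0 : 0 ≤ C := (norm_nonneg _).trans h3
    rw [norm_smul, norm_mul]
    have h4 := (ι w).norm_coe_le_norm x
    have h5 := norm_evalAt_le hS x
    gcongr
  constructor
  · refine hasFDerivAt_integral_of_dominated_of_fderiv_le
      (F := fun (v : E) x => g ((ι v) x) * (ι w) x)
      (F' := fun (v : E) x => (deriv g ((ι v) x)
        * (ι w) x) • evalAt hS x)
      (bound := fun _ => C * ‖(ι w)‖ * 1)
      (Metric.ball_mem_nhds u one_pos) ?_ ?_ (hmeas u) ?_ (integrable_const _) ?_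
    · exact Filter.Eventually.of_forall fun v =>
        (integrable_mul_bcf (integrable_comp_bcf hS hg.continuous _) _).aestronglyMeasurable
    · exact integrable_mul_bcf (integrable_comp_bcf hS hg.continuous _) _
    · exact ae_of_all _ hbound
    · refine ae_of_all _ fun x v _ => ?_
      have h1 : HasFDerivAt (fun v : E => (ι v) x) (evalAt hS x) v :=
        (evalAt hS x).hasFDerivAt
      have h2 : HasDerivAt g (deriv g ((ι v) x)) ((ι v) x) :=
        (hg.differentiable one_ne_zero _).hasDerivAt
      have h3 := (h2.comp_hasFDerivAt v h1).mul_const ((ι w) x)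
      rw [smul_smul, mul_comm ((ι w) x)] at h3
      exact h3
  · exact Integrable.of_bound (hmeas u) _
      (ae_of_all _ fun x => hbound x u (Metric.mem_ball_self one_pos))

/-- The mass form as a continuous bilinear form. -/
def massCLM (hS : IsDiscretization Ω c ι) : E →L[ℝ] E →L[ℝ] ℝ :=
  have := hS.finiteDimensional
  (massBilin hS).toContinuousBilinearMap

theorem massCLM_apply (hS : IsDiscretization Ω c ι) (u w : E) :
    massCLM hS u w = massForm Ω (ι u) (ι w) := rfl

/-- Pairing with a basis is an injective linear map into a coordinate space, so f is recovered from
these scalar functions by a linear left inverse. -/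
theorem differentiable_of_massForm (hS : IsDiscretization Ω c ι) {X : Type*}
    [NormedAddCommGroup X] [NormedSpace ℝ X] {f : X → E}
    (hf : ∀ w : E, Differentiable ℝ fun y => massForm Ω (ι (f y)) (ι w)) : Differentiable ℝ f := by
  have := hS.finiteDimensional
  let b := Module.finBasis ℝ E
  let φ : E →ₗ[ℝ] (Fin (Module.finrank ℝ E) → ℝ) :=
    LinearMap.pi fun i => (massBilin hS).flip (b i)
  have hφ : Function.Injective φ := by
    refine (injective_iff_map_eq_zero _).2 fun u hu => ?_
    refine massBilin_injective hS (b.ext fun i => ?_)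
    rw [map_zero]
    exact congrFun hu i
  obtain ⟨ψ, hψ⟩ := φ.exists_leftInverse_of_injective (LinearMap.ker_eq_bot.2 hφ)
  have h1 : Differentiable ℝ fun y => φ (f y) :=
    differentiable_pi.2 fun i => hf (b i)
  have h2 : f = fun y => ψ.toContinuousLinearMap (φ (f y)) := by
    funext y
    exact (LinearMap.congr_fun hψ (f y)).symm
  rw [h2]
  exact ψ.toContinuousLinearMap.differentiable.comp h1

theorem hasFDerivAt_massForm_acceleration (hS : IsDiscretization Ω c ι) (hg : ContDiff ℝ 1 g)
    (hacc : IsAccelerationMap Ω c g F ι acc)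
    (t : ℝ) (u w : E) :
    ∃ A : E →L[ℝ] ℝ,
      HasFDerivAt (fun v : E => massForm Ω (ι (acc t v)) (ι w)) A u ∧
      ∀ x : E, A x = -(∫ y in Ω, deriv g ((ι u) y) * (ι w) y
        * (ι x) y) - stiffForm Ω c (ι x) (ι w) := by
  have := hS.finiteDimensional
  obtain ⟨h1, h2⟩ := hasFDerivAt_nonlinForm hS hg u w
  have h3 : HasFDerivAt (fun v : E => stiffForm Ω c (ι v) (ι w))
      (((stiffBilin hS).flip w).toContinuousLinearMap) u :=
    (((stiffBilin hS).flip w).toContinuousLinearMap).hasFDerivAt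
  have h4 : (fun v => massForm Ω (ι (acc t v)) (ι w)) = fun v =>
      loadForm Ω (F t) (ι w) - nonlinForm Ω g (ι v) (ι w) - stiffForm Ω c (ι v) (ι w) := by
    funext v
    linarith [hacc t v w]
  have h5 := (h1.const_sub (loadForm Ω (F t) (ι w))).sub h3
  refine ⟨_, h5.congr_of_eventuallyEq (Filter.EventuallyEq.of_eq h4), fun x => ?_⟩
  rw [_root_.sub_apply, _root_.neg_apply, ContinuousLinearMap.integral_apply h2]
  rfl

theorem differentiable_acceleration (hS : IsDiscretization Ω c ι) (hg : ContDiff ℝ 1 g)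
    (hacc : IsAccelerationMap Ω c g F ι acc) (t : ℝ) :
    Differentiable ℝ (acc t) :=
  differentiable_of_massForm hS fun w u => by
    obtain ⟨A, hA, -⟩ := hasFDerivAt_massForm_acceleration hS hg hacc t u w
    exact hA.differentiableAt

/-- With G' = g, the acceleration is the gradient, for the mass form, of u ↦ (F, u) - ½(c²∇u, ∇u) -
∫G(u). Accordingly the explicit derivative, from g' and the stiffness form, is symmetric in x and y.
-/
theorem massCLM_fderiv_acceleration_comm (hS : IsDiscretization Ω c ι) (hg : ContDiff ℝ 1 g)
    (hacc : IsAccelerationMap Ω c g F ι acc)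
    (t : ℝ) (u x y : E) :
    massCLM hS (fderiv ℝ (acc t) u x) y
      = massCLM hS (fderiv ℝ (acc t) u y) x := by
  have key : ∀ x y : E, massCLM hS (fderiv ℝ (acc t) u x) y
      = -(∫ z in Ω, deriv g ((ι u) z) * (ι y) z
        * (ι x) z) - stiffForm Ω c (ι x) (ι y) := by
    intro x y
    obtain ⟨A, hA, hA'⟩ := hasFDerivAt_massForm_acceleration hS hg hacc t u y
    rw [← hA' x]
    have h1 : HasFDerivAt (fun v : E => massForm Ω (ι (acc t v)) (ι y))
        (((massCLM hS).flip y).comp (fderiv ℝ (acc t) u)) u :=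
      ((massCLM hS).flip y).hasFDerivAt.comp u
        (differentiable_acceleration hS hg hacc t u).hasFDerivAt
    rw [hA.unique h1]
    rfl
  rw [key, key, stiffForm_comm]
  simp only [mul_right_comm]

end SemiDiscrete

/-! ### The schemes for a second-order equation -/

theorem isGaussRule_gaussNodes {p : ℕ} (hp : 1 ≤ p) : IsGaussRule (gaussNodes p) p where
  card := card_gaussNodes hp
  mem _ hi := (gauss_pos hp hi).1
  pos _ hi := (gauss_pos hp hi).2
  exact _ hr := gauss_exact hp hr

section BilinSchemes

variable {E : Type*} [NormedAddCommGroup E] [NormedSpace ℝ E] {M : E →L[ℝ] E →L[ℝ] ℝ}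
  {acc : ℝ → E → E} {N : ℕ} {τ : Fin (N + 1) → ℝ} {p : ℕ} {nodes : Finset ℝ}

theorem bilinScheme_and_reconstruction_iff_isPRKSolution (hτ : StrictMono τ) (hN : N ≠ 0)
    (hpos : ∀ x, x ≠ 0 → 0 < M x x) (hG : IsGaussRule nodes p) {U V : ℝ → E}
    (hU : IsTrial τ p U) (hV : IsTrial τ p V) {U₀ V₀ : E} :
    (BilinScheme M acc nodes τ p U₀ V₀ U ∧ BilinReconstruction M τ p V₀ U V) ↔
      IsPRKSolution (collocation nodes) (collocation nodes) (fun _ _ v => v) (fun t u _ => acc t u)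
        τ U₀ V₀ (fun n => U (τ n)) (fun n => V (τ n)) (fun n i => U (slabTime τ n i))
        (fun n i => V (slabTime τ n i)) := by
  obtain ⟨P, hP⟩ := (isTrial_iff hτ).1 hU
  obtain ⟨Q, hQ⟩ := (isTrial_iff hτ).1 hV
  rw [bilinScheme_and_reconstruction_iff hτ hN hpos hG hP hQ, isPRKSolution_collocation_iff hG hP hQ]

theorem bilinScheme_and_reconstruction_iff_isRKSolution (hτ : StrictMono τ) (hN : N ≠ 0)
    (hpos : ∀ x, x ≠ 0 → 0 < M x x) (hG : IsGaussRule nodes p) {U V : ℝ → E}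
    (hU : IsTrial τ p U) (hV : IsTrial τ p V) {U₀ V₀ : E} :
    (BilinScheme M acc nodes τ p U₀ V₀ U ∧ BilinReconstruction M τ p V₀ U V) ↔
      IsRKSolution (collocation nodes) (fun t y => (y.2, acc t y.1)) τ (U₀, V₀)
        (fun n => (U (τ n), V (τ n))) (fun n i => (U (slabTime τ n i), V (slabTime τ n i))) :=
  (bilinScheme_and_reconstruction_iff_isPRKSolution hτ hN hpos hG hU hV).trans
    (isRKSolution_collocation_iff (y := fun n => (U (τ n), V (τ n)))
      (Y := fun n i => (U (slabTime τ n i), V (slabTime τ n i)))).symm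

theorem exists_gauss_trial_of_stages (hτ : StrictMono τ) (hN : N ≠ 0) (hG : IsGaussRule nodes p)
    {U₀ V₀ : E} {y : Fin (N + 1) → E × E} {Y : Fin N → nodes → E × E}
    (h : IsRKSolution (collocation nodes) (fun t y => (y.2, acc t y.1)) τ (U₀, V₀) y Y) :
    ∃ U V : ℝ → E,
      (IsTrial τ p U ∧ IsTrial τ p V ∧ (∀ n, (U (τ n), V (τ n)) = y n) ∧
        (∀ (n : Fin N) (i : nodes), (U (slabTime τ n i), V (slabTime τ n i)) = Y n i)) ∧
      ∀ U' V' : ℝ → E,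
        (IsTrial τ p U' ∧ IsTrial τ p V' ∧ (∀ n, (U' (τ n), V' (τ n)) = y n) ∧
          (∀ (n : Fin N) (i : nodes), (U' (slabTime τ n i), V' (slabTime τ n i)) = Y n i)) →
        EqOn U' U (Icc (τ 0) (τ (Fin.last N))) ∧ EqOn V' V (Icc (τ 0) (τ (Fin.last N))) := by
  obtain ⟨-, -, h⟩ := isRKSolution_collocation_iff.1 h
  obtain ⟨U, hU, hUy, hUY, hU'⟩ := exists_collocation_trial_of_stages hτ hN hG
    (y := fun n => (y n).1) (K := fun n i => (Y n i).2) (fun n => (h n).1) (fun n => (h n).2.2.1)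
  obtain ⟨V, hV, hVy, hVY, hV'⟩ := exists_collocation_trial_of_stages hτ hN hG
    (y := fun n => (y n).2) (K := fun n i => acc (slabTime τ n i) (Y n i).1)
    (fun n => (h n).2.1) (fun n => (h n).2.2.2)
  refine ⟨U, V, ⟨hU, hV, fun n => Prod.ext (hUy n) (hVy n),
    fun n i => Prod.ext (hUY n i) (hVY n i)⟩, ?_⟩
  rintro U' V' ⟨h1, h2, h3, h4⟩
  exact ⟨hU' U' h1 (fun n => congrArg Prod.fst (h3 n)) (fun n i => congrArg Prod.fst (h4 n i)),
    hV' V' h2 (fun n => congrArg Prod.snd (h3 n)) (fun n i => congrArg Prod.snd (h4 n i))⟩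

theorem slabTime_mem_Icc (hτ : StrictMono τ) (n : Fin N) {x : ℝ} (hx : x ∈ Icc (0 : ℝ) 1) :
    slabTime τ n x ∈ Icc (τ 0) (τ (Fin.last N)) := by
  have h0 : τ 0 ≤ τ n.castSucc := hτ.monotone (Fin.zero_le _)
  have h1 : τ n.succ ≤ τ (Fin.last N) := hτ.monotone (Fin.le_last _)
  have h2 : τ n.castSucc ≤ τ n.succ := hτ.monotone (Fin.castSucc_lt_succ).le
  rw [slabTime, stepSize]
  constructor <;> nlinarith [hx.1, hx.2]

/-- `Φ` is differentiable on `D` and its derivative preserves the symplectic form of `M`. -/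
def IsBilinSymplecticOn (M : E →L[ℝ] E →L[ℝ] ℝ) (Φ : E × E → E × E) (D : Set (E × E)) : Prop :=
  ∀ y ∈ D, DifferentiableAt ℝ Φ y ∧ ∀ ξ η : E × E,
    M (fderiv ℝ Φ y ξ).1 (fderiv ℝ Φ y η).2 - M (fderiv ℝ Φ y ξ).2 (fderiv ℝ Φ y η).1
      = M ξ.1 η.2 - M ξ.2 η.1

theorem IsBilinSymplecticOn.of_hasFDerivAt {q r : E × E → E} {D : Set (E × E)}
    (h : ∀ y ∈ D, ∃ q' r' : E × E →L[ℝ] E, HasFDerivAt q q' y ∧ HasFDerivAt r r' y ∧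
      ∀ ξ η, M (q' ξ) (r' η) - M (r' ξ) (q' η) = M ξ.1 η.2 - M ξ.2 η.1) :
    IsBilinSymplecticOn M (fun y => (q y, r y)) D := by
  intro y hy
  obtain ⟨q', r', hq, hr, hω⟩ := h y hy
  have := hq.prodMk hr
  refine ⟨this.differentiableAt, fun ξ η => ?_⟩
  rw [this.fderiv]
  exact hω ξ η

theorem gauss_flow_symplectic (hτ : StrictMono τ) (hN : N ≠ 0)
    (hpos : ∀ x, x ≠ 0 → 0 < M x x) (hM : ∀ x y, M x y = M y x) (hG : IsGaussRule nodes p)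
    (hacc : ∀ t, Differentiable ℝ (acc t))
    (hacc' : ∀ t u x y, M (fderiv ℝ (acc t) u x) y = M (fderiv ℝ (acc t) u y) x)
    {D : Set (E × E)} (hD : IsOpen D) {U V : E × E → ℝ → E}
    (hsol : ∀ y ∈ D, BilinScheme M acc nodes τ p y.1 y.2 (U y) ∧
      BilinReconstruction M τ p y.2 (U y) (V y))
    (hU : ∀ t ∈ Icc (τ 0) (τ (Fin.last N)), DifferentiableOn ℝ (fun y => U y t) D)
    (n : Fin (N + 1)) : IsBilinSymplecticOn M (fun y => (U y (τ n), V y (τ n))) D :=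
  .of_hasFDerivAt (prk_flow_symplectic hM hacc hacc' (B₁ := collocation nodes)
    (B₂ := collocation nodes) (fun _ => rfl) hG.symplectic hD
    (q := fun y n => U y (τ n)) (r := fun y n => V y (τ n))
    (fun y hy => (bilinScheme_and_reconstruction_iff_isPRKSolution hτ hN hpos hG (hsol y hy).1.1
      (hsol y hy).2.1).1 (hsol y hy))
    (fun n i => hU _ (slabTime_mem_Icc hτ n (hG.mem_Icc i i.2))) n)

theorem lobatto_flow_symplectic (hτ : StrictMono τ) (hp : 1 ≤ p)
    (hpos : ∀ x, x ≠ 0 → 0 < M x x) (hM : ∀ x y, M x y = M y x)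
    (hacc : ∀ t, Differentiable ℝ (acc t))
    (hacc' : ∀ t u x y, M (fderiv ℝ (acc t) u x) y = M (fderiv ℝ (acc t) u y) x)
    {D : Set (E × E)} (hD : IsOpen D) {U : E × E → ℝ → E} {v : E × E → Fin (N + 1) → E}
    (hsol : ∀ y ∈ D, BilinScheme M acc (lobattoNodes p) τ p y.1 y.2 (U y) ∧
      BilinHybrid M acc (lobattoNodes p) τ p y.2 (U y) (v y))
    (hU : ∀ t ∈ Icc (τ 0) (τ (Fin.last N)), DifferentiableOn ℝ (fun y => U y t) D)
    (n : Fin (N + 1)) : IsBilinSymplecticOn M (fun y => (U y (τ n), v y n)) D :=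
  .of_hasFDerivAt (prk_flow_symplectic hM hacc hacc' (B₁ := lobattoIIIA p)
    (B₂ := lobattoIIIB p) (fun _ => rfl) (lobatto_symplectic hp) hD
    (q := fun y n => U y (τ n)) (r := v)
    (fun y hy => (bilinScheme_and_hybrid_iff hτ hp hpos (hsol y hy).1.1).1 (hsol y hy))
    (fun n i => hU _ (slabTime_mem_Icc hτ n (lobattoNodes_subset hp i.2))) n)

end BilinSchemes

/-! ### The schemes for the wave equation -/

section WaveSchemes

variable {d : ℕ} {Ω : Set (RSpace d)} {c : RSpace d → ℝ} {E : Type*} [NormedAddCommGroup E]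
  [NormedSpace ℝ E] {ι : E → (RSpace d →ᵇ ℝ)} {g : ℝ → ℝ} {F : ℝ → Lp ℝ 2 (volume.restrict Ω)}
  {acc : ℝ → E → E} {N : ℕ} {τ : Fin (N + 1) → ℝ} {p : ℕ} {nodes : Finset ℝ}

/-- The acceleration identity holds at every time, so the three spatial terms combine node by node
into one mass pairing. This reduces the wave schemes to those for u'' = acc(t, u). -/
theorem slabQuad_acceleration {X : Type*} {j : X → (RSpace d →ᵇ ℝ)} {a : ℝ → X → X}
    (ha : IsAccelerationMap Ω c g F j a) (n : Fin N) (U W : ℝ → X) :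
    slabQuad nodes τ n (fun t => massForm Ω (j (a t (U t))) (j (W t)))
      = slabQuad nodes τ n (fun t => loadForm Ω (F t) (j (W t)))
        - slabQuad nodes τ n (fun t => nonlinForm Ω g (j (U t)) (j (W t)))
        - slabQuad nodes τ n (fun t => stiffForm Ω c (j (U t)) (j (W t))) := by
  have h : ∀ t u w, massForm Ω (j (a t u)) (j w)
      = loadForm Ω (F t) (j w) - nonlinForm Ω g (j u) (j w) - stiffForm Ω c (j u) (j w) := by
    intro t u w
    linarith [ha t u w]
  simp only [slabQuad, h, mul_sub, Finset.sum_sub_distrib]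

theorem bilinScheme_massCLM_iff (hS : IsDiscretization Ω c ι)
    (hacc : IsAccelerationMap Ω c g F ι acc) {U₀ V₀ : E} {U : ℝ → E} :
    BilinScheme (massCLM hS) acc nodes τ p U₀ V₀ U ↔
      IsTrial τ p U ∧ U (τ 0) = U₀ ∧
      ∀ W : ℝ → E, IsTrial τ p W → W (τ (Fin.last N)) = 0 →
        -(∫ t in (τ 0)..(τ (Fin.last N)), massForm Ω (ι (deriv U t)) (ι (deriv W t)))
          + ∑ n, slabQuad nodes τ n (fun t => stiffForm Ω c (ι (U t)) (ι (W t)))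
          + ∑ n, slabQuad nodes τ n (fun t => nonlinForm Ω g (ι (U t)) (ι (W t)))
        = ∑ n, slabQuad nodes τ n (fun t => loadForm Ω (F t) (ι (W t)))
          + massForm Ω (ι V₀) (ι (W (τ 0))) := by
  simp only [BilinScheme, massCLM_apply, slabQuad_acceleration hacc, Finset.sum_sub_distrib]
  refine and_congr_right' (and_congr_right' (forall_congr' fun W => imp_congr_right fun _ =>
    imp_congr_right fun _ => ?_))
  constructor <;> intro h <;> linarith

theorem bilinHybrid_massCLM_iff (hS : IsDiscretization Ω c ι)
    (hacc : IsAccelerationMap Ω c g F ι acc) {V₀ : E} {U : ℝ → E} {v : Fin (N + 1) → E} :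
    BilinHybrid (massCLM hS) acc nodes τ p V₀ U v ↔
      v 0 = V₀ ∧
      ∀ (n : Fin N) (l : ℝ → E), IsPolyOn (τ n.castSucc) (τ n.succ) p l →
        (∫ t in (τ n.castSucc)..(τ n.succ),
            massForm Ω (ι (slabDeriv τ (slabDeriv τ U n) n t)) (ι (l t)))
          + massForm Ω (ι (v n.succ - slabDeriv τ U n (τ n.succ))) (ι (l (τ n.succ)))
          - massForm Ω (ι (v n.castSucc - slabDeriv τ U n (τ n.castSucc))) (ι (l (τ n.castSucc)))
          + slabQuad nodes τ n (fun t => stiffForm Ω c (ι (U t)) (ι (l t)))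
          + slabQuad nodes τ n (fun t => nonlinForm Ω g (ι (U t)) (ι (l t)))
        = slabQuad nodes τ n (fun t => loadForm Ω (F t) (ι (l t))) := by
  simp only [BilinHybrid, massCLM_apply, slabQuad_acceleration hacc]
  refine and_congr_right' (forall_congr' fun n => forall_congr' fun l =>
    imp_congr_right fun _ => ?_)
  constructor <;> intro h <;> linarith

variable {S : Submodule ℝ (RSpace d →ᵇ ℝ)}

theorem isDiscretization_of_le_feSpace (hΩ : IsOpen Ω)
    {K : Geometry.SimplicialComplex ℝ (RSpace d)} (hKfin : K.faces.Finite)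
    (hK : K.space = closure Ω) {px : ℕ} (hS : S ≤ feSpace Ω K px)
    (hc : ContinuousOn c (closure Ω)) :
    IsDiscretization (E := S) Ω c (fun u => u.1) where
  isOpen := hΩ
  finite := by
    have hcomp : IsCompact (closure Ω) := hK ▸ isCompact_space hKfin
    exact ⟨by
      rw [Measure.restrict_apply_univ]
      exact (measure_mono subset_closure).trans_lt hcomp.measure_lt_top⟩
  finiteDimensional := by
    have := finiteDimensional_feSpace hKfin hK hΩ px
    exact Submodule.finiteDimensional_of_le hS
  map_add _ _ := rfl
  map_smul _ _ := rfl
  norm_map _ := rfl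
  eq_zero u x hx := (hS u.2).1 x hx
  gradient_bound u := exists_gradient_bound hKfin hK hΩ (hS u.2)
  coeff_meas := (hc.mono subset_closure).aestronglyMeasurable hΩ.measurableSet
  coeff_bound := by
    have hcomp : IsCompact (closure Ω) := hK ▸ isCompact_space hKfin
    obtain ⟨C, hC⟩ := hcomp.exists_bound_of_continuousOn hc
    exact ⟨C, fun x hx => hC x (subset_closure hx)⟩

theorem isAcceleration_iff (hS : IsDiscretization (E := S) Ω c (fun u => u.1)) (hg : Continuous g)
    (t : ℝ) (u a : S) : IsAcceleration Ω c g F S t u a ↔ a = acceleration Ω c g F S t u := by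
  have hex : ∃! a : S, IsAcceleration Ω c g F S t u a := existsUnique_acceleration hS hg t u
  have hacc : IsAcceleration Ω c g F S t u (acceleration Ω c g F S t u) := by
    rw [acceleration, dif_pos hex.exists]
    exact hex.exists.choose_spec
  exact ⟨fun h => hex.unique h hacc, fun h => h ▸ hacc⟩

theorem isAccelerationMap_acceleration (hS : IsDiscretization (E := S) Ω c (fun u => u.1))
    (hg : Continuous g) :
    IsAccelerationMap (X := S) Ω c g F (fun u => u.1) (acceleration Ω c g F S) :=
  fun t u w => (isAcceleration_iff hS hg t u _).2 rfl w

theorem solvesQuadScheme_iff (hS : IsDiscretization (E := S) Ω c (fun u => u.1))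
    (hg : Continuous g) {U₀ V₀ : S} {U : ℝ → S} :
    SolvesQuadScheme nodes Ω c g F S τ p U₀ V₀ U ↔
      BilinScheme (E := S) (massCLM hS) (acceleration Ω c g F S) nodes τ p U₀ V₀ U :=
  (bilinScheme_massCLM_iff hS (isAccelerationMap_acceleration hS hg)).symm

theorem isReconstruction_iff (hS : IsDiscretization (E := S) Ω c (fun u => u.1))
    {V₀ : S} {U V : ℝ → S} :
    IsReconstruction Ω S τ p V₀ U V ↔ BilinReconstruction (E := S) (massCLM hS) τ p V₀ U V :=
  Iff.rfl

theorem isHybridVelocity_iff (hS : IsDiscretization (E := S) Ω c (fun u => u.1))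
    (hg : Continuous g) {V₀ : S} {U : ℝ → S} {v : Fin (N + 1) → S} :
    IsHybridVelocity nodes Ω c g F S τ p V₀ U v ↔
      BilinHybrid (E := S) (massCLM hS) (acceleration Ω c g F S) nodes τ p V₀ U v :=
  (bilinHybrid_massCLM_iff hS (isAccelerationMap_acceleration hS hg)).symm

theorem isSymplecticOn_iff (hS : IsDiscretization (E := S) Ω c (fun u => u.1))
    {Φ : S × S → S × S} {D : Set (S × S)} :
    IsSymplecticOn Ω S Φ D ↔ IsBilinSymplecticOn (E := S) (massCLM hS) Φ D :=
  Iff.rfl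

end WaveSchemes

end

/-! ### Assembly of the theorem. -/

theorem theorem3p8 {d : ℕ} (hd : 1 ≤ d)
    -- the domain, its finite conforming simplicial mesh, and the discrete space
    (Ω : Set (RSpace d)) (hΩ : IsOpen Ω)
    (K : Geometry.SimplicialComplex ℝ (RSpace d)) (hKfin : K.faces.Finite)
    (hK : K.space = closure Ω)
    (px : ℕ) (hpx : 1 ≤ px)
    (S : Submodule ℝ (RSpace d →ᵇ ℝ)) (hS : S ≤ feSpace Ω K px)
    -- the data of the equation
    (c : RSpace d → ℝ) (hc : ContinuousOn c (closure Ω))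
    (c₀ : ℝ) (hc₀ : 0 < c₀) (hcpos : ∀ x ∈ Ω, c₀ ≤ c x)
    (g : ℝ → ℝ) (hg : Continuous g) (hg0 : g 0 = 0)
    (T : ℝ) (hT : 0 < T)
    (F : ℝ → MeasureTheory.Lp ℝ 2 (MeasureTheory.volume.restrict Ω))
    (hF : ContinuousOn F (Set.Icc 0 T))
    -- the time mesh and the polynomial degree in time
    {N : ℕ} (τ : Fin (N + 1) → ℝ) (hτ : StrictMono τ) (hτ0 : τ 0 = 0)
    (hτT : τ (Fin.last N) = T)
    (p : ℕ) (hp : 1 ≤ p) :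
    -- the semi-discrete system is an ordinary differential equation in `S × S`
    (∀ (t : ℝ) (u a : S),
      IsAcceleration Ω c g F S t u a ↔ a = acceleration Ω c g F S t u) ∧
    -- Gauss-Legendre: the solutions of the scheme, with the reconstructed velocity, are exactly
    -- the solutions of the Gauss-Legendre Runge-Kutta method
    (∀ U₀ V₀ : S,
      (∀ U : ℝ → S, SolvesQuadScheme (gaussNodes p) Ω c g F S τ p U₀ V₀ U →
        ∃ Vt : ℝ → S, IsReconstruction Ω S τ p V₀ U Vt ∧
          ∀ Vt' : ℝ → S, IsReconstruction Ω S τ p V₀ U Vt' → Set.EqOn Vt' Vt (Set.Icc 0 T)) ∧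
      (∀ U Vt : ℝ → S, IsTrial τ p U → IsTrial τ p Vt →
        ((SolvesQuadScheme (gaussNodes p) Ω c g F S τ p U₀ V₀ U ∧
            IsReconstruction Ω S τ p V₀ U Vt) ↔
          IsRKSolution (gaussLegendre p) (waveField Ω c g F S) τ (U₀, V₀)
            (fun n => (U (τ n), Vt (τ n)))
            (fun n i => (U (slabTime τ n i), Vt (slabTime τ n i))))) ∧
      (∀ (y : Fin (N + 1) → S × S) (Y : Fin N → gaussNodes p → S × S),
        IsRKSolution (gaussLegendre p) (waveField Ω c g F S) τ (U₀, V₀) y Y →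
        ∃ U Vt : ℝ → S,
          (IsTrial τ p U ∧ IsTrial τ p Vt ∧
            (∀ n, (U (τ n), Vt (τ n)) = y n) ∧
            (∀ (n : Fin N) (i : gaussNodes p), (U (slabTime τ n i), Vt (slabTime τ n i)) = Y n i)) ∧
          ∀ U' Vt' : ℝ → S,
            (IsTrial τ p U' ∧ IsTrial τ p Vt' ∧
              (∀ n, (U' (τ n), Vt' (τ n)) = y n) ∧
              (∀ (n : Fin N) (i : gaussNodes p), (U' (slabTime τ n i), Vt' (slabTime τ n i)) = Y n i)) →
            Set.EqOn U' U (Set.Icc 0 T) ∧ Set.EqOn Vt' Vt (Set.Icc 0 T))) ∧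
    -- Gauss-Lobatto: the solutions of the scheme, with the hybrid velocities at the mesh nodes,
    -- are exactly the solutions of the Lobatto IIIA/IIIB pair
    (∀ U₀ V₀ : S,
      (∀ U : ℝ → S, SolvesQuadScheme (lobattoNodes p) Ω c g F S τ p U₀ V₀ U →
        ∃! Vh : Fin (N + 1) → S,
          IsHybridVelocity (lobattoNodes p) Ω c g F S τ p V₀ U Vh) ∧
      (∀ (U : ℝ → S) (Vh : Fin (N + 1) → S), IsTrial τ p U →
        ((SolvesQuadScheme (lobattoNodes p) Ω c g F S τ p U₀ V₀ U ∧
            IsHybridVelocity (lobattoNodes p) Ω c g F S τ p V₀ U Vh) ↔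
          IsPRKSolution (lobattoIIIA p) (lobattoIIIB p)
            (fun _ _ v => v) (fun t u _ => acceleration Ω c g F S t u) τ U₀ V₀
            (fun n => U (τ n)) Vh
            (fun n i => U (slabTime τ n i)) (fun n i => slabDeriv τ U n (slabTime τ n i)))) ∧
      (∀ (y z : Fin (N + 1) → S) (Y Z : Fin N → lobattoNodes p → S),
        IsPRKSolution (lobattoIIIA p) (lobattoIIIB p)
          (fun _ _ v => v) (fun t u _ => acceleration Ω c g F S t u) τ U₀ V₀ y z Y Z →
        ∃ U : ℝ → S,
          (IsTrial τ p U ∧ (∀ n, U (τ n) = y n) ∧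
            (∀ (n : Fin N) (i : lobattoNodes p), U (slabTime τ n i) = Y n i) ∧
            (∀ (n : Fin N) (i : lobattoNodes p), slabDeriv τ U n (slabTime τ n i) = Z n i)) ∧
          ∀ U' : ℝ → S,
            (IsTrial τ p U' ∧ (∀ n, U' (τ n) = y n) ∧
              (∀ (n : Fin N) (i : lobattoNodes p), U' (slabTime τ n i) = Y n i) ∧
              (∀ (n : Fin N) (i : lobattoNodes p), slabDeriv τ U' n (slabTime τ n i) = Z n i)) →
            Set.EqOn U' U (Set.Icc 0 T))) ∧
    -- both schemes are symplectic: every differentiable numerical flow is a symplectic map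
    (ContDiff ℝ 1 g → ∀ D : Set (S × S), IsOpen D →
      (∀ U Vt : S × S → ℝ → S,
        (∀ y ∈ D, SolvesQuadScheme (gaussNodes p) Ω c g F S τ p y.1 y.2 (U y) ∧
          IsReconstruction Ω S τ p y.2 (U y) (Vt y)) →
        (∀ t ∈ Set.Icc 0 T, DifferentiableOn ℝ (fun y => U y t) D) →
        ∀ n, IsSymplecticOn Ω S (fun y => (U y (τ n), Vt y (τ n))) D) ∧
      (∀ (U : S × S → ℝ → S) (Vh : S × S → Fin (N + 1) → S),
        (∀ y ∈ D, SolvesQuadScheme (lobattoNodes p) Ω c g F S τ p y.1 y.2 (U y) ∧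
          IsHybridVelocity (lobattoNodes p) Ω c g F S τ p y.2 (U y) (Vh y)) →
        (∀ t ∈ Set.Icc 0 T, DifferentiableOn ℝ (fun y => U y t) D) →
        ∀ n, IsSymplecticOn Ω S (fun y => (U y (τ n), Vh y n)) D)) := by
  -- Since 0 < T there is at least one slab, needed for the slabs to cover the time interval.
  have hN : N ≠ 0 := by
    rintro rfl
    exact hT.ne (hτ0.symm.trans hτT)
  have hIcc : Icc (0 : ℝ) T = Icc (τ 0) (τ (Fin.last N)) := by rw [hτ0, hτT]
  rw [hIcc]
  have hD := isDiscretization_of_le_feSpace hΩ hKfin hK hS hc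
  have hacc := isAccelerationMap_acceleration (F := F) hD hg
  have hpos : ∀ u : S, u ≠ 0 → 0 < massCLM hD u u := fun u hu => massForm_self_pos hD hu
  have hsymm : ∀ u v : S, massCLM hD u v = massCLM hD v u := fun u v => massForm_comm _ _
  have hG := isGaussRule_gaussNodes hp
  refine ⟨isAcceleration_iff hD hg, fun U₀ V₀ => ⟨fun U hU => ?_, fun U V hU hV => ?_,
    fun y Y h => ?_⟩, fun U₀ V₀ => ⟨fun U hU => ?_, fun U v hU => ?_, fun y z Y Z h => ?_⟩,
    fun hg1 D hDo => ⟨fun U V hsol hU n => ?_, fun U v hsol hU n => ?_⟩⟩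
  · exact exists_bilinReconstruction (E := S) (M := massCLM hD) hτ hN hpos hG hU.1 V₀
  · rw [solvesQuadScheme_iff hD hg, isReconstruction_iff hD]
    exact bilinScheme_and_reconstruction_iff_isRKSolution (E := S) (M := massCLM hD) (acc := acceleration Ω c g F S) hτ hN hpos hG hU hV
  · exact exists_gauss_trial_of_stages (E := S) (acc := acceleration Ω c g F S) hτ hN hG h
  · have h := existsUnique_bilinHybrid (E := S) (M := massCLM hD) (acc := acceleration Ω c g F S) hτ hN hp hpos ((solvesQuadScheme_iff hD hg).1 hU)
    simpa only [isHybridVelocity_iff hD hg] using h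
  · rw [solvesQuadScheme_iff hD hg, isHybridVelocity_iff hD hg]
    exact bilinScheme_and_hybrid_iff (E := S) (M := massCLM hD) (acc := acceleration Ω c g F S) hτ hp hpos hU
  · exact exists_lobatto_trial_of_stages (E := S) (acc := acceleration Ω c g F S) hτ hN hp h
  · rw [isSymplecticOn_iff hD]
    refine gauss_flow_symplectic (E := S) (M := massCLM hD) (acc := acceleration Ω c g F S) hτ hN hpos hsymm hG (differentiable_acceleration hD hg1 hacc)
      (massCLM_fderiv_acceleration_comm hD hg1 hacc) hDo (fun y hy => ?_) hU n
    exact ⟨(solvesQuadScheme_iff hD hg).1 (hsol y hy).1, (hsol y hy).2⟩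
  · rw [isSymplecticOn_iff hD]
    refine lobatto_flow_symplectic (E := S) (M := massCLM hD) (acc := acceleration Ω c g F S) hτ hp hpos hsymm (differentiable_acceleration hD hg1 hacc)
      (massCLM_fderiv_acceleration_comm hD hg1 hacc) hDo (fun y hy => ?_) hU n
    exact ⟨(solvesQuadScheme_iff hD hg).1 (hsol y hy).1,
      (isHybridVelocity_iff hD hg).1 (hsol y hy).2⟩
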